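/- **Parameters.** Let $n$ be a perfect square and let $\log n$ in the parameters below denote $\lceil\log_2 n\rceil$ (which is $\log_2 n$ exactly when $n$ is a power of two). For $k\ge 1$ put $d_{n,k}=2n-k\sqrt n$, $\ell_{n,k}=k\cdot 10n^{3/2}\log n$, $g_n=40n^2\log n+8$ and $m=15n^3\log^2 n$. **Trees.** Let $C_{n,k}$ be the rooted tree in which every internal vertex has $d_{n,k}-1$ children and all leaves have depth $\ell_{n,k}$. The self-similar tree $\widehat T_{n,k}$ is obtained recursively from $C_{n,k}$ by attaching to each internal vertex of $C_{n,k}$, for each $r=1,\dots,k-1$, the roots of $d_{n,r}-d_{n,r+1}$ new copies of $\widehat T_{n,r}$, each by a new edge. **Graph.** Let $E_n$ be an $n$-regular graph on at most $2^{c\,n^2\log^2 n}$ vertices ($c$ a constant, for example $|V(E_n)|=2^{21n^2\log^2 n}$) whose two largest adjacency eigenvalues (with multiplicity) differ by at least $n/2$ and whose girth is at least $g_n$. The graph $G_n$ is obtained from $E_n$ by attaching to each vertex of $E_n$, for each $k=1,\dots,\sqrt n-1$, the roots of $d_{n,k}-d_{n,k+1}$ new copies of $\widehat T_{n,k}$,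 and then adding isolated vertices so that the total number of vertices is $2^m$. Its vertex set is $V=V_E\cup V_T\cup V_I$ (expander, tree and added isolated vertices). For $u,v\in V$ in the same component, $\mathrm{dist}_E(u,v)$ is the number of vertices of $V_E$ on a shortest path from $u$ to $v$ in $G_n$, endpoints included; otherwise $\mathrm{dist}_E(u,v)=\infty$. For $U\subseteq V$, $\mathrm{dist}_E(U,v)=\min_{u\in U}\mathrm{dist}_E(u,v)$. **Hamiltonian and oracle.** For a bijection $\pi:V\to[2^m]$ let $H_\pi=-P_\pi A_nP_\pi^{-1}$, where $A_n$ is the adjacency matrix of $G_n$ and $P_\pi$ is the permutation matrix of $\pi$, and let $\psi_\pi$ denote a unit ground state of $H_\pi$. The oracle $\mathcal O_\pi$ maps a label $x\in[2^m]$ to the set of labels of the neighbours of $\pi^{-1}(x)$. Let $\psi_{\mathrm{in}}$ be a unit vector in $\mathbb C^V$, let $\psi_{\mathrm{in},\pi}=P_\pi\psi_{\mathrm{in}}$ and $p_{\mathrm{in},\pi}(x)=|\langle x|\psi_{\mathrm{in},\pi}\rangle|^2$. **Proposition (Hardness of exploring the graph $G_n$).** Let $a,b\ge 1$ and $c$ be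 constants. There is $n_0=n_0(a,b,c)$ such that the following holds for every perfect square $n\ge n_0$ and every $E_n$ as above. The non-isolated part of $G_n$ has at most $2^m$ vertices (so that bijections $\pi:V\to[2^m]$ exist). Suppose that $|\langle\psi_{\mathrm{in},\pi}|\psi_\pi\rangle|\ge 1/n^a$ for all $\pi$, and let $t\le n^b$. Consider any randomized classical algorithm that receives $t$ samples $x_1,\dots,x_t\in[2^m]$, always makes fewer than $2^{\sqrt n}$ adaptive queries to $\mathcal O_\pi$, and outputs some $y\in[2^m]$. The algorithm may depend on $n$, $E_n$ and $\psi_{\mathrm{in}}$, but not on $\pi$. For a uniformly random $\pi$ and independent $x_1,\dots,x_t\sim p_{\mathrm{in},\pi}$, $$\Pr\Big[\pi^{-1}(y)\notin V_I\ \text{ and }\ \mathrm{dist}_E\big(\pi^{-1}(\{x_1,\dots,x_t\}),\pi^{-1}(y)\big)\ge g_n/2\Big]\le 2^{-n\log_2 n}.$$ -/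

import Mathlib

open scoped ENNReal

noncomputable section

namespace GuidedSampling

/-! ## Parameters -/

/-- Base-2 logarithm of `n`, rounded up (exact when `n` is a power of two). -/
def lg (n : ℕ) : ℕ := Nat.clog 2 n

/-- Degree sequence `d_{n,k} = 2n - k√n`. -/
def degSeq (n k : ℕ) : ℕ := 2 * n - k * n.sqrt

/-- Depth sequence `ℓ_{n,k} = k · 10 n^{3/2} log n`. -/
def depthSeq (n k : ℕ) : ℕ := k * (10 * (n * n.sqrt) * lg n)

/-- Girth parameter `g_n = 40 n² log n + 8`. -/
def girthParam (n : ℕ) : ℕ := 40 * n ^ 2 * lg n + 8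

/-- Number of qubits: the padded graph has `2 ^ (15 n³ log² n)` vertices. -/
def numQubits (n : ℕ) : ℕ := 15 * n ^ 3 * lg n ^ 2

/-- The label set `[2^m]`. -/
abbrev Label (n : ℕ) : Type := Fin (2 ^ numQubits n)

/-! ## High-degree, high-girth expanders -/

open Classical in
/-- The two largest eigenvalues (with multiplicity) of the adjacency matrix differ by at
least `δ`. The eigenvalues `eigenvalues₀` are listed in nonincreasing order. -/
def HasAdjGap {W : Type} [Fintype W] (E : SimpleGraph W) (δ : ℝ) : Prop :=
  ∃ h : 1 < Fintype.card W,
    δ ≤ (SimpleGraph.isHermitian_adjMatrix (R := ℝ) (G := E)).eigenvalues₀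
          ⟨0, Nat.zero_lt_of_lt h⟩
        - (SimpleGraph.isHermitian_adjMatrix (R := ℝ) (G := E)).eigenvalues₀ ⟨1, h⟩

open Classical in
/-- An `n`-regular graph on at most `2 ^ (c n² log² n)` vertices, with spectral gap at least
`n / 2` and girth at least `g_n`. -/
structure IsHighGirthExpander (c n : ℕ) {N : ℕ} (E : SimpleGraph (Fin N)) : Prop where
  card_le : N ≤ 2 ^ (c * n ^ 2 * lg n ^ 2)
  regular : E.IsRegularOfDegree n
  gap : HasAdjGap E (n / 2)
  girth : (girthParam n : ℕ∞) ≤ E.egirth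

/-! ## Self-similar trees -/

/-- `TreeVertex n k j` is the set of vertices lying weakly below a vertex of depth `j` of the
perfect tree `C_{n,k}`, inside the full-level decorated tree `T̂_{n,k}`. A leaf (`j = ℓ_{n,k}`)
has nothing below it. An internal vertex has `d_{n,k} - 1` children in `C_{n,k}` and, for each
`1 ≤ r < k`, `d_{n,r} - d_{n,r+1}` further children, each the root of a copy of `T̂_{n,r}`.
A vertex is thus encoded by the downward path that leads to it. -/
inductive TreeVertex (n : ℕ) : ℕ → ℕ → Type
  | here {k j : ℕ} : TreeVertex n k j
  | base {k j : ℕ} (h : j < depthSeq n k) (c : Fin (degSeq n k - 1))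
      (w : TreeVertex n k (j + 1)) : TreeVertex n k j
  | deco {k j : ℕ} (h : j < depthSeq n k) (r : ℕ) (hr : 1 ≤ r ∧ r < k)
      (i : Fin (degSeq n r - degSeq n (r + 1))) (w : TreeVertex n r 0) : TreeVertex n k j

/-- `IsChild v w`: the vertex `w` is a child of the vertex `v`. -/
inductive TreeVertex.IsChild {n : ℕ} :
    {k j : ℕ} → TreeVertex n k j → TreeVertex n k j → Prop
  | base_root {k j : ℕ} (h : j < depthSeq n k) (c : Fin (degSeq n k - 1)) :
      IsChild (k := k) (j := j) .here (.base h c .here)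
  | deco_root {k j : ℕ} (h : j < depthSeq n k) (r : ℕ) (hr : 1 ≤ r ∧ r < k)
      (i : Fin (degSeq n r - degSeq n (r + 1))) :
      IsChild (k := k) (j := j) .here (.deco h r hr i .here)
  | base_step {k j : ℕ} (h : j < depthSeq n k) (c : Fin (degSeq n k - 1))
      {v w : TreeVertex n k (j + 1)} (hvw : IsChild v w) :
      IsChild (TreeVertex.base h c v) (TreeVertex.base h c w)
  | deco_step {k j : ℕ} (h : j < depthSeq n k) (r : ℕ) (hr : 1 ≤ r ∧ r < k)
      (i : Fin (degSeq n r - degSeq n (r + 1)))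
      {v w : TreeVertex n r 0} (hvw : IsChild v w) :
      IsChild (k := k) (j := j) (TreeVertex.deco h r hr i v) (TreeVertex.deco h r hr i w)

/-- The full-level decorated tree `T̂_{n,k}`, with root `TreeVertex.here`. -/
def selfSimilarTree (n k : ℕ) : SimpleGraph (TreeVertex n k 0) :=
  SimpleGraph.fromRel TreeVertex.IsChild

theorem TreeVertex.finite_of (n k : ℕ)
    (ih : ∀ r < k, Finite (TreeVertex n r 0)) :
    ∀ s j : ℕ, depthSeq n k - j = s → Finite (TreeVertex n k j) := by
  have hD : Finite (Σ r : Fin k, Fin (degSeq n r - degSeq n (r + 1)) × TreeVertex n r 0) := by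
    have : ∀ r : Fin k, Finite (TreeVertex n r 0) := fun r => ih r r.2
    infer_instance
  intro s
  induction s with
  | zero =>
    intro j hj
    have hlt : ¬ j < depthSeq n k := by omega
    have : Subsingleton (TreeVertex n k j) := by
      constructor
      intro a b
      cases a with
      | here => cases b with
        | here => rfl
        | base h => exact absurd h hlt
        | deco h => exact absurd h hlt
      | base h => exact absurd h hlt
      | deco h => exact absurd h hlt
    infer_instance
  | succ s ihs =>
    intro j hj
    have hN : Finite (TreeVertex n k (j + 1)) := ihs (j + 1) (by omega)
    have hlt : j < depthSeq n k := by omega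
    let f : Option ((Fin (degSeq n k - 1) × TreeVertex n k (j + 1)) ⊕
        {x : Σ r : Fin k, Fin (degSeq n r - degSeq n (r + 1)) × TreeVertex n r 0 //
          1 ≤ (x.1 : ℕ)}) → TreeVertex n k j := fun x => match x with
      | none => .here
      | some (.inl (c, w)) => .base hlt c w
      | some (.inr ⟨⟨r, i, w⟩, hr⟩) => .deco hlt r ⟨hr, r.2⟩ i w
    refine Finite.of_surjective f ?_
    intro y
    cases y with
    | here => exact ⟨none, rfl⟩
    | base h c w => exact ⟨some (.inl (c, w)), rfl⟩
    | deco h r hr i w => exact ⟨some (.inr ⟨⟨⟨r, hr.2⟩, i, w⟩, hr.1⟩), rfl⟩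

instance TreeVertex.instFinite (n k j : ℕ) : Finite (TreeVertex n k j) := by
  have key : ∀ k, Finite (TreeVertex n k 0) := by
    intro k
    induction k using Nat.strong_induction_on with
    | _ k ih => exact TreeVertex.finite_of n k ih _ 0 rfl
  exact TreeVertex.finite_of n k (fun r _ => key r) _ j rfl

/-! ## The main graph -/

/-- The non-isolated vertices of the main graph: the expander vertices `V_E = W`, and the tree
vertices `V_T`. To each expander vertex `u` and each `1 ≤ k < √n` are attached
`d_{n,k} - d_{n,k+1}` copies of `T̂_{n,k}`. -/
inductive CoreVertex (n : ℕ) (W : Type) : Type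
  | expander (u : W) : CoreVertex n W
  | tree (u : W) (k : ℕ) (hk : 1 ≤ k ∧ k < n.sqrt)
      (i : Fin (degSeq n k - degSeq n (k + 1))) (w : TreeVertex n k 0) : CoreVertex n W

/-- The edges of the decorated expander, each listed in at least one direction. -/
inductive CoreVertex.Link {n : ℕ} {W : Type} (E : SimpleGraph W) :
    CoreVertex n W → CoreVertex n W → Prop
  | edge {u v : W} (h : E.Adj u v) : Link E (.expander u) (.expander v)
  | root (u : W) (k : ℕ) (hk : 1 ≤ k ∧ k < n.sqrt)
      (i : Fin (degSeq n k - degSeq n (k + 1))) :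
      Link E (.expander u) (.tree u k hk i .here)
  | inner (u : W) (k : ℕ) (hk : 1 ≤ k ∧ k < n.sqrt)
      (i : Fin (degSeq n k - degSeq n (k + 1))) {v w : TreeVertex n k 0}
      (h : (selfSimilarTree n k).Adj v w) :
      Link E (.tree u k hk i v) (.tree u k hk i w)

/-- The expander `E` decorated with self-similar trees. -/
def coreGraph (n : ℕ) {W : Type} (E : SimpleGraph W) : SimpleGraph (CoreVertex n W) :=
  SimpleGraph.fromRel (CoreVertex.Link E)

instance CoreVertex.instFinite (n : ℕ) (W : Type) [Finite W] : Finite (CoreVertex n W) := by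
  let f : W ⊕ (W × {x : Σ k : Fin n.sqrt,
      Fin (degSeq n k - degSeq n (k + 1)) × TreeVertex n k 0 // 1 ≤ (x.1 : ℕ)}) →
      CoreVertex n W := fun x => match x with
    | .inl u => .expander u
    | .inr (u, ⟨⟨k, i, w⟩, hk⟩) => .tree u k ⟨hk, k.2⟩ i w
  refine Finite.of_surjective f ?_
  intro y
  cases y with
  | expander u => exact ⟨.inl u, rfl⟩
  | tree u k hk i w => exact ⟨.inr (u, ⟨⟨⟨k, hk.2⟩, i, w⟩, hk.1⟩), rfl⟩

/-- The number of isolated vertices that pad the graph to `2 ^ (15 n³ log² n)` vertices. -/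
def numIsolated (n : ℕ) (W : Type) : ℕ := 2 ^ numQubits n - Nat.card (CoreVertex n W)

/-- The vertex set `V = (V_E ∪ V_T) ∪ V_I`. -/
abbrev Vertex (n : ℕ) (W : Type) : Type := CoreVertex n W ⊕ Fin (numIsolated n W)

instance Vertex.instFintype (n : ℕ) (W : Type) [Finite W] : Fintype (Vertex n W) :=
  Fintype.ofFinite _

/-- The main graph `G_n` built on the expander `E`. -/
def mainGraph (n : ℕ) {W : Type} (E : SimpleGraph W) : SimpleGraph (Vertex n W) :=
  coreGraph n E ⊕g (⊥ : SimpleGraph (Fin (numIsolated n W)))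

/-- The set `V_E` of expander vertices. -/
def expanderVertices (n : ℕ) (W : Type) : Set (Vertex n W) :=
  Set.range fun u : W => Sum.inl (CoreVertex.expander u)

/-- The set `V_I` of isolated (padding) vertices. -/
def isolatedVertices (n : ℕ) (W : Type) : Set (Vertex n W) := Set.range Sum.inr

open Classical in
/-- `dist_E(u, v)`: the number of expander vertices along a shortest path from `u` to `v` in the
main graph (endpoints included). It is `⊤` if no path connects `u` and `v`. -/
def distE (n : ℕ) {W : Type} (E : SimpleGraph W) (u v : Vertex n W) : ℕ∞ :=
  ⨅ (p : (mainGraph n E).Walk u v) (_ : p.length = (mainGraph n E).dist u v),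
    ((p.support.countP fun w => decide (w ∈ expanderVertices n W) : ℕ) : ℕ∞)

/-- `dist_E(U, v) = min_{u ∈ U} dist_E(u, v)`. -/
def distESet (n : ℕ) {W : Type} (E : SimpleGraph W) (U : Set (Vertex n W))
    (v : Vertex n W) : ℕ∞ :=
  ⨅ u ∈ U, distE n E u v

/-! ## Hamiltonian, ground state, guiding states -/

/-- A labeling `π : V → [2^m]`. -/
abbrev Labeling (n : ℕ) (W : Type) : Type := Vertex n W ≃ Label n

instance Labeling.instFintype (n : ℕ) (W : Type) [Finite W] : Fintype (Labeling n W) :=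
  Fintype.ofFinite _

open Classical in
/-- The Hamiltonian `H_π = - P_π A_n P_π⁻¹`, where `A_n` is the adjacency matrix of `G_n`. -/
def hamiltonian {n : ℕ} {W : Type} (E : SimpleGraph W) (π : Labeling n W) :
    Matrix (Label n) (Label n) ℂ :=
  -(((mainGraph n E).adjMatrix ℂ).reindex π π)

/-- `ψ` is a ground state of `H`: a unit eigenvector for the smallest eigenvalue. -/
def IsGroundState {ι : Type} [Fintype ι] (H : Matrix ι ι ℂ) (ψ : EuclideanSpace ℂ ι) : Prop :=
  ‖ψ‖ = 1 ∧ ∃ e : ℝ, H.mulVec ψ.ofLp = (e : ℂ) • ψ.ofLp ∧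
    ∀ (e' : ℝ) (φ : ι → ℂ), φ ≠ 0 → H.mulVec φ = (e' : ℂ) • φ → e ≤ e'

/-- The relabeled state `P_π ψ`. -/
def relabelState {n : ℕ} {W : Type} [Finite W] (π : Labeling n W)
    (ψ : EuclideanSpace ℂ (Vertex n W)) : EuclideanSpace ℂ (Label n) :=
  WithLp.toLp 2 fun x => ψ (π.symm x)

theorem relabelState_norm {n : ℕ} {W : Type} [Finite W] (π : Labeling n W)
    (ψ : EuclideanSpace ℂ (Vertex n W)) : ‖relabelState π ψ‖ = ‖ψ‖ := by
  simp only [EuclideanSpace.norm_eq, relabelState]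
  congr 1
  exact Equiv.sum_comp π.symm fun v => ‖ψ v‖ ^ 2

/-- The distribution `x ↦ |⟨x|ψ⟩|²` of a standard-basis measurement of the unit vector `ψ`. -/
def measureState {ι : Type} [Fintype ι] (ψ : EuclideanSpace ℂ ι) (hψ : ‖ψ‖ = 1) : PMF ι :=
  PMF.ofFintype (fun x => ENNReal.ofReal (‖ψ x‖ ^ 2)) (by
    rw [← ENNReal.ofReal_sum_of_nonneg (fun _ _ => by positivity),
      ← EuclideanSpace.norm_sq_eq, hψ]
    simp)

/-! ## Classical query algorithms -/

open Classical in
/-- The adjacency-list oracle: on a label `x`, the set of labels of the neighbors of the vertex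
`π⁻¹(x)`. -/
def oracle {n : ℕ} {W : Type} (E : SimpleGraph W) (π : Labeling n W) (x : Label n) :
    Finset (Label n) :=
  {x' | (mainGraph n E).Adj (π.symm x) (π.symm x')}

/-- A deterministic adaptive query algorithm: it either stops with an output in `X`, or queries
the oracle at some `x` and continues according to the answer. -/
inductive QueryTree (X A : Type) : Type
  | output (y : X) : QueryTree X A
  | query (x : X) (next : A → QueryTree X A) : QueryTree X A

/-- The output on the oracle `O`. -/
def QueryTree.run {X A : Type} (O : X → A) : QueryTree X A → X
  | .output y => y
  | .query x next => (next (O x)).run O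

/-- The number of queries made on the oracle `O`. -/
def QueryTree.numQueries {X A : Type} (O : X → A) : QueryTree X A → ℕ
  | .output _ => 0
  | .query x next => (next (O x)).numQueries O + 1

/-- A randomized classical algorithm with `t` input samples: given the samples, it draws its
random coins, which determine a deterministic query algorithm. -/
abbrev ClassicalAlgorithm (n t : ℕ) : Type :=
  (Fin t → Label n) → PMF (QueryTree (Label n) (Finset (Label n)))

/-- On every labeling, every input and every outcome of its coins, the algorithm makes fewer than
`q` queries to the adjacency-list oracle. -/
def ClassicalAlgorithm.MakesFewerThan {n t : ℕ} (alg : ClassicalAlgorithm n t)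
    {W : Type} (E : SimpleGraph W) (q : ℕ) : Prop :=
  ∀ (π : Labeling n W) (x : Fin t → Label n), ∀ T ∈ (alg x).support,
    T.numQueries (oracle E π) < q

/-- `t` independent samples from `p`. -/
def iidSamples {X : Type} (p : PMF X) : (t : ℕ) → PMF (Fin t → X)
  | 0 => PMF.pure Fin.elim0
  | t + 1 => p.bind fun a => (iidSamples p t).map fun x => Fin.cons a x

/-- The joint distribution `J_π` of the input samples `x₁, …, x_t ∼ p` and the output `y` of the
algorithm run with the oracle `O_π`. -/
def inputOutput {n t : ℕ} (alg : ClassicalAlgorithm n t) {W : Type} (E : SimpleGraph W)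
    (p : PMF (Label n)) (π : Labeling n W) : PMF ((Fin t → Label n) × Label n) :=
  (iidSamples p t).bind fun x => (alg x).map fun T => (x, T.run (oracle E π))

/-- The joint distribution of `(π, (x₁, …, x_t, y))`, where `π` is a uniformly random labeling and
`(x₁, …, x_t, y) ∼ J_π` with input samples drawn from the measurement distribution of the guiding
state `P_π ψ`. -/
def experiment {n t : ℕ} (alg : ClassicalAlgorithm n t) {W : Type} [Finite W]
    (E : SimpleGraph W) [Nonempty (Labeling n W)]
    (ψ : EuclideanSpace ℂ (Vertex n W)) (hψ : ‖ψ‖ = 1) :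
    PMF (Labeling n W × ((Fin t → Label n) × Label n)) :=
  (PMF.uniformOfFintype (Labeling n W)).bind fun π =>
    (inputOutput alg E
      (measureState (relabelState π ψ) ((relabelState_norm π ψ).trans hψ)) π).map
      fun z => (π, z)

/-- The event that the output vertex is an expander or tree vertex at `dist_E`-distance at least
`g_n / 2` from the set of input vertices. -/
def farEvent (n t : ℕ) {W : Type} (E : SimpleGraph W) :
    Set (Labeling n W × ((Fin t → Label n) × Label n)) :=
  {z | z.1.symm z.2.2 ∉ isolatedVertices n W ∧
    ((girthParam n / 2 : ℕ) : ℕ∞) ≤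
      distESet n E (z.1.symm '' Set.range z.2.1) (z.1.symm z.2.2)}

end GuidedSampling

end

/-!
Write `n = K²`. All a classical algorithm gains from the guiding state is samples, and with fewer than
`2 ^ K` queries it cannot leave the neighborhood of its samples in the expander, because it keeps
getting lost in the self-similar trees.

*Reduction.* The samples can be drawn as vertices before the labeling is drawn. So it suffices to
fix the sampled vertices `vs`, their labels `xs` and the coins, hence a deterministic query tree,
and to count the labelings compatible with `vs` and `xs` for which the output is bad
(`experiment_toOuterMeasure_le`, `card_far_mul_le`).

*Cautious runs.* The run is compared with a cautious one, in which queries at labels not seen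
before are answered by `∅`. The two agree unless an unseen label of a non-isolated vertex is hit,
and this is unlikely because almost all labels belong to isolated vertices
(`card_exists_guesses_le`). A cautious run explores the graph from the samples along edges.

*The hull.* The expander vertices to which the samples are attached have a hull: the points on short
paths between points of the hull. By the girth condition the hull stays close to the
samples (`hull_subset_within`), and around it the expander looks like a forest
(`eq_of_mem_within`). Together with its trees this is a `Forest` (`CoreVertex.forest`): each inner
vertex has one child in each of the same number of slots, whatever its level, and a child has the
smaller of the levels of its parent and its slot. All the exploration can do to leave the
neighborhood of the hull is to walk down this forest to a vertex where the forest is cut out.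

*Blind runs.* Inner vertices all look alike. A difference between the levels shows only when the
end of a branch is seen. Fix a level `r`. Cyclically shifting, in each of `x` generations below a
vertex `v`, the slots of level at least `r` does not change what the algorithm sees until it sees
the end of a branch of level at least `r`. Hence it gets `x` generations below `v` with a level
still above `r` only with probability `(κ / M) ^ x`, where `M` slots have level at least `r` and `κ`
have a level above `r` (`Forest.card_exists_blind_le`). As `κ / M ≤ 1 - 1 / (2K)`, this is tiny for
`x = 3K³ log n`.

*Doubling.* If there are no such blind runs, then within `2 ^ r` steps after its first visit to a
vertex the exploration gets less than `2x` generations below it at levels at least `r`: one of the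
halves of a deeper path would take at most `2 ^ (r - 1)` steps, hence would require the end of a
branch of level at least `r - 1` to be found in this time, but all of these are too far away
(`Forest.depth_lt_of_not_blind`). For `r = K` this says that `2 ^ K` steps do not suffice to get
through the forest.
-/

noncomputable section

namespace GuidedSampling

/-! ### Cautious runs of a query algorithm -/

/-- The element of `X` that a query tree is about to query, or its output if it has stopped. -/
def QueryTree.current {X A : Type} : QueryTree X A → X
  | .output y => y
  | .query x _ => x

open Classical in
/-- One step of a *cautious* run. Its state is a set of known labels together with the remaining
query tree. A query at a known label is answered by the oracle, and the labels in the answer become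
known; a query at an unknown label is answered by `∅`. A stopped run stays where it is. -/
def cautiousStep {X : Type} (O : X → Finset X) (s : Set X × QueryTree X (Finset X)) :
    Set X × QueryTree X (Finset X) :=
  match s.2 with
  | .output _ => s
  | .query z next => if z ∈ s.1 then (s.1 ∪ ↑(O z), next (O z)) else (s.1, next ∅)

/-- The state of the cautious run after `j` steps. -/
def cautiousRun {X : Type} (O : X → Finset X) (S : Set X) (T : QueryTree X (Finset X)) :
    ℕ → Set X × QueryTree X (Finset X)
  | 0 => (S, T)
  | j + 1 => cautiousStep O (cautiousRun O S T j)

section Cautious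

variable {X : Type} {O O' : X → Finset X} {S S' : Set X} {T : QueryTree X (Finset X)}

theorem cautiousStep_congr {s : Set X × QueryTree X (Finset X)}
    (h : s.2.current ∈ s.1 → O s.2.current = O' s.2.current) :
    cautiousStep O s = cautiousStep O' s := by
  obtain ⟨K, T⟩ := s
  cases T with
  | output y => rfl
  | query z next =>
    by_cases hz : z ∈ K
    · have : O z = O' z := h hz
      simp [cautiousStep, hz, this]
    · simp [cautiousStep, hz]

theorem mem_cautiousStep_of_query {K : Set X} {y z : X} {next : Finset X → QueryTree X (Finset X)}
    (hy : y ∈ K) (h : z ∈ O y) : z ∈ (cautiousStep O (K, .query y next)).1 := by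
  simp [cautiousStep, hy, h]

theorem subset_cautiousStep (s : Set X × QueryTree X (Finset X)) :
    s.1 ⊆ (cautiousStep O s).1 := by
  obtain ⟨K, T⟩ := s
  cases T with
  | output y => exact subset_rfl
  | query y next =>
    by_cases hy : y ∈ K
    · simp [cautiousStep, hy]
    · simp [cautiousStep, hy]

theorem mem_cautiousStep {s : Set X × QueryTree X (Finset X)} {z : X}
    (h : z ∈ (cautiousStep O s).1) :
    z ∈ s.1 ∨ (s.2.current ∈ s.1 ∧ z ∈ O s.2.current) := by
  obtain ⟨K, T⟩ := s
  cases T with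
  | output y => exact Or.inl h
  | query y next =>
    by_cases hy : y ∈ K
    · simp only [cautiousStep, hy, if_true, Set.mem_union, Finset.mem_coe] at h
      exact h.imp id fun h => ⟨hy, h⟩
    · simp only [cautiousStep, hy, if_false] at h
      exact Or.inl h

theorem exists_of_mem_cautiousRun {z : X} :
    ∀ {j : ℕ}, z ∈ (cautiousRun O S T j).1 → z ∈ S ∨ ∃ i < j,
      (cautiousRun O S T i).2.current ∈ (cautiousRun O S T i).1 ∧
        z ∈ O (cautiousRun O S T i).2.current
  | 0, h => Or.inl h
  | j + 1, h => by
    rcases mem_cautiousStep h with h | h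
    · rcases exists_of_mem_cautiousRun h with h | ⟨i, hi, h⟩
      · exact Or.inl h
      · exact Or.inr ⟨i, by omega, h⟩
    · exact Or.inr ⟨j, by omega, h⟩

theorem cautiousRun_succ' (j : ℕ) :
    cautiousRun O S T (j + 1)
      = cautiousRun O (cautiousStep O (S, T)).1 (cautiousStep O (S, T)).2 j := by
  induction j with
  | zero => rfl
  | succ j ih => rw [cautiousRun, ih]; rfl

/-- A cautious run in which every unknown label has an empty answer follows the actual run. -/
theorem exists_cautiousRun_current_eq_run {q : ℕ} (hq : T.numQueries O < q)
    (h : ∀ j < q, (cautiousRun O S T j).2.current ∉ (cautiousRun O S T j).1 →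
      O (cautiousRun O S T j).2.current = ∅) :
    ∃ j < q, (cautiousRun O S T j).2.current = T.run O := by
  induction T generalizing S q with
  | output y => exact ⟨0, by omega, rfl⟩
  | query z next ih =>
    obtain ⟨q, rfl⟩ : ∃ r, q = r + 1 := ⟨q - 1, by omega⟩
    have hstep : (cautiousStep O (S, .query z next)).2 = next (O z) := by
      by_cases hz : z ∈ S
      · simp [cautiousStep, hz]
      · have := h 0 (by omega) hz
        simp only [cautiousRun, QueryTree.current] at this
        simp [cautiousStep, hz, this]
    have hq' : (next (O z)).numQueries O < q := by
      simp only [QueryTree.numQueries] at hq; omega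
    obtain ⟨j, hj, hj'⟩ := ih (O z) (S := (cautiousStep O (S, .query z next)).1) hq' (by
      intro j hj
      have := h (j + 1) (by omega)
      rw [cautiousRun_succ', hstep] at this
      exact this)
    refine ⟨j + 1, by omega, ?_⟩
    rw [cautiousRun_succ', hstep, hj']
    rfl

end Cautious

/-! ### Exploring a labeled graph -/

section Explore

variable {V X : Type} [Fintype X]

open Classical in
/-- The adjacency-list oracle of a graph `G` with vertex labels `π`. -/
def labelOracle (G : SimpleGraph V) (π : V ≃ X) (x : X) : Finset X :=
  {x' | G.Adj (π.symm x) (π.symm x')}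

theorem mem_labelOracle {G : SimpleGraph V} {π : V ≃ X} {x x' : X} :
    x' ∈ labelOracle G π x ↔ G.Adj (π.symm x) (π.symm x') := by
  simp [labelOracle]

/-- The cautious run on the labeled graph, when the labels of the vertices in `R` are known from
the start. -/
def explore (G : SimpleGraph V) (R : Set V) (T : QueryTree X (Finset X)) (π : V ≃ X) (j : ℕ) :
    Set X × QueryTree X (Finset X) :=
  cautiousRun (labelOracle G π) (π '' R) T j

/-- The set of vertices whose labels are known after `j` steps. -/
def Known (G : SimpleGraph V) (R : Set V) (T : QueryTree X (Finset X)) (π : V ≃ X) (j : ℕ) :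
    Set V :=
  {u | π u ∈ (explore G R T π j).1}

/-- In step `j` the cautious run queries (or outputs) the known label of `u`. -/
def Visits (G : SimpleGraph V) (R : Set V) (T : QueryTree X (Finset X)) (π : V ≃ X) (j : ℕ)
    (u : V) : Prop :=
  (explore G R T π j).2.current = π u ∧ u ∈ Known G R T π j

variable {G : SimpleGraph V} {R : Set V} {T : QueryTree X (Finset X)} {π : V ≃ X} {j : ℕ} {u : V}

theorem mem_known : u ∈ Known G R T π j ↔ π u ∈ (explore G R T π j).1 := Iff.rfl

theorem explore_succ :
    explore G R T π (j + 1) = cautiousStep (labelOracle G π) (explore G R T π j) := rfl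

theorem known_mono {i : ℕ} (h : i ≤ j) : Known G R T π i ⊆ Known G R T π j := by
  induction h with
  | refl => exact subset_rfl
  | step _ ih => exact fun u hu => subset_cautiousStep _ (ih hu)

theorem Visits.unique {u' : V} (h : Visits G R T π j u) (h' : Visits G R T π j u') : u = u' :=
  π.injective (h.1.symm.trans h'.1)

theorem visits_of_current_mem
    (h : (explore G R T π j).2.current ∈ (explore G R T π j).1) :
    Visits G R T π j (π.symm (explore G R T π j).2.current) := by
  refine ⟨by simp, ?_⟩
  simpa [Known] using h

theorem known_cases (h : u ∈ Known G R T π j) :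
    u ∈ R ∨ ∃ i < j, ∃ w, Visits G R T π i w ∧ G.Adj w u := by
  rcases exists_of_mem_cautiousRun h with ⟨w, hw, hwu⟩ | ⟨i, hi, h1, h2⟩
  · exact Or.inl (π.injective hwu ▸ hw)
  · refine Or.inr ⟨i, hi, _, visits_of_current_mem h1, ?_⟩
    have h3 := mem_labelOracle.1 h2
    rwa [π.symm_apply_apply] at h3

theorem known_succ (h : u ∈ Known G R T π (j + 1)) :
    u ∈ Known G R T π j ∨ ∃ w, Visits G R T π j w ∧ G.Adj w u := by
  rcases mem_cautiousStep h with h | ⟨h1, h2⟩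
  · exact Or.inl h
  · refine Or.inr ⟨_, visits_of_current_mem h1, ?_⟩
    have h3 := mem_labelOracle.1 h2
    rwa [π.symm_apply_apply] at h3

end Explore

/-! ### Self-similar forests inside a graph -/

/-- A self-similar forest in a graph `G`, hanging off a set of revealed vertices. Every inner vertex
of the forest has, besides its parent, one child in each of `D` slots. The level of a child is the
minimum of the level of its parent and the level `lam c` of its slot, and `dep` counts the steps
since the current level was entered. A branch of level `k` ends at `dep = ell k`. The neighborhoods
of the ends of level `K` are left unspecified: this is where the forest is cut out of `G`. The
vertices of the forest form the set `hidden`, `ht` is the depth in the forest, and the values of the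
functions outside `hidden` do not matter. -/
structure Forest {V : Type} (G : SimpleGraph V) (D K : ℕ) (lam : Fin D → ℕ) (ell : ℕ → ℕ) where
  revealed : Set V
  hidden : Set V
  level : V → ℕ
  dep : V → ℕ
  ht : V → ℕ
  par : V → V
  child : V → Fin D → V
  disjoint : ∀ u ∈ revealed, u ∉ hidden
  level_pos : ∀ u ∈ hidden, 1 ≤ level u
  level_le : ∀ u ∈ hidden, level u ≤ K
  dep_le : ∀ u ∈ hidden, dep u ≤ ell (level u)
  child_hidden : ∀ u ∈ hidden, dep u < ell (level u) → ∀ c, child u c ∈ hidden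
  child_inj : ∀ u ∈ hidden, dep u < ell (level u) → Function.Injective (child u)
  par_child : ∀ u ∈ hidden, dep u < ell (level u) → ∀ c, par (child u c) = u
  level_child : ∀ u ∈ hidden, dep u < ell (level u) → ∀ c,
    level (child u c) = min (level u) (lam c)
  dep_child : ∀ u ∈ hidden, dep u < ell (level u) → ∀ c,
    dep (child u c) = if level u ≤ lam c then dep u + 1 else 0
  ht_child : ∀ u ∈ hidden, dep u < ell (level u) → ∀ c, ht (child u c) = ht u + 1
  adj_inner : ∀ u ∈ hidden, dep u < ell (level u) → ∀ w,
    (G.Adj u w ↔ w = par u ∨ ∃ c, w = child u c)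
  adj_leaf : ∀ u ∈ hidden, dep u = ell (level u) → level u < K → ∀ w, (G.Adj u w ↔ w = par u)
  adj_revealed : ∀ u ∈ revealed, ∀ w, G.Adj u w → w ∈ revealed ∨ (w ∈ hidden ∧ par w = u)
  hidden_cases : ∀ u ∈ hidden, (par u ∈ revealed ∧ level u = K ∧ dep u = 1) ∨
    ((par u ∈ hidden ∧ dep (par u) < ell (level (par u))) ∧ ∃ c, u = child (par u) c)

namespace Forest

variable {V : Type} {G : SimpleGraph V} {D K : ℕ} {lam : Fin D → ℕ} {ell : ℕ → ℕ}
  (F : Forest G D K lam ell)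

/-- A vertex of the forest that has children. -/
def Inner (u : V) : Prop := u ∈ F.hidden ∧ F.dep u < ell (F.level u)

/-- The end of a branch of the forest. -/
def Term (u : V) : Prop := u ∈ F.hidden ∧ F.dep u = ell (F.level u)

/-- An end of level `K`, where the forest is cut out of the graph. -/
def Cut (u : V) : Prop := F.Term u ∧ F.level u = K

/-- `F.Desc v s u`: the vertex `u` lies `s` steps below `v`. -/
inductive Desc (v : V) : ℕ → V → Prop
  | refl : Desc v 0 v
  | step {s : ℕ} {u : V} (h : Desc v s u) (hu : F.Inner u) (c : Fin D) :
      Desc v (s + 1) (F.child u c)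

/-- The set of vertices strictly below `v`. -/
def Below (v : V) : Set V := {u | ∃ s, F.Desc v (s + 1) u}

variable {F} {v u w : V} {s : ℕ}

theorem inner_or_term (h : u ∈ F.hidden) : F.Inner u ∨ F.Term u :=
  (F.dep_le u h).lt_or_eq.imp (fun h' => ⟨h, h'⟩) fun h' => ⟨h, h'⟩

theorem Inner.child_hidden (h : F.Inner u) (c : Fin D) : F.child u c ∈ F.hidden :=
  F.child_hidden u h.1 h.2 c

theorem Inner.par_child (h : F.Inner u) (c : Fin D) : F.par (F.child u c) = u :=
  F.par_child u h.1 h.2 c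

theorem Inner.adj (h : F.Inner u) : G.Adj u w ↔ w = F.par u ∨ ∃ c, w = F.child u c :=
  F.adj_inner u h.1 h.2 w

theorem Desc.inner (h : F.Desc v (s + 1) u) : ∃ u', F.Desc v s u' ∧ F.Inner u' ∧
    ∃ c, u = F.child u' c := by
  cases h with
  | step h' hu c => exact ⟨_, h', hu, c, rfl⟩

theorem Desc.par (h : F.Desc v (s + 1) u) : F.Desc v s (F.par u) ∧ F.Inner (F.par u) ∧
    ∃ c, u = F.child (F.par u) c := by
  obtain ⟨u', hd, hu, c, rfl⟩ := h.inner
  rw [hu.par_child]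
  exact ⟨hd, hu, c, rfl⟩

theorem Desc.hidden (hv : v ∈ F.hidden) (h : F.Desc v s u) : u ∈ F.hidden := by
  cases h with
  | refl => exact hv
  | step h hu c => exact hu.child_hidden c

theorem Desc.hidden_of_succ (h : F.Desc v (s + 1) u) : u ∈ F.hidden := by
  obtain ⟨u', h, hu, c, rfl⟩ := h.inner
  exact hu.child_hidden c

theorem Desc.ht (h : F.Desc v s u) : F.ht u = F.ht v + s := by
  induction h with
  | refl => rfl
  | step h hu c ih => rw [F.ht_child _ hu.1 hu.2, ih]; omega

theorem Desc.level_le (h : F.Desc v s u) : F.level u ≤ F.level v := by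
  induction h with
  | refl => exact le_rfl
  | step h hu c ih => rw [F.level_child _ hu.1 hu.2]; omega

theorem Desc.trans {s' : ℕ} (h : F.Desc v s u) (h' : F.Desc u s' w) : F.Desc v (s + s') w := by
  induction h' with
  | refl => exact h
  | step _ hu c ih => exact ih.step hu c

theorem hidden_of_mem_below (h : u ∈ F.Below v) : u ∈ F.hidden := by
  obtain ⟨s, h⟩ := h
  exact h.hidden_of_succ

theorem par_of_mem_below (h : u ∈ F.Below v) :
    (F.par u = v ∨ F.par u ∈ F.Below v) ∧ F.par u ∈ F.hidden := by
  obtain ⟨s, h⟩ := h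
  obtain ⟨h1, h2, -⟩ := h.par
  refine ⟨?_, h2.1⟩
  cases s with
  | zero => cases h1; exact Or.inl rfl
  | succ s => exact Or.inr ⟨s, h1⟩

theorem self_notMem_below : v ∉ F.Below v := by
  rintro ⟨s, h⟩
  have := h.ht
  omega

theorem child_mem_below (h : u = v ∨ u ∈ F.Below v) (hu : F.Inner u) (c : Fin D) :
    F.child u c ∈ F.Below v := by
  rcases h with rfl | ⟨s, h⟩
  · exact ⟨0, Desc.refl.step hu c⟩
  · exact ⟨s + 1, h.step hu c⟩

theorem mem_below_of_par (hu : u ∈ F.hidden) (h : F.par u = v ∨ F.par u ∈ F.Below v)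
    (hp : F.par u ∈ F.hidden) : u ∈ F.Below v := by
  rcases F.hidden_cases u hu with ⟨h1, -⟩ | ⟨h1, c, h2⟩
  · exact absurd hp (F.disjoint _ h1)
  · rw [h2]
    exact child_mem_below h h1 c

/-- The neighbors of a vertex of the forest lie in the forest or are revealed. -/
theorem adj_mem (hu : u ∈ F.revealed ∨ u ∈ F.hidden) (hc : ¬ F.Cut u) (h : G.Adj u w) :
    w ∈ F.revealed ∨ w ∈ F.hidden := by
  have key : ∀ u ∈ F.hidden, F.par u ∈ F.revealed ∨ F.par u ∈ F.hidden := fun u hu =>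
    (F.hidden_cases u hu).imp (fun h => h.1) fun h => h.1.1
  rcases hu with hu | hu
  · exact (F.adj_revealed u hu w h).imp id fun h => h.1
  · rcases inner_or_term hu with hi | ht
    · rcases hi.adj.1 h with rfl | ⟨c, rfl⟩
      · exact key u hu
      · exact Or.inr (hi.child_hidden c)
    · have hlt : F.level u < K := lt_of_le_of_ne (F.level_le u hu) fun h => hc ⟨ht, h⟩
      rw [(F.adj_leaf u hu ht.2 hlt w).1 h]
      exact key u hu

/-- The only vertex outside `F.Below v` with neighbors in `F.Below v` is `v`. -/
theorem notMem_below_of_adj (hu : u ∈ F.revealed ∨ u ∈ F.hidden)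
    (hc : ¬ F.Cut u) (huv : u ≠ v) (hub : u ∉ F.Below v) (h : G.Adj u w) : w ∉ F.Below v := by
  intro hw
  rcases hu with hu | hu
  · rcases F.adj_revealed u hu w h with h | ⟨-, h⟩
    · exact F.disjoint _ h (hidden_of_mem_below hw)
    · exact F.disjoint _ hu (h ▸ (par_of_mem_below hw).2)
  · have key : w = F.par u → False := by
      rintro rfl
      exact hub (mem_below_of_par hu (Or.inr hw) (hidden_of_mem_below hw))
    rcases inner_or_term hu with hi | ht
    · rcases hi.adj.1 h with h | ⟨c, rfl⟩
      · exact key h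
      · have := (par_of_mem_below hw).1
        rw [hi.par_child] at this
        exact this.elim huv hub
    · have hlt : F.level u < K := lt_of_le_of_ne (F.level_le u hu) fun h => hc ⟨ht, h⟩
      exact key ((F.adj_leaf u hu ht.2 hlt w).1 h)

/-! ### Shuffling the slots below a vertex -/

section Shuffle

variable {Γ : Type} {x : ℕ} (F) (sh : Γ → Equiv.Perm (Fin D)) (g : Fin x → Γ)

/-- The permutation of the slots `s` steps below the base vertex. -/
def slotPerm (s : ℕ) : Equiv.Perm (Fin D) := if h : s < x then sh (g ⟨s, h⟩) else 1

/-- The vertex at an address below `v` when the slots are shuffled by `g`. The most recent step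
of the address comes first. -/
def place (v : V) : List (Fin D) → V
  | [] => v
  | i :: p => F.child (place v p) (slotPerm sh g p.length i)

/-- The address leads downward through inner vertices only. -/
def Valid (v : V) : List (Fin D) → Prop
  | [] => True
  | _ :: p => Valid v p ∧ F.Inner (F.place sh g v p)

variable {F sh g} {p q : List (Fin D)}

theorem Valid.desc (h : F.Valid sh g v p) : F.Desc v p.length (F.place sh g v p) := by
  induction p with
  | nil => exact Desc.refl
  | cons i p ih => exact (ih h.1).step h.2 _

theorem Desc.exists_valid (h : F.Desc v s u) :
    ∃ p, F.Valid sh g v p ∧ p.length = s ∧ F.place sh g v p = u := by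
  induction h with
  | refl => exact ⟨[], trivial, rfl, rfl⟩
  | @step s u h hu c ih =>
    obtain ⟨p, hp, hs, rfl⟩ := ih
    exact ⟨(slotPerm sh g p.length).symm c :: p, ⟨hp, hu⟩, by simp [hs], by simp [place]⟩

theorem Valid.place_inj (hp : F.Valid sh g v p) (hq : F.Valid sh g v q)
    (h : F.place sh g v p = F.place sh g v q) : p = q := by
  have hl : p.length = q.length := by
    have h1 := hp.desc.ht
    have h2 := hq.desc.ht
    rw [h] at h1
    omega
  induction p generalizing q with
  | nil => exact (List.length_eq_zero_iff.1 hl.symm).symm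
  | cons i p ih =>
    cases q with
    | nil => simp at hl
    | cons j q =>
      simp only [List.length_cons, add_left_inj] at hl
      have h1 : F.place sh g v p = F.place sh g v q := by
        have := congrArg F.par h
        simpa only [place, hp.2.par_child, hq.2.par_child] using this
      obtain rfl := ih hp.1 hq.1 h1 hl
      simp only [place] at h
      have := (slotPerm sh g p.length).injective (F.child_inj _ hp.2.1 hp.2.2 h)
      rw [this]

theorem Valid.mem_below (hp : F.Valid sh g v p) (h : p ≠ []) : F.place sh g v p ∈ F.Below v := by
  cases p with
  | nil => exact absurd rfl h
  | cons i p => exact ⟨p.length, hp.desc⟩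

/-- Shuffles of slots of level at least `r` are invisible if levels are only known up to `r`. -/
theorem Valid.level_eq {r : ℕ} {g' : Fin x → Γ}
    (hsh : ∀ γ i, min (lam (sh γ i)) r = min (lam i) r)
    (h : F.Valid sh g v p) (h' : F.Valid sh g' v p) :
    min (F.level (F.place sh g v p)) r = min (F.level (F.place sh g' v p)) r ∧
      (F.level (F.place sh g v p) < r →
        F.dep (F.place sh g v p) = F.dep (F.place sh g' v p)) := by
  have hperm : ∀ (g : Fin x → Γ) s i, min (lam (slotPerm sh g s i)) r = min (lam i) r := by
    intro g s i
    unfold slotPerm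
    split_ifs
    · exact hsh _ _
    · rfl
  induction p with
  | nil => exact ⟨rfl, fun _ => rfl⟩
  | cons i p ih =>
    obtain ⟨h1, h2⟩ := ih h.1 h'.1
    simp only [place]
    rw [F.level_child _ h.2.1 h.2.2, F.level_child _ h'.2.1 h'.2.2, F.dep_child _ h.2.1 h.2.2,
      F.dep_child _ h'.2.1 h'.2.2]
    have e1 := hperm g p.length i
    have e2 := hperm g' p.length i
    refine ⟨by omega, fun hlt => ?_⟩
    by_cases hr : F.level (F.place sh g v p) < r
    · have := h2 hr
      split_ifs <;> omega
    · split_ifs <;> omega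

/-- The levels of the slots along a valid address bound the level of the vertex it leads to. -/
theorem Valid.le_lam (h : F.Valid sh g v p) {r : ℕ} (hr : r ≤ F.level (F.place sh g v p))
    (hl : p.length ≤ x) (s : Fin x) (hs : (s : ℕ) < p.length) :
    r ≤ lam (sh (g s) (p.reverse[(s : ℕ)]'(by simpa using hs))) := by
  induction p with
  | nil => simp at hs
  | cons i p ih =>
    simp only [place] at hr
    rw [F.level_child _ h.2.1 h.2.2] at hr
    simp only [List.length_cons] at hs hl
    rcases Nat.lt_succ_iff_lt_or_eq.1 hs with hs' | hs'
    · have := ih h.1 (by omega) (by omega) hs'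
      simpa [List.getElem_append, hs'] using this
    · have h1 : slotPerm sh g p.length = sh (g s) := by
        rw [slotPerm, dif_pos (by omega)]
        congr 2
        exact Fin.ext hs'.symm
      rw [h1] at hr
      have h2 : r ≤ lam (sh (g s) i) := by omega
      simpa [List.getElem_append, hs'] using h2

end Shuffle
end Forest
namespace Forest

variable {V : Type} {G : SimpleGraph V} {D K : ℕ} {lam : Fin D → ℕ} {ell : ℕ → ℕ}
  {F : Forest G D K lam ell} {v u w : V}

theorem par_mem (hu : u ∈ F.hidden) : F.par u ∈ F.revealed ∨ F.par u ∈ F.hidden :=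
  (F.hidden_cases u hu).imp (fun h => h.1) fun h => h.1.1

theorem par_notMem_below (hv : v ∈ F.hidden) : F.par v ∉ F.Below v := by
  rintro ⟨s, h⟩
  rcases F.hidden_cases v hv with ⟨h1, -⟩ | ⟨h1, c, h2⟩
  · exact F.disjoint _ h1 h.hidden_of_succ
  · have e1 := F.ht_child _ h1.1 h1.2 c
    rw [← h2] at e1
    have e2 := h.ht
    omega

section Twin

variable {Γ : Type} {x : ℕ} {sh : Γ → Equiv.Perm (Fin D)} {g g₁ g₂ : Fin x → Γ} {I : Set V}

/-- `u₁` and `u₂` play the same role for the shuffles `g₁` and `g₂`: either they are the same vertex,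
which no shuffle affects, or they have the same address below `v`. -/
def Twin (F : Forest G D K lam ell) (sh : Γ → Equiv.Perm (Fin D)) (I : Set V) (v : V)
    (g₁ g₂ : Fin x → Γ) (u₁ u₂ : V) : Prop :=
  (u₁ = u₂ ∧ u₁ ∉ I ∧ u₁ ∉ F.Below v) ∨
    ∃ p, p ≠ [] ∧ F.Valid sh g₁ v p ∧ F.Valid sh g₂ v p ∧ u₁ = F.place sh g₁ v p ∧
      u₂ = F.place sh g₂ v p

theorem Twin.symm {u₁ u₂ : V} (h : F.Twin sh I v g₁ g₂ u₁ u₂) : F.Twin sh I v g₂ g₁ u₂ u₁ := by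
  rcases h with ⟨rfl, h⟩ | ⟨p, h0, h1, h2, h3, h4⟩
  · exact Or.inl ⟨rfl, h⟩
  · exact Or.inr ⟨p, h0, h2, h1, h4, h3⟩

/-- If no branch of level at least `r` has come to an end, then the neighborhoods of twins
consist of twins. -/
theorem Twin.exists_adj {r : ℕ} (hsh : ∀ γ i, min (lam (sh γ i)) r = min (lam i) r)
    (hI : ∀ u ∈ I, u ∉ F.revealed ∧ u ∉ F.hidden) (hv : F.Inner v) {u₁ u₂ w₁ : V}
    (h : F.Twin sh I v g₁ g₂ u₁ u₂) (hm : u₁ ∈ F.revealed ∨ u₁ ∈ F.hidden)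
    (hc₁ : ¬ F.Cut u₁) (hc₂ : ¬ F.Cut u₂)
    (ht₁ : u₁ ∈ F.Below v → r ≤ F.level u₁ → ¬ F.Term u₁)
    (ht₂ : u₂ ∈ F.Below v → r ≤ F.level u₂ → ¬ F.Term u₂) (ha : G.Adj u₁ w₁) :
    ∃ w₂, G.Adj u₂ w₂ ∧ F.Twin sh I v g₁ g₂ w₁ w₂ := by
  have hnI : ∀ u, (u ∈ F.revealed ∨ u ∈ F.hidden) → u ∉ I := fun u hu hi =>
    hu.elim (hI u hi).1 (hI u hi).2
  rcases h with ⟨rfl, h1, h2⟩ | ⟨p, h0, h1, h2, rfl, rfl⟩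
  · by_cases huv : u₁ = v
    · subst huv
      rcases hv.adj.1 ha with rfl | ⟨c, rfl⟩
      · exact ⟨_, ha, Or.inl ⟨rfl, hnI _ (par_mem hv.1), par_notMem_below hv.1⟩⟩
      · refine ⟨F.place sh g₂ u₁ [(slotPerm sh g₁ 0).symm c], ?_, Or.inr
          ⟨[(slotPerm sh g₁ 0).symm c], by simp, ⟨trivial, hv⟩, ⟨trivial, hv⟩, ?_, rfl⟩⟩
        · exact hv.adj.2 (Or.inr ⟨_, rfl⟩)
        · simp [place]
    · exact ⟨w₁, ha, Or.inl ⟨rfl, hnI _ (adj_mem hm hc₁ ha),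
        notMem_below_of_adj hm hc₁ huv h2 ha⟩⟩
  · have hb₁ := h1.mem_below h0
    have hb₂ := h2.mem_below h0
    have hh₁ := hidden_of_mem_below hb₁
    have hh₂ := hidden_of_mem_below hb₂
    have hpar : ∃ w₂, G.Adj (F.place sh g₂ v p) w₂ ∧
        F.Twin sh I v g₁ g₂ (F.par (F.place sh g₁ v p)) w₂ := by
      refine ⟨F.par (F.place sh g₂ v p), ?_, ?_⟩
      · rcases inner_or_term hh₂ with hi | ht
        · exact hi.adj.2 (Or.inl rfl)
        · have hlt : F.level (F.place sh g₂ v p) < K :=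
            lt_of_le_of_ne (F.level_le _ hh₂) fun h => hc₂ ⟨ht, h⟩
          exact (F.adj_leaf _ hh₂ ht.2 hlt _).2 rfl
      · cases p with
        | nil => exact absurd rfl h0
        | cons i p =>
          simp only [place, h1.2.par_child, h2.2.par_child]
          cases p with
          | nil => exact Or.inl ⟨rfl, hnI _ (Or.inr hv.1), self_notMem_below⟩
          | cons j p => exact Or.inr ⟨_, by simp, h1.1, h2.1, rfl, rfl⟩
    rcases inner_or_term hh₁ with hi | ht
    · rcases hi.adj.1 ha with rfl | ⟨c, rfl⟩
      · exact hpar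
      · have hi₂ : F.Inner (F.place sh g₂ v p) := by
          refine (inner_or_term hh₂).resolve_right fun ht => ?_
          have hlt : F.level (F.place sh g₂ v p) < r := by
            by_contra hge
            exact ht₂ hb₂ (by omega) ht
          obtain ⟨e1, e2⟩ := h2.level_eq hsh h1
          have e3 := e2 hlt
          have e4 := hi.2
          have e5 : F.level (F.place sh g₂ v p) = F.level (F.place sh g₁ v p) := by omega
          have e6 := ht.2
          rw [e5] at e6
          omega
        refine ⟨F.place sh g₂ v ((slotPerm sh g₁ p.length).symm c :: p), ?_, Or.inr
          ⟨(slotPerm sh g₁ p.length).symm c :: p, by simp, ⟨h1, hi⟩, ⟨h2, hi₂⟩, ?_, rfl⟩⟩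
        · exact hi₂.adj.2 (Or.inr ⟨_, rfl⟩)
        · simp [place]
    · have hlt : F.level (F.place sh g₁ v p) < K :=
        lt_of_le_of_ne (F.level_le _ hh₁) fun h => hc₁ ⟨ht, h⟩
      rw [(F.adj_leaf _ hh₁ ht.2 hlt _).1 ha]
      exact hpar

end Twin

/-! ### Arrivals and blind runs -/

section Runs

variable {X : Type} [Fintype X]

/-- In step `a` the exploration visits `v` for the first time, not having visited any cut vertex
before. -/
def Arrives (F : Forest G D K lam ell) (T : QueryTree X (Finset X)) (v : V) (a : ℕ)
    (π : V ≃ X) : Prop :=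
  Visits G F.revealed T π a v ∧ ∀ j < a, ∀ u, Visits G F.revealed T π j u → ¬ F.Cut u ∧ u ≠ v

/-- The exploration arrives at `v` in step `a`, and in step `b` it visits a vertex `x` steps below
`v` whose level is still above `r`, although no end of a branch of level at least `r` below `v`
has been visited in the meantime. -/
def Blind (F : Forest G D K lam ell) (T : QueryTree X (Finset X)) (x r : ℕ) (v : V) (a b : ℕ)
    (π : V ≃ X) : Prop :=
  F.Arrives T v a π ∧ a < b ∧
    (∀ j < b, ∀ u, Visits G F.revealed T π j u →
      ¬ F.Cut u ∧ (u ∈ F.Below v → r ≤ F.level u → ¬ F.Term u)) ∧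
    ∃ u, Visits G F.revealed T π b u ∧ F.Desc v x u ∧ r < F.level u

variable {T : QueryTree X (Finset X)} {π π₁ π₂ : V ≃ X} {a b j : ℕ} {I : Set V}

theorem known_mem (h : ∀ i < j, ∀ u, Visits G F.revealed T π i u → ¬ F.Cut u)
    (hu : u ∈ Known G F.revealed T π j) : u ∈ F.revealed ∨ u ∈ F.hidden := by
  induction j using Nat.strong_induction_on generalizing u with
  | _ j ih =>
    rcases known_cases hu with hu | ⟨i, hi, w, hw, hwu⟩
    · exact Or.inl hu
    · exact adj_mem (ih i hi (fun i' hi' => h i' (by omega)) hw.2) (h i hi w hw) hwu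

/-- Before the arrival at `v`, no vertex below `v` is known. -/
theorem Arrives.notMem_below (h : F.Arrives T v a π) (hj : j ≤ a)
    (hu : u ∈ Known G F.revealed T π j) : u ∉ F.Below v := by
  induction j using Nat.strong_induction_on generalizing u with
  | _ j ih =>
    rcases known_cases hu with hu | ⟨i, hi, w, hw, hwu⟩
    · exact fun hb => F.disjoint _ hu (hidden_of_mem_below hb)
    · exact notMem_below_of_adj
        (known_mem (fun i' hi' u' hu' => (h.2 i' (by omega) u' hu').1) hw.2)
        (h.2 i (by omega) w hw).1 (h.2 i (by omega) w hw).2 (ih i hi (by omega) hw.2) hwu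

/-- Whether and when the exploration arrives at `v` does not depend on the labels of the vertices
below `v` and of isolated vertices. -/
theorem Arrives.congr (hI : ∀ u ∈ I, u ∉ F.revealed ∧ u ∉ F.hidden)
    (hπ : ∀ u, u ∉ I → u ∉ F.Below v → π₁ u = π₂ u) (h : F.Arrives T v a π₁) :
    F.Arrives T v a π₂ := by
  have hnI : ∀ u, (u ∈ F.revealed ∨ u ∈ F.hidden) → u ∉ I := fun u hu hi =>
    hu.elim (hI u hi).1 (hI u hi).2
  have hclean : ∀ j ≤ a, ∀ i < j, ∀ u, Visits G F.revealed T π₁ i u → ¬ F.Cut u :=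
    fun j hj i hi u hu => (h.2 i (by omega) u hu).1
  have hfix : ∀ j ≤ a, ∀ u ∈ Known G F.revealed T π₁ j, π₁ u = π₂ u := fun j hj u hu =>
    hπ u (hnI u (known_mem (hclean j hj) hu)) (h.notMem_below hj hu)
  have hrun : ∀ j ≤ a, explore G F.revealed T π₁ j = explore G F.revealed T π₂ j := by
    intro j hj
    induction j with
    | zero =>
      refine Prod.ext (Set.image_congr fun u hu => ?_) rfl
      exact hπ u (hnI u (Or.inl hu)) fun hb => F.disjoint _ hu (hidden_of_mem_below hb)
    | succ j ih =>
      have ih' := ih (by omega)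
      rw [explore_succ, explore_succ, ← ih']
      refine cautiousStep_congr fun hcur => ?_
      have hvis : Visits G F.revealed T π₁ j _ := visits_of_current_mem hcur
      set u := π₁.symm (explore G F.revealed T π₁ j).2.current with hu
      rw [hvis.1]
      have hw : ∀ w, G.Adj u w → π₁ w = π₂ w := fun w hw => by
        have h1 := known_mem (hclean j (by omega)) hvis.2
        have h2 := h.2 j (by omega) u hvis
        exact hπ w (hnI w (adj_mem h1 h2.1 hw))
          (notMem_below_of_adj h1 h2.1 h2.2 (h.notMem_below (by omega) hvis.2) hw)
      have huu : π₂.symm (π₁ u) = u := by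
        rw [hfix j (by omega) u hvis.2, π₂.symm_apply_apply]
      ext z
      rw [mem_labelOracle, mem_labelOracle, huu, π₁.symm_apply_apply]
      constructor
      · intro hz
        have := hw _ hz
        rw [π₁.apply_symm_apply] at this
        rwa [this, π₂.symm_apply_apply]
      · intro hz
        have := hw _ hz
        rw [π₂.apply_symm_apply] at this
        rwa [← this, π₁.symm_apply_apply]
  have hvis : ∀ j ≤ a, ∀ u, Visits G F.revealed T π₂ j u → Visits G F.revealed T π₁ j u := by
    intro j hj u hu
    have h1 : (explore G F.revealed T π₁ j).2.current ∈ (explore G F.revealed T π₁ j).1 := by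
      rw [hrun j hj, hu.1]; exact hu.2
    have h2 : Visits G F.revealed T π₁ j _ := visits_of_current_mem h1
    have h3 : π₂ u = π₂ (π₁.symm (explore G F.revealed T π₁ j).2.current) := by
      rw [← hfix j hj _ h2.2, π₁.apply_symm_apply, hrun j hj, hu.1]
    rw [π₂.injective h3]
    exact h2
  refine ⟨⟨?_, ?_⟩, fun j hj u hu => h.2 j hj u (hvis j (by omega) u hu)⟩
  · rw [← hrun a le_rfl, h.1.1]
    exact hfix a le_rfl v h.1.2
  · rw [mem_known, ← hrun a le_rfl, ← hfix a le_rfl v h.1.2]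
    exact h.1.2

variable {Γ : Type} {x r : ℕ} {sh : Γ → Equiv.Perm (Fin D)} {g₁ g₂ : Fin x → Γ}

/-- If two labelings give twins the same labels and both lead to a blind run, then the two runs are
the same and visit twins. -/
theorem Blind.exists_twin (hsh : ∀ γ i, min (lam (sh γ i)) r = min (lam i) r)
    (hI : ∀ u ∈ I, u ∉ F.revealed ∧ u ∉ F.hidden) (hv : F.Inner v)
    (hπ : ∀ u₁ u₂, F.Twin sh I v g₁ g₂ u₁ u₂ → π₁ u₁ = π₂ u₂)
    (h₁ : F.Blind T x r v a b π₁) (h₂ : F.Blind T x r v a b π₂) :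
    ∃ u₁ u₂, Visits G F.revealed T π₁ b u₁ ∧ Visits G F.revealed T π₂ b u₂ ∧
      F.Twin sh I v g₁ g₂ u₁ u₂ := by
  have hnI : ∀ u, (u ∈ F.revealed ∨ u ∈ F.hidden) → u ∉ I := fun u hu hi =>
    hu.elim (hI u hi).1 (hI u hi).2
  have hrun : ∀ j ≤ b, explore G F.revealed T π₁ j = explore G F.revealed T π₂ j ∧
      ∀ u₁ ∈ Known G F.revealed T π₁ j, ∃ u₂, F.Twin sh I v g₁ g₂ u₁ u₂ := by
    intro j hj
    induction j with
    | zero =>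
      have hR : ∀ u ∈ F.revealed, F.Twin sh I v g₁ g₂ u u := fun u hu =>
        Or.inl ⟨rfl, hnI u (Or.inl hu), fun hb => F.disjoint _ hu (hidden_of_mem_below hb)⟩
      refine ⟨Prod.ext (Set.image_congr fun u hu => hπ u u (hR u hu)) rfl, ?_⟩
      rintro u ⟨u', hu', h⟩
      obtain rfl := π₁.injective h
      exact ⟨u', hR u' hu'⟩
    | succ j ih =>
      obtain ⟨ih1, ih2⟩ := ih (by omega)
      have hadj : ∀ u, Visits G F.revealed T π₁ j u → ∃ u₂, F.Twin sh I v g₁ g₂ u u₂ ∧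
          (∀ w, G.Adj u w → ∃ w₂, G.Adj u₂ w₂ ∧ F.Twin sh I v g₁ g₂ w w₂) ∧
          (∀ w, G.Adj u₂ w → ∃ w₁, G.Adj u w₁ ∧ F.Twin sh I v g₁ g₂ w₁ w) := by
        intro u hu
        obtain ⟨u₂, ht⟩ := ih2 u hu.2
        have hu₂ : Visits G F.revealed T π₂ j u₂ := by
          refine ⟨?_, ?_⟩
          · rw [← ih1, hu.1, hπ u u₂ ht]
          · rw [mem_known, ← ih1, ← hπ u u₂ ht]
            exact hu.2
        have c₁ := h₁.2.2.1 j (by omega) u hu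
        have c₂ := h₂.2.2.1 j (by omega) u₂ hu₂
        refine ⟨u₂, ht, fun w hw => ?_, fun w hw => ?_⟩
        · exact ht.exists_adj hsh hI hv
            (known_mem (fun i hi u hu => (h₁.2.2.1 i (by omega) u hu).1) hu.2)
            c₁.1 c₂.1 c₁.2 c₂.2 hw
        · obtain ⟨w₁, h1, h2⟩ := ht.symm.exists_adj hsh hI hv
            (known_mem (fun i hi u hu => (h₂.2.2.1 i (by omega) u hu).1) hu₂.2)
            c₂.1 c₁.1 c₂.2 c₁.2 hw
          exact ⟨w₁, h1, h2.symm⟩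
      refine ⟨?_, ?_⟩
      · rw [explore_succ, explore_succ, ← ih1]
        refine cautiousStep_congr fun hcur => ?_
        have hvis : Visits G F.revealed T π₁ j _ := visits_of_current_mem hcur
        set u := π₁.symm (explore G F.revealed T π₁ j).2.current with hu
        obtain ⟨u₂, ht, hw₁, hw₂⟩ := hadj u hvis
        rw [hvis.1]
        have huu : π₂.symm (π₁ u) = u₂ := by rw [hπ u u₂ ht, π₂.symm_apply_apply]
        ext z
        rw [mem_labelOracle, mem_labelOracle, huu, π₁.symm_apply_apply]
        constructor
        · intro hz
          obtain ⟨w₂, h1, h2⟩ := hw₁ _ hz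
          have := hπ _ _ h2
          rw [π₁.apply_symm_apply] at this
          rwa [this, π₂.symm_apply_apply]
        · intro hz
          obtain ⟨w₁, h1, h2⟩ := hw₂ _ hz
          have := hπ _ _ h2
          rw [π₂.apply_symm_apply] at this
          rwa [← this, π₁.symm_apply_apply]
      · intro u hu
        rcases known_succ hu with hu | ⟨w, hw, hwu⟩
        · exact ih2 u hu
        · obtain ⟨u₂, -, h3, -⟩ := hadj w hw
          obtain ⟨w₂, -, h4⟩ := h3 u hwu
          exact ⟨w₂, h4⟩
  obtain ⟨h1, h2⟩ := hrun b le_rfl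
  obtain ⟨u₁, hu₁, -⟩ := h₁.2.2.2
  obtain ⟨u₂, ht⟩ := h2 u₁ hu₁.2
  refine ⟨u₁, u₂, hu₁, ⟨?_, ?_⟩, ht⟩
  · rw [← h1, hu₁.1, hπ u₁ u₂ ht]
  · rw [mem_known, ← h1, ← hπ u₁ u₂ ht]
    exact hu₁.2

end Runs
end Forest
namespace Forest

/-! ### Blind runs are unlikely -/

variable {V : Type} {G : SimpleGraph V} {D K : ℕ} {lam : Fin D → ℕ} {ell : ℕ → ℕ}
  {F : Forest G D K lam ell} {v u w : V} {Γ : Type} {x : ℕ} {sh : Γ → Equiv.Perm (Fin D)}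
  {I : Set V}

theorem Desc.inner_of_succ {s : ℕ} (h : F.Desc v (s + 1) u) : F.Inner v := by
  induction s generalizing u with
  | zero =>
    obtain ⟨u', h, hu, -⟩ := h.inner
    cases h
    exact hu
  | succ s ih =>
    obtain ⟨u', h, -⟩ := h.inner
    exact ih h

/-- There is room among the vertices of `I` for all addresses that are valid in some shuffle. -/
theorem exists_address_embedding [Finite V] [Fintype Γ] (hv : v ∈ F.hidden)
    (hI : Fintype.card Γ ^ x * F.hidden.ncard ≤ I.ncard) :
    ∃ ι : List (Fin D) → V, (∀ p, (∃ g : Fin x → Γ, F.Valid sh g v p) → ι p ∈ I) ∧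
      Set.InjOn ι {p | ∃ g : Fin x → Γ, F.Valid sh g v p} := by
  classical
  have hmap : ∀ g : Fin x → Γ, Set.MapsTo (F.place sh g v) {p | F.Valid sh g v p} F.hidden :=
    fun g p hp => hp.desc.hidden hv
  have hinj : ∀ g : Fin x → Γ, Set.InjOn (F.place sh g v) {p | F.Valid sh g v p} :=
    fun g p hp q hq h => hp.place_inj hq h
  have hfin : ∀ g : Fin x → Γ, {p | F.Valid sh g v p}.Finite := fun g =>
    Set.Finite.of_injOn (hmap g) (hinj g) (Set.toFinite _)
  have hU : {p | ∃ g : Fin x → Γ, F.Valid sh g v p}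
      = ⋃ g : Fin x → Γ, {p | F.Valid sh g v p} := by
    ext p; simp
  have hUfin : {p | ∃ g : Fin x → Γ, F.Valid sh g v p}.Finite := by
    rw [hU]; exact Set.finite_iUnion hfin
  have hcard : {p | ∃ g : Fin x → Γ, F.Valid sh g v p}.ncard ≤ I.ncard := by
    refine le_trans ?_ hI
    have h1 : {p | ∃ g : Fin x → Γ, F.Valid sh g v p}
        = ((Finset.univ : Finset (Fin x → Γ)).biUnion fun g => (hfin g).toFinset : Finset _) := by
      ext p; simp
    rw [h1, Set.ncard_coe_finset]
    refine (Finset.card_biUnion_le_card_mul _ _ F.hidden.ncard ?_).trans ?_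
    · intro g _
      rw [← Set.ncard_eq_toFinset_card _ (hfin g)]
      exact Set.ncard_le_ncard_of_injOn _ (hmap g) (hinj g) (Set.toFinite _)
    · simp
  have := hUfin.to_subtype
  obtain ⟨e⟩ : Nonempty ({p | ∃ g : Fin x → Γ, F.Valid sh g v p} ↪ I) := by
    have := Fintype.ofFinite {p | ∃ g : Fin x → Γ, F.Valid sh g v p}
    have := Fintype.ofFinite I
    refine Function.Embedding.nonempty_of_card_le ?_
    rw [← Nat.card_eq_fintype_card, ← Nat.card_eq_fintype_card]
    exact hcard
  refine ⟨fun p => if h : ∃ g : Fin x → Γ, F.Valid sh g v p then e ⟨p, h⟩ else v, ?_, ?_⟩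
  · intro p hp
    simp only [dif_pos hp]
    exact (e _).2
  · intro p hp q hq h
    have hp' : ∃ g : Fin x → Γ, F.Valid sh g v p := hp
    have hq' : ∃ g : Fin x → Γ, F.Valid sh g v q := hq
    simp only [dif_pos hp', dif_pos hq'] at h
    have := e.injective (Subtype.ext h)
    exact congrArg Subtype.val this

/-- The permutation of the vertices that realizes a shuffle: it carries the reserve vertex of an
address to the vertex at that address. -/
theorem exists_shuffle_perm [Finite V] {ι : List (Fin D) → V}
    (hι : ∀ p, (∃ g : Fin x → Γ, F.Valid sh g v p) → ι p ∈ I)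
    (hinj : Set.InjOn ι {p | ∃ g : Fin x → Γ, F.Valid sh g v p}) (g : Fin x → Γ) :
    ∃ σ : Equiv.Perm V, (∀ u, u ∉ I → u ∉ F.Below v → σ u = u) ∧
      ∀ p, p ≠ [] → F.Valid sh g v p → σ (ι p) = F.place sh g v p := by
  classical
  have := Fintype.ofFinite V
  set A : Set (List (Fin D)) := {p | p ≠ [] ∧ F.Valid sh g v p} with hA
  have hAinj : Set.InjOn ι A := fun p hp q hq h => hinj ⟨g, hp.2⟩ ⟨g, hq.2⟩ h
  set f : V → V := fun u => if u ∈ I then F.place sh g v (Function.invFunOn ι A u) else u with hf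
  have hfι : ∀ p ∈ A, f (ι p) = F.place sh g v p := by
    intro p hp
    simp only [hf, if_pos (hι p ⟨g, hp.2⟩)]
    rw [hAinj.leftInvOn_invFunOn hp]
  have hff : ∀ u, u ∉ I → f u = u := fun u hu => by simp [hf, hu]
  set s : Finset V := (({u | u ∉ I ∧ u ∉ F.Below v} ∪ ι '' A : Set V)).toFinset with hs
  have hfs : Set.InjOn f s := by
    intro u hu w hw h
    simp only [hs, Set.coe_toFinset] at hu hw
    rcases hu with ⟨hu1, hu2⟩ | ⟨p, hp, rfl⟩ <;> rcases hw with ⟨hw1, hw2⟩ | ⟨q, hq, rfl⟩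
    · rwa [hff u hu1, hff w hw1] at h
    · rw [hff u hu1, hfι q hq] at h
      exact absurd (h ▸ hq.2.mem_below hq.1) hu2
    · rw [hff w hw1, hfι p hp] at h
      exact absurd (h ▸ hp.2.mem_below hp.1) hw2
    · rw [hfι p hp, hfι q hq] at h
      rw [hp.2.place_inj hq.2 h]
  obtain ⟨e, he⟩ := Finset.exists_equiv_extend_of_card_eq (t := Finset.univ)
    (Finset.card_univ (α := V)).symm (s := s) (f := f) (Finset.subset_univ _) hfs
  refine ⟨e.trans (Equiv.subtypeUnivEquiv Finset.mem_univ), fun u hu hb => ?_, fun p h0 hp => ?_⟩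
  · rw [← hff u hu]
    simp only [Equiv.trans_apply, Equiv.subtypeUnivEquiv_apply]
    rw [hff u hu, he u (by simp [hs, hu, hb]), hff u hu]
  · rw [← hfι p ⟨h0, hp⟩]
    simp only [Equiv.trans_apply, Equiv.subtypeUnivEquiv_apply]
    refine he _ ?_
    simp only [hs, Set.mem_toFinset]
    exact Or.inr ⟨p, ⟨h0, hp⟩, rfl⟩

section Count

variable {X : Type} [Fintype X] {T : QueryTree X (Finset X)} {a b r κ : ℕ}

open Classical in
/-- A fixed labeling leads to a blind run in at most `κ ^ x` of its shuffles, although it leads to an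
arrival at `v` in all of them or in none. -/
theorem card_shuffles_blind_le [Fintype Γ] [Finite V] (hx : 0 < x)
    (hsh : ∀ γ i, min (lam (sh γ i)) r = min (lam i) r)
    (hκ : ∀ i, (Finset.univ.filter fun γ => r < lam (sh γ i)).card ≤ κ)
    (hI : ∀ u ∈ I, u ∉ F.revealed ∧ u ∉ F.hidden) (hv : F.Inner v)
    {ι : List (Fin D) → V} {σ : (Fin x → Γ) → Equiv.Perm V}
    (hσ : ∀ g u, u ∉ I → u ∉ F.Below v → σ g u = u)
    (hσι : ∀ g p, p ≠ [] → F.Valid sh g v p → σ g (ι p) = F.place sh g v p) (π : V ≃ X) :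
    (Finset.univ.filter fun g => F.Blind T x r v a b ((σ g).symm.trans π)).card *
        Fintype.card Γ ^ x ≤
      κ ^ x * (Finset.univ.filter fun g => F.Arrives T v a ((σ g).symm.trans π)).card := by
  rcases (Finset.univ.filter fun g => F.Blind T x r v a b ((σ g).symm.trans π)).eq_empty_or_nonempty
    with h | ⟨g₀, hg₀⟩
  · simp [h]
  have h₀ := (Finset.mem_filter.1 hg₀).2
  have hfix : ∀ g u, u ∉ I → u ∉ F.Below v → ((σ g).symm.trans π) u = π u := by
    intro g u hu hb
    rw [Equiv.trans_apply, (Equiv.symm_apply_eq _).2 (hσ g u hu hb).symm]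
  have hplace : ∀ g p, p ≠ [] → F.Valid sh g v p →
      ((σ g).symm.trans π) (F.place sh g v p) = π (ι p) := by
    intro g p h0 hp
    rw [Equiv.trans_apply, (Equiv.symm_apply_eq _).2 (hσι g p h0 hp).symm]
  have hall : (Finset.univ.filter fun g => F.Arrives T v a ((σ g).symm.trans π)) = Finset.univ := by
    refine Finset.filter_true_of_mem fun g _ => ?_
    exact h₀.1.congr hI fun u hu hb => (hfix g₀ u hu hb).trans (hfix g u hu hb).symm
  have hcard : (Finset.univ.filter fun g => F.Blind T x r v a b ((σ g).symm.trans π)).card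
      ≤ κ ^ x := by
    obtain ⟨u₀, hu₀, hd₀, -⟩ := h₀.2.2.2
    obtain ⟨p, hp, hpl, hpu⟩ := hd₀.exists_valid (sh := sh) (g := g₀)
    have hsub : (Finset.univ.filter fun g => F.Blind T x r v a b ((σ g).symm.trans π)) ⊆
        Fintype.piFinset fun s : Fin x => Finset.univ.filter fun γ =>
          r < lam (sh γ (p.reverse[(s : ℕ)]'(by simp [hpl]))) := by
      intro g hg
      have h := (Finset.mem_filter.1 hg).2
      obtain ⟨u₁, u₂, h1, h2, ht⟩ := h₀.exists_twin hsh hI hv (g₁ := g₀) (g₂ := g) (by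
        rintro u₁ u₂ (⟨rfl, h1, h2⟩ | ⟨p, h0, h1, h2, rfl, rfl⟩)
        · exact (hfix g₀ _ h1 h2).trans (hfix g _ h1 h2).symm
        · exact (hplace g₀ p h0 h1).trans (hplace g p h0 h2).symm) h
      obtain rfl := h1.unique hu₀
      obtain ⟨u₃, hu₃, hd₃, hl₃⟩ := h.2.2.2
      obtain rfl := h2.unique hu₃
      rcases ht with ⟨-, -, hb⟩ | ⟨q, -, hq₁, hq₂, hq₃, hq₄⟩
      · obtain ⟨y, rfl⟩ : ∃ y, x = y + 1 := ⟨x - 1, by omega⟩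
        exact absurd ⟨y, hd₀⟩ hb
      · obtain rfl := hq₁.place_inj hp (hq₃.symm.trans hpu.symm)
        rw [hq₄] at hl₃
        rw [Fintype.mem_piFinset]
        intro s
        exact Finset.mem_filter.2 ⟨Finset.mem_univ _,
          hq₂.le_lam (r := r + 1) hl₃ hpl.le s (by rw [hpl]; exact s.2)⟩
    refine (Finset.card_le_card hsub).trans ?_
    rw [Fintype.card_piFinset]
    refine (Finset.prod_le_prod' fun s _ => hκ _).trans ?_
    simp
  rw [hall, Finset.card_univ, Fintype.card_pi_const]
  exact Nat.mul_le_mul_right _ hcard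

open Classical in
/-- Among the labelings that lead to an arrival at `v`, at most a fraction `(κ / |Γ|) ^ x` leads to a
blind run, because averaging over the shuffles below `v` does not change the count. -/
theorem card_blind_le [Fintype Γ] [Nonempty Γ] [Finite V] (hx : 0 < x)
    (hsh : ∀ γ i, min (lam (sh γ i)) r = min (lam i) r)
    (hκ : ∀ i, (Finset.univ.filter fun γ => r < lam (sh γ i)).card ≤ κ)
    (hI : ∀ u ∈ I, u ∉ F.revealed ∧ u ∉ F.hidden)
    (hIcard : Fintype.card Γ ^ x * F.hidden.ncard ≤ I.ncard) {L : Finset (V ≃ X)}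
    (hL : ∀ π ∈ L, ∀ σ : Equiv.Perm V, (∀ u, u ∉ I → u ∉ F.hidden → σ u = u) → σ.trans π ∈ L)
    (v : V) :
    (L.filter fun π => F.Blind T x r v a b π).card * Fintype.card Γ ^ x ≤
      κ ^ x * (L.filter fun π => F.Arrives T v a π).card := by
  by_cases hv : F.Inner v
  swap
  · rw [Finset.filter_false_of_mem, Finset.card_empty, zero_mul]
    · exact Nat.zero_le _
    · rintro π - ⟨-, -, -, u, -, hd, -⟩
      obtain ⟨y, rfl⟩ : ∃ y, x = y + 1 := ⟨x - 1, by omega⟩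
      exact hv hd.inner_of_succ
  obtain ⟨ι, hι, hinj⟩ := exists_address_embedding (sh := sh) hv.1 hIcard
  choose σ hσ hσι using exists_shuffle_perm hι hinj
  have hσ' : ∀ g u, u ∉ I → u ∉ F.hidden → σ g u = u := fun g u hu hh =>
    hσ g u hu fun hb => hh (hidden_of_mem_below hb)
  have hbij : ∀ (P : (V ≃ X) → Prop) (g : Fin x → Γ),
      (L.filter fun π => P ((σ g).symm.trans π)).card = (L.filter P).card := by
    intro P g
    refine Finset.card_nbij' (fun π => (σ g).symm.trans π) (fun π => (σ g).trans π) ?_ ?_ ?_ ?_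
    · intro π hπ
      obtain ⟨h1, h2⟩ := Finset.mem_filter.1 hπ
      refine Finset.mem_filter.2 ⟨hL π h1 _ fun u hu hh => ?_, h2⟩
      rw [Equiv.symm_apply_eq, hσ' g u hu hh]
    · intro π hπ
      obtain ⟨h1, h2⟩ := Finset.mem_filter.1 hπ
      refine Finset.mem_filter.2 ⟨hL π h1 _ (hσ' g), ?_⟩
      rwa [← Equiv.trans_assoc, Equiv.symm_trans_self, Equiv.refl_trans]
    · intro π _
      simp only [← Equiv.trans_assoc, Equiv.self_trans_symm, Equiv.refl_trans]
    · intro π _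
      simp only [← Equiv.trans_assoc, Equiv.symm_trans_self, Equiv.refl_trans]
  have hcount : ∀ P : (V ≃ X) → Prop,
      ∑ π ∈ L, (Finset.univ.filter fun g : Fin x → Γ => P ((σ g).symm.trans π)).card
        = Fintype.card Γ ^ x * (L.filter P).card := by
    intro P
    simp only [Finset.card_filter]
    rw [Finset.sum_comm]
    simp only [← Finset.card_filter, hbij]
    simp
  have key := Finset.sum_le_sum fun π (_ : π ∈ L) =>
    card_shuffles_blind_le (T := T) (a := a) (b := b) hx hsh hκ hI hv hσ hσι π
  rw [← Finset.sum_mul, ← Finset.mul_sum, hcount (F.Blind T x r v a b), hcount (F.Arrives T v a)]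
    at key
  refine le_of_mul_le_mul_left ?_ (pow_pos (Fintype.card_pos (α := Γ)) x)
  calc _ = _ := (mul_assoc _ _ _).symm
    _ ≤ _ := key
    _ = _ := by ring

open Classical in
/-- Blind runs of length `x` are unlikely. -/
theorem card_exists_blind_le [Fintype Γ] [Nonempty Γ] [Fintype V] (hx : 0 < x)
    (hsh : ∀ γ i, min (lam (sh γ i)) r = min (lam i) r)
    (hκ : ∀ i, (Finset.univ.filter fun γ => r < lam (sh γ i)).card ≤ κ)
    (hI : ∀ u ∈ I, u ∉ F.revealed ∧ u ∉ F.hidden)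
    (hIcard : Fintype.card Γ ^ x * F.hidden.ncard ≤ I.ncard) {L : Finset (V ≃ X)}
    (hL : ∀ π ∈ L, ∀ σ : Equiv.Perm V, (∀ u, u ∉ I → u ∉ F.hidden → σ u = u) → σ.trans π ∈ L)
    (Q : ℕ) :
    (L.filter fun π => ∃ v, ∃ a < Q, ∃ b < Q, F.Blind T x r v a b π).card * Fintype.card Γ ^ x ≤
      Q ^ 2 * κ ^ x * L.card := by
  have hsub : (L.filter fun π => ∃ v, ∃ a < Q, ∃ b < Q, F.Blind T x r v a b π) ⊆
      (Finset.range Q ×ˢ Finset.range Q).biUnion fun ab =>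
        Finset.univ.biUnion fun v => L.filter fun π => F.Blind T x r v ab.1 ab.2 π := by
    intro π hπ
    obtain ⟨h1, v, a, ha, b, hb, h⟩ := Finset.mem_filter.1 hπ
    simp only [Finset.mem_biUnion, Finset.mem_product, Finset.mem_range, Finset.mem_univ,
      Finset.mem_filter, true_and]
    exact ⟨(a, b), ⟨ha, hb⟩, v, h1, h⟩
  have hab : ∀ a b : ℕ, (Finset.univ.biUnion fun v => L.filter fun π =>
      F.Blind T x r v a b π).card * Fintype.card Γ ^ x ≤ κ ^ x * L.card := by
    intro a b
    calc _ ≤ (∑ v, (L.filter fun π => F.Blind T x r v a b π).card) * Fintype.card Γ ^ x :=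
          Nat.mul_le_mul_right _ Finset.card_biUnion_le
      _ = ∑ v, (L.filter fun π => F.Blind T x r v a b π).card * Fintype.card Γ ^ x :=
          Finset.sum_mul _ _ _
      _ ≤ ∑ v, κ ^ x * (L.filter fun π => F.Arrives T v a π).card :=
          Finset.sum_le_sum fun v _ => card_blind_le hx hsh hκ hI hIcard hL v
      _ = κ ^ x * (Finset.univ.biUnion fun v => L.filter fun π => F.Arrives T v a π).card := by
          rw [← Finset.mul_sum, Finset.card_biUnion]
          intro v _ w _ hvw
          refine Finset.disjoint_filter.2 fun π _ h1 h2 => hvw (h1.1.unique h2.1)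
      _ ≤ κ ^ x * L.card := by
          refine Nat.mul_le_mul_left _ (Finset.card_le_card ?_)
          exact Finset.biUnion_subset.2 fun v _ => Finset.filter_subset _ _
  calc _ ≤ (∑ ab ∈ Finset.range Q ×ˢ Finset.range Q, (Finset.univ.biUnion fun v =>
          L.filter fun π => F.Blind T x r v ab.1 ab.2 π).card) * Fintype.card Γ ^ x :=
        Nat.mul_le_mul_right _ ((Finset.card_le_card hsub).trans Finset.card_biUnion_le)
    _ = ∑ ab ∈ Finset.range Q ×ˢ Finset.range Q, (Finset.univ.biUnion fun v =>
          L.filter fun π => F.Blind T x r v ab.1 ab.2 π).card * Fintype.card Γ ^ x :=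
        Finset.sum_mul _ _ _
    _ ≤ ∑ ab ∈ Finset.range Q ×ˢ Finset.range Q, κ ^ x * L.card :=
        Finset.sum_le_sum fun ab _ => hab ab.1 ab.2
    _ = _ := by simp; ring

end Count
end Forest
namespace Forest

/-! ### Without blind runs the exploration stays shallow -/

section Shallow

variable {V X : Type} [Fintype X] {G : SimpleGraph V} {D K : ℕ} {lam : Fin D → ℕ} {ell : ℕ → ℕ}
  {F : Forest G D K lam ell} {T : QueryTree X (Finset X)} {π : V ≃ X} {u v w : V}
  {a b J x s : ℕ}

/-- `a` is the first step in which the exploration visits `v`. -/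
def FirstVisit (F : Forest G D K lam ell) (T : QueryTree X (Finset X)) (π : V ≃ X) (a : ℕ)
    (v : V) : Prop :=
  Visits G F.revealed T π a v ∧ ∀ j < a, ¬ Visits G F.revealed T π j v

/-- The exploration visits no cut vertex before step `J`. -/
def CutFree (F : Forest G D K lam ell) (T : QueryTree X (Finset X)) (π : V ≃ X) (J : ℕ) : Prop :=
  ∀ i < J, ∀ u, Visits G F.revealed T π i u → ¬ F.Cut u

theorem exists_firstVisit (h : Visits G F.revealed T π b u) :
    ∃ a ≤ b, F.FirstVisit T π a u := by
  classical
  have hex : ∃ a, Visits G F.revealed T π a u := ⟨b, h⟩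
  exact ⟨Nat.find hex, Nat.find_min' _ h, Nat.find_spec hex, fun j hj => Nat.find_min hex hj⟩

theorem FirstVisit.eq (h : F.FirstVisit T π a v) (h' : F.FirstVisit T π b v) : a = b := by
  rcases lt_trichotomy a b with hab | hab | hab
  · exact absurd h.1 (h'.2 a hab)
  · exact hab
  · exact absurd h'.1 (h.2 b hab)

theorem CutFree.mono (h : F.CutFree T π b) (hab : a ≤ b) : F.CutFree T π a :=
  fun i hi => h i (hi.trans_le hab)

/-- The exploration can get to know a vertex of the forest only through its parent. -/
theorem exists_visits_par (hJ : F.CutFree T π J) {j : ℕ} (hj : j ≤ J)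
    (hu : u ∈ Known G F.revealed T π j) (hh : u ∈ F.hidden) :
    ∃ i < j, Visits G F.revealed T π i (F.par u) := by
  induction j using Nat.strong_induction_on generalizing u with
  | _ j ih =>
    rcases known_cases hu with hu | ⟨i, hi, w, hw, hwu⟩
    · exact absurd hh (F.disjoint u hu)
    have hcut := hJ i (by omega) w hw
    have key : ∀ hwh : w ∈ F.hidden, u = F.par w → ∃ i < j, Visits G F.revealed T π i (F.par u) := by
      rintro hwh rfl
      obtain ⟨i', hi', h'⟩ := ih i hi (by omega) hw.2 hwh
      obtain ⟨i'', hi'', h''⟩ := ih i' (by omega) (by omega) h'.2 hh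
      exact ⟨i'', by omega, h''⟩
    rcases known_mem (hJ.mono (by omega)) hw.2 with hwr | hwh
    · rcases F.adj_revealed w hwr u hwu with h | ⟨-, h⟩
      · exact absurd hh (F.disjoint u h)
      · exact ⟨i, hi, h ▸ hw⟩
    · rcases inner_or_term hwh with hin | hte
      · rcases hin.adj.1 hwu with h | ⟨c, rfl⟩
        · exact key hwh h
        · exact ⟨i, hi, by rwa [hin.par_child]⟩
      · have hlt : F.level w < K := lt_of_le_of_ne (F.level_le w hwh) fun h => hcut ⟨hte, h⟩
        exact key hwh ((F.adj_leaf w hwh hte.2 hlt u).1 hwu)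

/-- On the way from `v` to `u`, each vertex is first visited at least as many steps earlier than `u`
as it lies above `u`. -/
theorem FirstVisit.exists_ancestor (hJ : F.CutFree T π J) {d : ℕ} (h : F.FirstVisit T π b u)
    (hb : b ≤ J) (hd : F.Desc v (s + d) u) :
    ∃ w a, a + d ≤ b ∧ F.FirstVisit T π a w ∧ F.Desc v s w ∧ F.Desc w d u := by
  induction d generalizing b u with
  | zero => exact ⟨u, b, le_rfl, h, hd, Desc.refl⟩
  | succ d ih =>
    obtain ⟨h1, h2, c, h3⟩ := Desc.par (s := s + d) hd
    obtain ⟨i, hi, hv⟩ := exists_visits_par hJ hb h.1.2 hd.hidden_of_succ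
    obtain ⟨b', hb', h'⟩ := exists_firstVisit hv
    obtain ⟨w, a, e1, e2, e3, e4⟩ := ih h' (by omega) h1
    exact ⟨w, a, by omega, e2, e3, h3 ▸ e4.step h2 c⟩

/-- Above each visited vertex of the forest there is a visited root, of level `K` and depth `1`. -/
theorem FirstVisit.exists_root (hJ : F.CutFree T π J) (h : F.FirstVisit T π b u) (hb : b ≤ J)
    (hu : u ∈ F.hidden) :
    ∃ v a s, a ≤ b ∧ F.FirstVisit T π a v ∧ F.Desc v s u ∧ v ∈ F.hidden ∧ F.level v = K ∧
      F.dep v = 1 := by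
  induction b using Nat.strong_induction_on generalizing u with
  | _ b ih =>
    rcases F.hidden_cases u hu with ⟨-, h1, h2⟩ | ⟨h1, c, h2⟩
    · exact ⟨u, b, 0, le_rfl, h, Desc.refl, hu, h1, h2⟩
    · obtain ⟨i, hi, hv⟩ := exists_visits_par hJ hb h.1.2 hu
      obtain ⟨b', hb', h'⟩ := exists_firstVisit hv
      obtain ⟨v, a, s, e1, e2, e3, e4⟩ := ih b' (by omega) h' (by omega) h1.1
      exact ⟨v, a, s + 1, by omega, e2, h2 ▸ e3.step h1 c, e4⟩

theorem Desc.level_dep (h : F.Desc v s u) :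
    (F.level u = F.level v ∧ F.dep u = F.dep v + s) ∨
      (F.level u < F.level v ∧ F.dep u + 1 ≤ s) := by
  induction h with
  | refl => exact Or.inl ⟨rfl, rfl⟩
  | step h hu c ih =>
    rw [F.level_child _ hu.1 hu.2, F.dep_child _ hu.1 hu.2]
    split_ifs <;> omega

/-- If no run of length `x` is blind, then within `2 ^ r` steps after the first visit to a vertex of
level at least `r`, the exploration gets less than `2 * x` deep while staying at level at
least `r`. By induction on `r`: one half of a deeper path would be traversed within `2 ^ (r - 1)`
steps; not being blind, that run has seen the end of a branch of level at least `r - 1`, which is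
too far away to be found in that time. -/
theorem depth_lt_of_not_blind (hx : 0 < x) (hell : ∀ k, 1 ≤ k → k < K → (k + 2) * x ≤ ell k)
    (hJ : F.CutFree T π J)
    (hblind : ∀ r v a b, 1 ≤ r → r < K → a < b → b ≤ J → ¬ F.Blind T x r v a b π)
    {r : ℕ} (hr : 1 ≤ r) (hrK : r ≤ K) (hv : F.FirstVisit T π a v) (hvh : v ∈ F.hidden)
    (hroom : F.level v = K ∨ F.dep v + (r + 2) * x ≤ ell (F.level v))
    (hbJ : b ≤ J) (hb : b < a + 2 ^ r) (hu : Visits G F.revealed T π b u) (hd : F.Desc v s u)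
    (hlu : r ≤ F.level u) : s < 2 * x := by
  induction r, hr using Nat.le_induction generalizing a b u v s with
  | base =>
    obtain ⟨b', hb', hu'⟩ := exists_firstVisit hu
    obtain ⟨w, a', h1, h2, h3, -⟩ := hu'.exists_ancestor hJ (by omega) (s := 0) (d := s)
      (by simpa using hd)
    cases h3
    have := hv.eq h2
    omega
  | succ r hr ih =>
    -- A run that is not blind has met the end of a branch, against the induction hypothesis.
    have sub : ∀ a' v' b' u', F.FirstVisit T π a' v' → v' ∈ F.hidden →
        (F.level v' = K ∨ F.dep v' + (r + 2) * x ≤ ell (F.level v')) →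
        F.FirstVisit T π b' u' → F.Desc v' x u' → r < F.level u' → a' < b' → b' < a' + 2 ^ r →
        b' ≤ J → False := by
      intro a' v' b' u' h1 h2 h3 h4 h5 h6 h7 h8 h9
      refine hblind r v' a' b' hr (by omega) h7 h9 ⟨⟨h1.1, fun j hj u hu =>
        ⟨hJ j (by omega) u hu, ?_⟩⟩, h7, fun j hj w hw => ⟨hJ j (by omega) w hw, ?_⟩,
        u', h4.1, h5, h6⟩
      · rintro rfl
        exact h1.2 j hj hu
      · rintro ⟨s', hs'⟩ hlw ht
        have hlt := ih (by omega) h1 h2 h3 (by omega) (by omega) hw hs' hlw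
        have hwK : F.level w < K := lt_of_le_of_ne (F.level_le w ht.1)
          fun h => hJ j (by omega) w hw ⟨ht, h⟩
        have h10 := ht.2
        rcases hs'.level_dep with ⟨e1, e2⟩ | ⟨e1, e2⟩
        · rcases h3 with h3 | h3
          · omega
          · rw [e1] at h10
            nlinarith
        · have := hell (F.level w) (F.level_pos w ht.1) hwK
          nlinarith
    by_contra! hs
    obtain ⟨b₀, hb₀, hu₀⟩ := exists_firstVisit hu
    obtain ⟨d, rfl⟩ : ∃ d, s = 2 * x + d := ⟨s - 2 * x, by omega⟩
    obtain ⟨w₂, t₂, ht₂, hw₂, hd₂, hd₂'⟩ := hu₀.exists_ancestor hJ (by omega) hd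
    rw [two_mul] at hd₂
    obtain ⟨w₁, t₁, ht₁, hw₁, hd₁, hd₁'⟩ := hw₂.exists_ancestor hJ (by omega) hd₂
    obtain ⟨w₀, t₀, ht₀, hw₀, hd₀, -⟩ := hw₁.exists_ancestor hJ (by omega) (s := 0) (d := x)
      (by simpa using hd₁)
    cases hd₀
    obtain rfl := hw₀.eq hv
    have hl₂ := hd₂'.level_le
    have hl₁ := hd₁'.level_le
    have hpow : 2 ^ (r + 1) = 2 ^ r + 2 ^ r := by ring
    by_cases ht : t₁ < t₀ + 2 ^ r
    · refine sub t₀ v t₁ w₁ hv hvh (hroom.imp id fun h => ?_) hw₁ hd₁ (by omega) (by omega) ht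
        (by omega)
      nlinarith
    · refine sub t₁ w₁ t₂ w₂ hw₁ (hd₁.hidden hvh) ?_ hw₂ hd₁' (by omega) (by omega) (by omega)
        (by omega)
      rcases hd₁.level_dep with ⟨e1, e2⟩ | ⟨e1, e2⟩
      · rw [e1, e2]
        refine hroom.imp id fun h => ?_
        nlinarith
      · right
        have h1 := hell (F.level w₁) (by omega) (by have := F.level_le v hvh; omega)
        have h2 : (r + 1 + 2) * x ≤ (F.level w₁ + 2) * x := Nat.mul_le_mul_right _ (by omega)
        nlinarith

/-- If no run of length `x` is blind, then no cut vertex is visited in fewer than `2 ^ K` steps. -/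
theorem not_cut_of_not_blind (hx : 0 < x) (hK : 1 ≤ K)
    (hell : ∀ k, 1 ≤ k → k < K → (k + 2) * x ≤ ell k) (hellK : 2 * x + 1 ≤ ell K)
    (hblind : ∀ r v a b, 1 ≤ r → r < K → a < b → b < 2 ^ K → ¬ F.Blind T x r v a b π) :
    F.CutFree T π (2 ^ K) := by
  intro b
  induction b using Nat.strong_induction_on with
  | _ b ih =>
    intro hb u hu hcut
    have hJ : F.CutFree T π b := fun i hi => ih i hi (hi.trans hb)
    obtain ⟨b', hb', hu'⟩ := exists_firstVisit hu
    obtain ⟨v, a, s, h1, h2, h3, h4, h5, h6⟩ := hu'.exists_root hJ hb' hcut.1.1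
    have := depth_lt_of_not_blind hx hell hJ
      (fun r v a b' h1 h2 h3 h4 => hblind r v a b' h1 h2 h3 (by omega)) hK le_rfl h2 h4
      (Or.inl h5) (b := b) le_rfl (by omega) hu h3 hcut.2.ge
    have h7 := hcut.1.2
    rw [hcut.2] at h7
    have h8 := hcut.2
    rcases h3.level_dep with ⟨e1, e2⟩ | ⟨e1, e2⟩ <;> omega

end Shallow
end Forest

/-! ### Guessing an unknown label -/

section Guess

variable {V X : Type} [Fintype X] {G : SimpleGraph V} {R : Set V} {T : QueryTree X (Finset X)}
  {π π₁ π₂ : V ≃ X} {w : V} {j : ℕ} {I Iso : Set V}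

/-- In step `j` the cautious run queries (or outputs) the label of `w`, which it does not know. -/
def Guesses (G : SimpleGraph V) (R : Set V) (T : QueryTree X (Finset X)) (π : V ≃ X) (j : ℕ)
    (w : V) : Prop :=
  (explore G R T π j).2.current = π w ∧ w ∉ Known G R T π j

theorem known_notMem_iso (hIso : ∀ u ∈ Iso, u ∉ R ∧ ∀ w, ¬ G.Adj w u) {u : V}
    (hu : u ∈ Known G R T π j) : u ∉ Iso := by
  intro h
  rcases known_cases hu with hu | ⟨-, -, w, -, hw⟩
  · exact (hIso u h).1 hu
  · exact (hIso u h).2 w hw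

/-- Which label is guessed does not depend on the label of the vertex `w` that is hit. -/
theorem Guesses.current_eq (hIso : ∀ u ∈ Iso, u ∉ R ∧ ∀ w, ¬ G.Adj w u)
    (hπ : ∀ u, u ≠ w → u ∉ Iso → π₁ u = π₂ u) (hw : w ∉ R)
    (h₁ : Guesses G R T π₁ j w) : (explore G R T π₁ j).2.current = (explore G R T π₂ j).2.current := by
  suffices ∀ i ≤ j, explore G R T π₁ i = explore G R T π₂ i by rw [this j le_rfl]
  intro i hi
  have hk : ∀ i ≤ j, ∀ u ∈ Known G R T π₁ i, π₁ u = π₂ u := fun i hi u hu =>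
    hπ u (by rintro rfl; exact h₁.2 (known_mono hi hu)) (known_notMem_iso hIso hu)
  induction i with
  | zero =>
    refine Prod.ext (Set.image_congr fun u hu => ?_) rfl
    exact hπ u (by rintro rfl; exact hw hu) fun h => (hIso u h).1 hu
  | succ i ih =>
    rw [explore_succ, explore_succ, ← ih (by omega)]
    rcases hT : (explore G R T π₁ i) with ⟨S, T'⟩
    cases T' with
    | output y => rfl
    | query y next =>
      refine cautiousStep_congr fun hcur => ?_
      have hvis : Visits G R T π₁ i _ := visits_of_current_mem (by rw [hT]; exact hcur)
      simp only [hT] at hvis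
      set u := π₁.symm (QueryTree.query y next).current with hu
      have hcu : (QueryTree.query y next).current = π₁ u := by simp [hu]
      have hadj : ∀ u', G.Adj u u' → π₁ u' = π₂ u' := by
        intro u' hu'
        refine hk (i + 1) hi u' ?_
        rw [mem_known, explore_succ, hT]
        refine mem_cautiousStep_of_query hcur ?_
        rw [mem_labelOracle, π₁.symm_apply_apply]
        exact hu'
      have huu : π₂.symm (π₁ u) = u := by
        rw [hk i (by omega) u hvis.2, π₂.symm_apply_apply]
      rw [hcu]
      ext z
      rw [mem_labelOracle, mem_labelOracle, huu, π₁.symm_apply_apply]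
      constructor
      · intro hz
        have := hadj _ hz
        rw [π₁.apply_symm_apply] at this
        rwa [this, π₂.symm_apply_apply]
      · intro hz
        have := hadj _ hz
        rw [π₂.apply_symm_apply] at this
        rwa [← this, π₁.symm_apply_apply]

open Classical in
/-- Guessing the label of a fixed vertex is unlikely, because the label of any vertex in `I` is
equally likely to be its label. -/
theorem card_guesses_le [Fintype V] (hIso : ∀ u ∈ Iso, u ∉ R ∧ ∀ w, ¬ G.Adj w u) (hI : I ⊆ Iso)
    (hw : w ∉ R) {L : Finset (V ≃ X)}
    (hL : ∀ π ∈ L, ∀ i ∈ I, (Equiv.swap w i).trans π ∈ L) :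
    (L.filter fun π => Guesses G R T π j w).card * I.ncard ≤ L.card := by
  set A : Finset V := I.toFinset with hA
  have hAI : I.ncard = A.card := Set.ncard_eq_toFinset_card' I
  have hbij : ∀ i ∈ A, (L.filter fun π => Guesses G R T ((Equiv.swap w i).trans π) j w).card
      = (L.filter fun π => Guesses G R T π j w).card := by
    intro i hi
    have hi' : i ∈ I := by simpa [hA] using hi
    have hinv : ∀ π : V ≃ X, (Equiv.swap w i).trans ((Equiv.swap w i).trans π) = π := by
      intro π
      ext u
      simp
    refine Finset.card_nbij' (fun π => (Equiv.swap w i).trans π)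
      (fun π => (Equiv.swap w i).trans π) ?_ ?_ (fun π _ => hinv π) fun π _ => hinv π
    · intro π hπ
      obtain ⟨h1, h2⟩ := Finset.mem_filter.1 hπ
      exact Finset.mem_filter.2 ⟨hL π h1 i hi', h2⟩
    · intro π hπ
      obtain ⟨h1, h2⟩ := Finset.mem_filter.1 hπ
      refine Finset.mem_filter.2 ⟨hL π h1 i hi', ?_⟩
      rwa [hinv]
  have hone : ∀ π ∈ L,
      (A.filter fun i => Guesses G R T ((Equiv.swap w i).trans π) j w).card ≤ 1 := by
    intro π _
    refine Finset.card_le_one.2 fun i hi i' hi' => ?_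
    obtain ⟨h1, h2⟩ := Finset.mem_filter.1 hi
    obtain ⟨h1', h2'⟩ := Finset.mem_filter.1 hi'
    have h3 : i ∈ I := by simpa [hA] using h1
    have h3' : i' ∈ I := by simpa [hA] using h1'
    have := h2.current_eq (π₂ := (Equiv.swap w i').trans π) hIso (fun u hu hui => by
      have e1 : u ≠ i := by rintro rfl; exact hui (hI h3)
      have e2 : u ≠ i' := by rintro rfl; exact hui (hI h3')
      simp [Equiv.swap_apply_of_ne_of_ne hu e1, Equiv.swap_apply_of_ne_of_ne hu e2]) hw
    rw [h2.1, h2'.1] at this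
    simpa using this
  calc _ = ∑ i ∈ A, (L.filter fun π => Guesses G R T ((Equiv.swap w i).trans π) j w).card := by
        rw [Finset.sum_congr rfl hbij, hAI]; simp [mul_comm]
    _ = ∑ π ∈ L, (A.filter fun i => Guesses G R T ((Equiv.swap w i).trans π) j w).card := by
        simp only [Finset.card_filter]
        exact Finset.sum_comm
    _ ≤ ∑ π ∈ L, 1 := Finset.sum_le_sum hone
    _ = L.card := by simp

open Classical in
/-- It is unlikely that the label of some vertex outside `Iso` is guessed in fewer than `Q` steps. -/
theorem card_exists_guesses_le [Fintype V] (hIso : ∀ u ∈ Iso, u ∉ R ∧ ∀ w, ¬ G.Adj w u)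
    (hI : I ⊆ Iso) {L : Finset (V ≃ X)}
    (hL : ∀ π ∈ L, ∀ w, w ∉ R → w ∉ Iso → ∀ i ∈ I, (Equiv.swap w i).trans π ∈ L) (Q : ℕ) :
    (L.filter fun π => ∃ j < Q, ∃ w ∉ Iso, Guesses G R T π j w).card * I.ncard ≤
      Q * Isoᶜ.ncard * L.card := by
  have hmemR : ∀ (π : V ≃ X) (j : ℕ) w, Guesses G R T π j w → w ∉ R := by
    intro π j w h hR
    exact h.2 (known_mono (Nat.zero_le j) ⟨w, hR, rfl⟩)
  have hsub : (L.filter fun π => ∃ j < Q, ∃ w ∉ Iso, Guesses G R T π j w) ⊆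
      (Finset.range Q ×ˢ Isoᶜ.toFinset).biUnion fun jw =>
        L.filter fun π => Guesses G R T π jw.1 jw.2 := by
    intro π hπ
    obtain ⟨h1, j, hj, w, hw, h⟩ := Finset.mem_filter.1 hπ
    simp only [Finset.mem_biUnion, Finset.mem_product, Finset.mem_range, Finset.mem_filter,
      Set.mem_toFinset]
    exact ⟨(j, w), ⟨hj, hw⟩, h1, h⟩
  calc _ ≤ (∑ jw ∈ Finset.range Q ×ˢ Isoᶜ.toFinset,
          (L.filter fun π => Guesses G R T π jw.1 jw.2).card) * I.ncard :=
        Nat.mul_le_mul_right _ ((Finset.card_le_card hsub).trans Finset.card_biUnion_le)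
    _ = ∑ jw ∈ Finset.range Q ×ˢ Isoᶜ.toFinset,
          (L.filter fun π => Guesses G R T π jw.1 jw.2).card * I.ncard := Finset.sum_mul _ _ _
    _ ≤ ∑ jw ∈ Finset.range Q ×ˢ Isoᶜ.toFinset, L.card := by
        refine Finset.sum_le_sum fun jw hjw => ?_
        have hw : jw.2 ∉ Iso := by
          have := (Finset.mem_product.1 hjw).2
          simpa using this
        by_cases hR : jw.2 ∈ R
        · rw [Finset.filter_false_of_mem fun π _ h => hmemR π _ _ h hR]
          simp
        · exact card_guesses_le hIso hI hR fun π hπ => hL π hπ _ hR hw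
    _ = _ := by
        rw [Finset.sum_const, Finset.card_product, Finset.card_range,
          Set.ncard_eq_toFinset_card' Isoᶜ, smul_eq_mul]

end Guess

/-! ### Tree-like neighborhoods in graphs of high girth -/

section Hull

variable {W : Type} {E : SimpleGraph W} {a b e u w z : W} {k : ℕ}

/-- In a graph of high girth, at most one neighbor of a vertex `e` is no further from `u` than
`e` is. -/
theorem eq_of_walks_of_girth (hg : ((2 * k + 3 : ℕ) : ℕ∞) ≤ E.egirth) (hea : E.Adj e a)
    (heb : E.Adj e b) (he : ∀ q : E.Walk e u, k ≤ q.length) (p : E.Walk a u) (hp : p.length ≤ k)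
    (q : E.Walk b u) (hq : q.length ≤ k) : a = b := by
  classical
  have avoid : ∀ {a : W}, E.Adj e a → ∀ p : E.Walk a u, p.length ≤ k → e ∉ p.support := by
    intro a hea p hp hmem
    have h1 := he (p.dropUntil e hmem)
    have h2 := congrArg SimpleGraph.Walk.length (p.take_spec hmem)
    rw [SimpleGraph.Walk.length_append] at h2
    have h3 : (p.takeUntil e hmem).length = 0 := by omega
    exact hea.ne (SimpleGraph.Walk.eq_of_length_eq_zero h3).symm
  have main : ∀ {a : W} (h : E.Adj e a) (p : E.Walk a u), p.length ≤ k →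
      ∃ P : E.Walk e u, P.IsPath ∧ P.length ≤ k + 1 ∧ P.snd = a := by
    intro a h p hp
    have hb := p.length_bypass_le_length
    refine ⟨.cons h p.bypass, ?_, ?_, by simp⟩
    · rw [SimpleGraph.Walk.cons_isPath_iff]
      exact ⟨p.bypass_isPath, avoid h _ (hb.trans hp)⟩
    · rw [SimpleGraph.Walk.length_cons]; omega
  obtain ⟨P, hP, hPl, rfl⟩ := main hea p hp
  obtain ⟨P', hP', hPl', rfl⟩ := main heb q hq
  suffices P = P' by rw [this]
  set H : SimpleGraph W := SimpleGraph.fromEdgeSet {x | x ∈ P.edges ++ P'.edges} with hH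
  have hHedge : ∀ x ∈ E.edgeSet, x ∈ P.edges ++ P'.edges → x ∈ H.edgeSet := by
    intro x hx hx'
    rw [hH, SimpleGraph.edgeSet_fromEdgeSet]
    exact ⟨hx', fun h => SimpleGraph.not_isDiag_of_mem_edgeSet E hx h⟩
  have hHE : H ≤ E := by
    intro x y hxy
    rw [hH, SimpleGraph.fromEdgeSet_adj] at hxy
    rcases List.mem_append.1 hxy.1 with h | h
    · exact P.adj_of_mem_edges h
    · exact P'.adj_of_mem_edges h
  have hac : H.IsAcyclic := by
    intro x c hc
    have h1 := (hc.mapLe hHE)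
    have h2 := hg.trans (SimpleGraph.egirth_le_length h1)
    rw [SimpleGraph.Walk.length_map] at h2
    have h3 : c.edges ⊆ P.edges ++ P'.edges := by
      intro y hy
      have := c.edges_subset_edgeSet hy
      rw [hH, SimpleGraph.edgeSet_fromEdgeSet] at this
      exact this.1
    have h4 := (hc.isTrail.edges_nodup.subperm h3).length_le
    rw [List.length_append, SimpleGraph.Walk.length_edges, SimpleGraph.Walk.length_edges,
      SimpleGraph.Walk.length_edges] at h4
    have h5 : 2 * k + 3 ≤ c.length := by exact_mod_cast h2
    omega
  have hPH : ∀ x ∈ P.edges, x ∈ H.edgeSet := fun x hx =>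
    hHedge x (P.edges_subset_edgeSet hx) (List.mem_append_left _ hx)
  have hPH' : ∀ x ∈ P'.edges, x ∈ H.edgeSet := fun x hx =>
    hHedge x (P'.edges_subset_edgeSet hx) (List.mem_append_right _ hx)
  have := congrArg (fun p : H.Path e u => p.1.support) ((hac.subsingleton_path e u).elim
    ⟨P.transfer H hPH, hP.transfer hPH⟩ ⟨P'.transfer H hPH', hP'.transfer hPH'⟩)
  simp only [SimpleGraph.Walk.support_transfer] at this
  exact SimpleGraph.Walk.ext_support this

/-- `Lead E U m k z e`: going from `z` to its neighbor `e` and never turning back, one gets after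
`k` steps to a vertex of `U`, or else to a branching vertex from which one can, in each of two
further directions, reach vertices of the same kind, in at most `m` steps altogether. -/
inductive Lead (E : SimpleGraph W) (U : Finset W) (m : ℕ) : ℕ → W → W → Prop
  | source {z e : W} (h : E.Adj z e) (he : e ∈ U) : Lead E U m 1 z e
  | branch {z e e₁ e₂ : W} {k₁ k₂ : ℕ} (h : E.Adj z e) (h₁₂ : e₁ ≠ e₂) (hz₁ : z ≠ e₁)
      (hz₂ : z ≠ e₂) (h₁ : Lead E U m k₁ e e₁) (h₂ : Lead E U m k₂ e e₂) (hm : k₁ + k₂ ≤ m) :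
      Lead E U m 1 z e
  | step {z e e' : W} {k : ℕ} (h : E.Adj z e) (hz : z ≠ e') (h' : Lead E U m k e e') :
      Lead E U m (k + 1) z e

/-- The hull of `U`: its points, and all vertices on short paths between points of the hull. -/
def hull (E : SimpleGraph W) (U : Finset W) (m : ℕ) : Set W :=
  {w | w ∈ U ∨ ∃ k₁ k₂ e₁ e₂, e₁ ≠ e₂ ∧ Lead E U m k₁ w e₁ ∧ Lead E U m k₂ w e₂ ∧ k₁ + k₂ ≤ m}

/-- The set of vertices from which `Z` can be reached in at most `s` steps. -/
def within (E : SimpleGraph W) (Z : Set W) (s : ℕ) : Set W :=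
  {w | ∃ z ∈ Z, ∃ p : E.Walk w z, p.length ≤ s}

variable {U : Finset W} {m s h : ℕ} {Z : Set W}

theorem Lead.adj (h : Lead E U m k z e) : E.Adj z e := by
  cases h <;> assumption

/-- The hull is closed: a neighbor in the hull that is a branching vertex is as good as a point
of `U`. -/
theorem lead_of_mem_hull (hw : w ∉ hull E U m) (hwa : E.Adj w a) (ha : a ∈ hull E U m) :
    Lead E U m 1 w a := by
  rcases ha with ha | ⟨k₁, k₂, e₁, e₂, hne, h₁, h₂, hm⟩
  · exact .source hwa ha
  -- If one of the two directions at `a` leads back to `w`, then `w` is in the hull.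
  have key : ∀ {k₁ k₂ : ℕ} {e₂ : W}, w ≠ e₂ → Lead E U m k₁ a w → Lead E U m k₂ a e₂ →
      k₁ + k₂ ≤ m → False := by
    intro k₁ k₂ e₂ hne h₁ h₂ hm
    cases h₁ with
    | source _ h => exact hw (Or.inl h)
    | branch _ h₁₂ _ _ h h' hm' => exact hw (Or.inr ⟨_, _, _, _, h₁₂, h, h', hm'⟩)
    | step _ hz h => exact hw (Or.inr ⟨_, _, _, _, hz.symm, h, .step hwa hne h₂, by omega⟩)
  by_cases h1 : w = e₁
  · subst h1
    exact (key hne h₁ h₂ hm).elim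
  by_cases h2 : w = e₂
  · subst h2
    exact (key hne.symm h₂ h₁ (by omega)).elim
  · exact .branch hwa hne h1 h2 h₁ h₂ hm

theorem mem_within_zero : w ∈ within E Z 0 ↔ w ∈ Z := by
  constructor
  · rintro ⟨z, hz, p, hp⟩
    rwa [SimpleGraph.Walk.eq_of_length_eq_zero (Nat.le_zero.1 hp)]
  · exact fun h => ⟨w, h, .nil, le_rfl⟩

theorem within_mono {s' : ℕ} (h : s ≤ s') : within E Z s ⊆ within E Z s' :=
  fun _ ⟨z, hz, p, hp⟩ => ⟨z, hz, p, hp.trans h⟩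

theorem mem_within_succ_of_adj (h : E.Adj w a) (ha : a ∈ within E Z s) : w ∈ within E Z (s + 1) := by
  obtain ⟨z, hz, p, hp⟩ := ha
  exact ⟨z, hz, .cons h p, by simpa using hp⟩

theorem exists_adj_of_mem_within_succ (hw : w ∈ within E Z (s + 1)) :
    w ∈ Z ∨ ∃ a, E.Adj w a ∧ a ∈ within E Z s := by
  obtain ⟨z, hz, p, hp⟩ := hw
  cases p with
  | nil => exact Or.inl hz
  | cons h p => exact Or.inr ⟨_, h, z, hz, p, by simpa using hp⟩

theorem exists_lead (hw : w ∉ within E (hull E U m) s) (hwa : E.Adj w a)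
    (ha : a ∈ within E (hull E U m) s) : ∃ k ≤ s + 1, Lead E U m k w a := by
  induction s generalizing w a with
  | zero => exact ⟨1, le_rfl, lead_of_mem_hull (mt mem_within_zero.2 hw) hwa (mem_within_zero.1 ha)⟩
  | succ s ih =>
    have hws := mt (fun h => within_mono (Nat.le_succ s) h) hw
    by_cases has : a ∈ within E (hull E U m) s
    · obtain ⟨k, hk, h⟩ := ih hws hwa has
      exact ⟨k, by omega, h⟩
    · rcases exists_adj_of_mem_within_succ ha with h | ⟨a', haa', ha'⟩
      · exact absurd (within_mono (Nat.zero_le s) (mem_within_zero.2 h)) has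
      · obtain ⟨k, hk, h⟩ := ih has haa' ha'
        exact ⟨k + 1, by omega, .step hwa (by rintro rfl; exact hws ha') h⟩

/-- Near its hull, the graph is a forest: a vertex outside the hull has at most one neighbor that is
no further from the hull. -/
theorem eq_of_mem_within (hm : 2 * (s + 2) ≤ m) (hw : w ∉ within E (hull E U m) s)
    (hwa : E.Adj w a) (ha : a ∈ within E (hull E U m) (s + 1)) (hwb : E.Adj w b)
    (hb : b ∈ within E (hull E U m) (s + 1)) : a = b := by
  have key : ∀ {a : W}, E.Adj w a → a ∈ within E (hull E U m) (s + 1) →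
      ∃ k ≤ s + 2, Lead E U m k w a := by
    intro a hwa ha
    by_cases has : a ∈ within E (hull E U m) s
    · obtain ⟨k, hk, h⟩ := exists_lead hw hwa has
      exact ⟨k, by omega, h⟩
    · rcases exists_adj_of_mem_within_succ ha with h | ⟨a', haa', ha'⟩
      · exact absurd (within_mono (Nat.zero_le s) (mem_within_zero.2 h)) has
      · obtain ⟨k, hk, h⟩ := exists_lead has haa' ha'
        exact ⟨k + 1, by omega, .step hwa (by rintro rfl; exact hw ha') h⟩
  obtain ⟨k₁, hk₁, h₁⟩ := key hwa ha
  obtain ⟨k₂, hk₂, h₂⟩ := key hwb hb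
  by_contra hne
  exact hw (within_mono (Nat.zero_le s)
    (mem_within_zero.2 (Or.inr ⟨k₁, k₂, a, b, hne, h₁, h₂, by omega⟩)))

/-- A shortest walk from `z` to `u` goes through the neighbor `e` and has length at most `l`. -/
def Toward (E : SimpleGraph W) (z e : W) (l : ℕ) (u : W) : Prop :=
  E.Adj z e ∧ ∃ k, k + 1 ≤ l ∧ (∃ p : E.Walk e u, p.length ≤ k) ∧ ∀ q : E.Walk z u, k < q.length

theorem Toward.mono {l l' : ℕ} (h : Toward E z e l u) (hl : l ≤ l') : Toward E z e l' u := by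
  obtain ⟨h1, k, h2, h3⟩ := h
  exact ⟨h1, k, by omega, h3⟩

theorem Toward.step {l : ℕ} (hg : ((2 * l + 3 : ℕ) : ℕ∞) ≤ E.egirth) (h : Toward E e a l u)
    (hze : E.Adj z e) (hza : z ≠ a) : Toward E z e (l + 1) u := by
  obtain ⟨h1, k, h2, ⟨p, hp⟩, h4⟩ := h
  refine ⟨hze, k + 1, by omega, ⟨.cons h1 p, by simpa using hp⟩, fun q => ?_⟩
  by_contra! hq
  refine hza (eq_of_walks_of_girth (k := k + 1) (le_trans ?_ hg) hze.symm h1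
    (fun q => h4 q) q hq p (by omega))
  exact_mod_cast (by omega)

theorem Toward.unique {l l' : ℕ} (hg : ((2 * l + 3 : ℕ) : ℕ∞) ≤ E.egirth) (h : Toward E e a l u)
    (h' : Toward E e b l' u) : a = b := by
  obtain ⟨h1, k, h2, ⟨p, hp⟩, h4⟩ := h
  obtain ⟨h1', k', h2', ⟨p', hp'⟩, h4'⟩ := h'
  have e1 := h4 (.cons h1' p')
  have e2 := h4' (.cons h1 p)
  rw [SimpleGraph.Walk.length_cons] at e1 e2
  refine eq_of_walks_of_girth (k := k + 1) (le_trans ?_ hg) h1 h1' (fun q => h4 q) p (by omega)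
    p' (by omega)
  exact_mod_cast (by omega)

/-- A lead goes to a point of `U` that is close. Otherwise it would branch `h` times
before it gets to `U`; by induction all branches end close by, hence at different points because of
the girth, and `U` would have at least `2 ^ h` points. -/
theorem Lead.exists_toward (hh : 1 ≤ h) (hU : U.card < 2 ^ h)
    (hg : ((2 * ((2 * h + 1) * m) + 3 : ℕ) : ℕ∞) ≤ E.egirth) (hl : Lead E U m k z e)
    (hk : k ≤ m) {d : ℕ} (hd : d ≤ h) :
    (∃ u ∈ U, Toward E z e (k + d * m) u) ∨
      ∃ S ⊆ U, 2 ^ d ≤ S.card ∧ ∀ u ∈ S, Toward E z e (k + (d + h) * m) u := by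
  classical
  have hgirth : ∀ l, l ≤ (2 * h + 1) * m → ((2 * l + 3 : ℕ) : ℕ∞) ≤ E.egirth := by
    intro l hl
    refine le_trans ?_ hg
    exact_mod_cast (by omega)
  induction hl generalizing d with
  | @source z e h he =>
    refine Or.inl ⟨e, he, h, 0, by omega, ⟨.nil, le_rfl⟩, fun q => ?_⟩
    by_contra! hq
    exact h.ne (SimpleGraph.Walk.eq_of_length_eq_zero (Nat.le_zero.1 hq))
  | @step z e e' k h' hz hle ih =>
    have hstep : ∀ d ≤ h, ∀ u, Toward E e e' (k + (d + h) * m) u →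
        Toward E z e (k + 1 + (d + h) * m) u := by
      intro d hd u hu
      refine (hu.step (hgirth _ ?_) h' hz).mono (by omega)
      nlinarith
    have hstep' : ∀ u, Toward E e e' (k + d * m) u → Toward E z e (k + 1 + d * m) u := by
      intro u hu
      refine (hu.step (hgirth _ ?_) h' hz).mono (by omega)
      nlinarith
    rcases ih (by omega) hd with ⟨u, hu, h1⟩ | ⟨S, hS, hc, h1⟩
    · exact Or.inl ⟨u, hu, hstep' u h1⟩
    · exact Or.inr ⟨S, hS, hc, fun u hu => hstep d hd u (h1 u hu)⟩
  | @branch z e e₁ e₂ k₁ k₂ h' h₁₂ hz₁ hz₂ hl₁ hl₂ hm ih₁ ih₂ =>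
    have hpos : ∀ d < h, (∃ u ∈ U, Toward E z e (1 + (d + 1) * m) u) ∨
        ∃ S ⊆ U, 2 ^ (d + 1) ≤ S.card ∧ ∀ u ∈ S, Toward E z e (1 + (d + 1 + h) * m) u := by
      intro d hd
      have hstep : ∀ {k e'} (_ : k ≤ m) (_ : z ≠ e') u, Toward E e e' (k + d * m) u →
          Toward E z e (1 + (d + 1) * m) u := by
        intro k e' hkm hze u hu
        refine (hu.step (hgirth _ ?_) h' hze).mono ?_ <;> nlinarith
      have hstep' : ∀ {k e'} (_ : k ≤ m) (_ : z ≠ e') u, Toward E e e' (k + (d + h) * m) u →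
          Toward E z e (1 + (d + 1 + h) * m) u := by
        intro k e' hkm hze u hu
        refine (hu.step (hgirth _ ?_) h' hze).mono ?_ <;> nlinarith
      rcases ih₁ (by omega) hd.le with ⟨u, hu, h1⟩ | ⟨S₁, hS₁, hc₁, h1⟩
      · exact Or.inl ⟨u, hu, hstep (by omega) hz₁ u h1⟩
      rcases ih₂ (by omega) hd.le with ⟨u, hu, h2⟩ | ⟨S₂, hS₂, hc₂, h2⟩
      · exact Or.inl ⟨u, hu, hstep (by omega) hz₂ u h2⟩
      refine Or.inr ⟨S₁ ∪ S₂, Finset.union_subset hS₁ hS₂, ?_, ?_⟩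
      · rw [Finset.card_union_of_disjoint, pow_succ]
        · omega
        · refine Finset.disjoint_left.2 fun u hu₁ hu₂ => h₁₂ ?_
          refine (h1 u hu₁).unique (hgirth _ ?_) (h2 u hu₂)
          have : k₁ ≤ m := by omega
          nlinarith
      · intro u hu
        rcases Finset.mem_union.1 hu with hu | hu
        · exact hstep' (by omega) hz₁ u (h1 u hu)
        · exact hstep' (by omega) hz₂ u (h2 u hu)
    rcases d with _ | d
    · obtain ⟨h₀, rfl⟩ : ∃ h₀, h = h₀ + 1 := ⟨h - 1, by omega⟩
      rcases hpos h₀ (by omega) with ⟨u, hu, h1⟩ | ⟨S, hS, hc, -⟩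
      · refine Or.inr ⟨{u}, by simpa using hu, by simp, fun u' hu' => ?_⟩
        obtain rfl := Finset.mem_singleton.1 hu'
        simpa using h1
      · have := Finset.card_le_card hS
        omega
    · exact hpos d (by omega)

/-- The hull of a small set stays close to it. -/
theorem hull_subset_within (hh : 1 ≤ h) (hU : U.card < 2 ^ h)
    (hg : ((2 * ((2 * h + 1) * m) + 3 : ℕ) : ℕ∞) ≤ E.egirth) :
    hull E U m ⊆ within E (U : Set W) ((h + 1) * m) := by
  rintro w (hw | ⟨k₁, k₂, e₁, e₂, -, h₁, -, hm⟩)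
  · exact ⟨w, hw, .nil, Nat.zero_le _⟩
  have key : ∃ u ∈ U, Toward E w e₁ ((h + 1) * m) u := by
    have hb : k₁ + (0 + h) * m ≤ (h + 1) * m := by nlinarith
    rcases h₁.exists_toward hh hU hg (by omega) (Nat.zero_le h) with ⟨u, hu, h1⟩ | ⟨S, hS, hc, h1⟩
    · exact ⟨u, hu, h1.mono (by nlinarith)⟩
    · obtain ⟨u, hu⟩ := Finset.card_pos.1 (lt_of_lt_of_le (by norm_num) hc)
      exact ⟨u, hS hu, (h1 u hu).mono hb⟩
  obtain ⟨u, hu, h1, k, h2, ⟨p, hp⟩, -⟩ := key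
  exact ⟨u, hu, .cons h1 p, by rw [SimpleGraph.Walk.length_cons]; omega⟩

end Hull

/-! ### Slots and levels -/

section Slots

variable {n K : ℕ}

/-- The number of slots for the children of an inner vertex. -/
abbrev numSlots (n : ℕ) : ℕ := degSeq n 1 - 1

/-- The level of the slot `c`. The slots of level at least `k` are the first `d_{n,k} - 1` ones, so
that a vertex of level `k` has its own continuations in these slots, and in each of the other slots
the root of a tree of the level of the slot. -/
def slotLevel (n : ℕ) (c : ℕ) : ℕ := min n.sqrt ((2 * n - 2 - c) / n.sqrt)

theorem sqrt_eq (hn : n = K ^ 2) : n.sqrt = K := by rw [hn, sq]; exact Nat.sqrt_eq K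

theorem degSeq_eq (hn : n = K ^ 2) (k : ℕ) : degSeq n k = 2 * K ^ 2 - k * K := by
  rw [degSeq, sqrt_eq hn, hn]

theorem le_slotLevel_iff (hn : n = K ^ 2) (hK : 2 ≤ K) {k : ℕ} (hkK : k ≤ K)
    {c : ℕ} : k ≤ slotLevel n c ↔ k = 0 ∨ c < degSeq n k - 1 := by
  rw [slotLevel, sqrt_eq hn, le_min_iff, Nat.le_div_iff_mul_le (by omega), degSeq_eq hn, hn]
  have h1 : k * K ≤ K ^ 2 := by nlinarith
  have h2 : 4 ≤ K ^ 2 := by nlinarith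
  rcases Nat.eq_zero_or_pos k with rfl | hk
  · simp
  have h3 : 1 * K ≤ k * K := Nat.mul_le_mul_right _ hk
  omega

theorem one_le_slotLevel (hn : n = K ^ 2) (hK : 2 ≤ K) (c : Fin (numSlots n)) :
    1 ≤ slotLevel n c :=
  (le_slotLevel_iff hn hK (by omega)).2 (Or.inr c.2)

/-- The position of a slot among the slots of the same level. -/
def slotIndex (n : ℕ) (c : ℕ) : ℕ := c + 1 - degSeq n (slotLevel n c + 1)

theorem slotIndex_add (hn : n = K ^ 2) (hK : 2 ≤ K) {c : ℕ} (h : slotLevel n c < K) :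
    slotIndex n c + degSeq n (slotLevel n c + 1) = c + 1 := by
  have := mt (le_slotLevel_iff hn hK (k := slotLevel n c + 1) h (c := c)).2 (by omega)
  rw [slotIndex]; omega

theorem slotIndex_lt (hn : n = K ^ 2) (hK : 2 ≤ K) (c : Fin (numSlots n))
    (h : slotLevel n c < K) :
    slotIndex n c < degSeq n (slotLevel n c) - degSeq n (slotLevel n c + 1) := by
  have h1 := (le_slotLevel_iff hn hK h.le (c := c)).1 le_rfl
  have h2 := one_le_slotLevel hn hK c
  have h3 := slotIndex_add hn hK h
  omega

theorem exists_slot (hn : n = K ^ 2) (hK : 2 ≤ K) {r i : ℕ} (hr : 1 ≤ r) (hrK : r < K)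
    (hi : i < degSeq n r - degSeq n (r + 1)) :
    ∃ c : Fin (numSlots n), slotLevel n c = r ∧ slotIndex n c = i := by
  have h0 : degSeq n r ≤ degSeq n 1 := by
    rw [degSeq_eq hn, degSeq_eq hn]
    exact Nat.sub_le_sub_left (Nat.mul_le_mul_right _ hr) _
  have h4 : 1 ≤ degSeq n (r + 1) := by
    rw [degSeq_eq hn]
    have : (r + 1) * K ≤ K * K := Nat.mul_le_mul_right _ hrK
    have : 0 < K ^ 2 := by positivity
    rw [← sq] at *
    omega
  set c := i + degSeq n (r + 1) - 1 with hc
  have h1 : r ≤ slotLevel n c := (le_slotLevel_iff hn hK hrK.le).2 (Or.inr (by omega))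
  have h2 : ¬ r + 1 ≤ slotLevel n c := fun h => by
    have := (le_slotLevel_iff hn hK (k := r + 1) hrK).1 h
    omega
  have h3 : slotLevel n c = r := by omega
  refine ⟨⟨c, show c < degSeq n 1 - 1 by omega⟩, h3, ?_⟩
  change slotIndex n c = i
  rw [slotIndex, h3]
  omega

theorem degSeq_self (hn : n = K ^ 2) : degSeq n K = n := by
  rw [degSeq_eq hn, hn]
  have : K * K = K ^ 2 := (sq K).symm
  omega

end Slots

/-! ### Self-similar trees as rooted trees -/

namespace TreeVertex

variable {n K k j : ℕ}

/-- The parent of a vertex, if it is not the root. -/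
def par : {k j : ℕ} → TreeVertex n k j → Option (TreeVertex n k j)
  | _, _, .here => none
  | _, _, .base h c w => some (match par w with
      | none => .here
      | some w' => .base h c w')
  | _, _, .deco h r hr i w => some (match par w with
      | none => .here
      | some w' => .deco h r hr i w')

/-- The level of the copy of a perfect tree to which the vertex belongs. -/
def lev : {k j : ℕ} → TreeVertex n k j → ℕ
  | k, _, .here => k
  | _, _, .base _ _ w => lev w
  | _, _, .deco _ _ _ _ w => lev w

/-- The depth of the vertex within its copy of a perfect tree. -/
def dep : {k j : ℕ} → TreeVertex n k j → ℕ
  | _, j, .here => j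
  | _, _, .base _ _ w => dep w
  | _, _, .deco _ _ _ _ w => dep w

/-- The number of steps from the root. -/
def len : {k j : ℕ} → TreeVertex n k j → ℕ
  | _, _, .here => 0
  | _, _, .base _ _ w => len w + 1
  | _, _, .deco _ _ _ _ w => len w + 1

/-- The slot of the last step on the way to the vertex. -/
def lastSlot : {k j : ℕ} → TreeVertex n k j → ℕ
  | _, _, .here => 0
  | _, _, .base _ c w => match par w with
      | none => c
      | some _ => lastSlot w
  | _, _, .deco _ r _ i w => match par w with
      | none => i + degSeq n (r + 1) - 1
      | some _ => lastSlot w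

/-- The child of a vertex in the slot `c`, or the vertex itself where there is no such child. -/
def child : {k j : ℕ} → TreeVertex n k j → ℕ → TreeVertex n k j
  | k, j, .here, c =>
    if hj : j < depthSeq n k then
      if hc : c < degSeq n k - 1 then .base hj ⟨c, hc⟩ .here
      else if h : (1 ≤ slotLevel n c ∧ slotLevel n c < k) ∧
          slotIndex n c < degSeq n (slotLevel n c) - degSeq n (slotLevel n c + 1) then
        .deco hj (slotLevel n c) h.1 ⟨slotIndex n c, h.2⟩ .here
      else .here
    else .here
  | _, _, .base h c' w, c => .base h c' (child w c)
  | _, _, .deco h r hr i w, c => .deco h r hr i (child w c)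

theorem par_eq_none {w : TreeVertex n k j} : par w = none ↔ w = .here := by
  cases w <;> simp [par]

theorem isChild_iff {v w : TreeVertex n k j} : IsChild v w ↔ par w = some v := by
  constructor
  · intro h
    induction h with
    | base_root => simp [par]
    | deco_root => simp [par]
    | base_step h c _ ih => simp [par, ih]
    | deco_step h r hr i _ ih => simp [par, ih]
  · intro h
    induction w with
    | here => simp [par] at h
    | base hj c w ih =>
      rcases hw : par w with _ | w'
      · obtain rfl := par_eq_none.1 hw
        simp only [par, Option.some.injEq] at h
        subst h
        exact .base_root hj c
      · simp only [par, hw, Option.some.injEq] at h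
        subst h
        exact .base_step hj c (ih hw)
    | deco hj r hr i w ih =>
      rcases hw : par w with _ | w'
      · obtain rfl := par_eq_none.1 hw
        simp only [par, Option.some.injEq] at h
        subst h
        exact .deco_root hj r hr i
      · simp only [par, hw, Option.some.injEq] at h
        subst h
        exact .deco_step hj r hr i (ih hw)

theorem lev_le (w : TreeVertex n k j) : lev w ≤ k := by
  induction w with
  | here => exact le_rfl
  | base h c w ih => exact ih
  | deco h r hr i w ih => exact ih.trans hr.2.le

theorem one_le_lev (hk : 1 ≤ k) (w : TreeVertex n k j) : 1 ≤ lev w := by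
  induction w with
  | here => exact hk
  | base h c w ih => exact ih hk
  | deco h r hr i w ih => exact ih hr.1

theorem dep_le (hj : j ≤ depthSeq n k) (w : TreeVertex n k j) : dep w ≤ depthSeq n (lev w) := by
  induction w with
  | here => exact hj
  | base h c w ih => exact ih h
  | deco h r hr i w ih => exact ih (Nat.zero_le _)

theorem child_here (hn : n = K ^ 2) (hK : 2 ≤ K) (hk : k ≤ K) (hj : j < depthSeq n k)
    (c : Fin (numSlots n)) :
    (∃ hc : (c : ℕ) < degSeq n k - 1, k ≤ slotLevel n c ∧
        child (.here : TreeVertex n k j) c = .base hj ⟨c, hc⟩ .here) ∨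
      (slotLevel n c < k ∧ ∃ h : 1 ≤ slotLevel n c ∧ slotLevel n c < k, ∃ hi,
        child (.here : TreeVertex n k j) c
          = .deco hj (slotLevel n c) h ⟨slotIndex n c, hi⟩ .here) := by
  have h1 := one_le_slotLevel hn hK c
  by_cases hc : (c : ℕ) < degSeq n k - 1
  · left
    exact ⟨hc, (le_slotLevel_iff hn hK hk).2 (Or.inr hc), by simp [child, hj, hc]⟩
  · right
    have h2 : k ≠ 0 := by
      rintro rfl
      simp [depthSeq] at hj
    have h3 : slotLevel n c < k := by
      by_contra! h
      have := (le_slotLevel_iff hn hK hk).1 h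
      omega
    have h4 := slotIndex_lt hn hK c (h3.trans_le hk)
    exact ⟨h3, ⟨h1, h3⟩, h4, by simp [child, hj, hc, h1, h3, h4]⟩

/-- All facts about a child of an inner vertex, in one induction. -/
theorem child_spec (hn : n = K ^ 2) (hK : 2 ≤ K) (hk : k ≤ K) (v : TreeVertex n k j)
    (hv : dep v < depthSeq n (lev v)) (c : Fin (numSlots n)) :
    par (child v c) = some v ∧ lev (child v c) = min (lev v) (slotLevel n c) ∧
      dep (child v c) = (if lev v ≤ slotLevel n c then dep v + 1 else 0) ∧
      len (child v c) = len v + 1 ∧ lastSlot (child v c) = c := by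
  induction v with
  | @here k j =>
    have hj : j < depthSeq n k := hv
    rcases child_here hn hK hk hj c with ⟨hc, h1, h2⟩ | ⟨h1, h2, h3, h4⟩
    · rw [h2]
      simp [par, lev, dep, len, lastSlot, h1]
    · rw [h4]
      have := slotIndex_add hn hK (h1.trans_le hk)
      refine ⟨by simp [par], by simp [lev, h1.le], (if_neg (not_le.2 h1)).symm, by simp [len], ?_⟩
      simp only [lastSlot, par]
      omega
  | base h c' w ih =>
    obtain ⟨h1, h2, h3, h4, h5⟩ := ih hk hv
    simp only [child, par, lev, dep, len, lastSlot, h1, h2, h3, h4, h5]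
    exact ⟨trivial, trivial, rfl, trivial, trivial⟩
  | deco h r hr i w ih =>
    obtain ⟨h1, h2, h3, h4, h5⟩ := ih (hr.2.le.trans hk) hv
    simp only [child, par, lev, dep, len, lastSlot, h1, h2, h3, h4, h5]
    exact ⟨trivial, trivial, rfl, trivial, trivial⟩

theorem exists_child_eq (hn : n = K ^ 2) (hK : 2 ≤ K) (hk : k ≤ K) {v w : TreeVertex n k j}
    (h : par w = some v) :
    dep v < depthSeq n (lev v) ∧ ∃ c : Fin (numSlots n), w = child v c := by
  induction w with
  | here => simp [par] at h
  | @base k j hj c w ih =>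
    rcases hw : par w with _ | w'
    · obtain rfl := par_eq_none.1 hw
      simp only [par, Option.some.injEq] at h
      subst h
      have hle : degSeq n k - 1 ≤ numSlots n := by
        have hk1 : k ≠ 0 := by rintro rfl; simp [depthSeq] at hj
        rw [numSlots, degSeq_eq hn, degSeq_eq hn]
        have : 1 * K ≤ k * K := Nat.mul_le_mul_right _ (by omega)
        omega
      exact ⟨hj, ⟨c, c.2.trans_le hle⟩, by simp [child, hj]⟩
    · simp only [par, hw, Option.some.injEq] at h
      subst h
      obtain ⟨h1, c', h2⟩ := ih hk hw
      exact ⟨h1, c', by rw [h2]; rfl⟩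
  | @deco k j hj r hr i w ih =>
    rcases hw : par w with _ | w'
    · obtain rfl := par_eq_none.1 hw
      simp only [par, Option.some.injEq] at h
      subst h
      obtain ⟨c, h1, h2⟩ := exists_slot hn hK hr.1 (hr.2.trans_le hk) i.2
      refine ⟨hj, c, ?_⟩
      rcases child_here hn hK hk hj c with ⟨hc, h3, -⟩ | ⟨h3, h4, h5, h6⟩
      · omega
      · rw [h6]
        obtain ⟨i, hi⟩ := i
        simp only at h2
        subst h2
        subst h1
        rfl
    · simp only [par, hw, Option.some.injEq] at h
      subst h
      obtain ⟨h1, c', h2⟩ := ih (hr.2.le.trans hk) hw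
      exact ⟨h1, c', by rw [h2]; rfl⟩

theorem par_ne (w : TreeVertex n k j) : par w ≠ some w := by
  induction w with
  | here => simp [par]
  | base h c w ih =>
    rcases hw : par w with _ | w'
    · simp [par, hw]
    · simp only [par, hw, ne_eq, Option.some.injEq, base.injEq, true_and]
      rintro rfl
      exact ih hw
  | deco h r hr i w ih =>
    rcases hw : par w with _ | w'
    · simp [par, hw]
    · simp only [par, hw, ne_eq, Option.some.injEq, deco.injEq, heq_eq_eq, true_and]
      rintro rfl
      exact ih hw

theorem selfSimilarTree_adj {v w : TreeVertex n k 0} :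
    (selfSimilarTree n k).Adj v w ↔ par w = some v ∨ par v = some w := by
  rw [selfSimilarTree, SimpleGraph.fromRel_adj, isChild_iff, isChild_iff]
  constructor
  · exact fun h => h.2
  · refine fun h => ⟨?_, h⟩
    rintro rfl
    exact par_ne v (h.elim id id)

theorem len_of_par {v w : TreeVertex n k j} (h : par w = some v) : len w = len v + 1 := by
  induction w with
  | here => simp [par] at h
  | base hj c w ih =>
    rcases hw : par w with _ | w'
    · obtain rfl := par_eq_none.1 hw
      simp only [par, Option.some.injEq] at h
      subst h
      rfl
    · simp only [par, hw, Option.some.injEq] at h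
      subst h
      simp only [len, ih hw]
  | deco hj r hr i w ih =>
    rcases hw : par w with _ | w'
    · obtain rfl := par_eq_none.1 hw
      simp only [par, Option.some.injEq] at h
      subst h
      rfl
    · simp only [par, hw, Option.some.injEq] at h
      subst h
      simp only [len, ih hw]

end TreeVertex

/-! ### The forest of expander vertices around a hull -/

/-- The vertices at distance between `1` and `ρ` from `Z` form a forest, in which every vertex at
distance less than `ρ` has `q` children besides its parent. They form the set `hid`, and `lay` is
the distance from `Z`. -/
structure BallForest {W : Type} (E : SimpleGraph W) (Z : Set W) (ρ q : ℕ) where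
  hid : Set W
  lay : W → ℕ
  parent : W → W
  kids : W → Fin q → W
  hid_subset : hid ⊆ within E Z ρ
  disjoint : ∀ u ∈ Z, u ∉ hid
  lay_le : ∀ u ∈ hid, lay u ≤ ρ
  kids_hid : ∀ u ∈ hid, lay u < ρ → ∀ c, kids u c ∈ hid
  kids_inj : ∀ u ∈ hid, lay u < ρ → Function.Injective (kids u)
  parent_kids : ∀ u ∈ hid, lay u < ρ → ∀ c, parent (kids u c) = u
  lay_kids : ∀ u ∈ hid, lay u < ρ → ∀ c, lay (kids u c) = lay u + 1
  adj_iff : ∀ u ∈ hid, lay u < ρ → ∀ b, (E.Adj u b ↔ b = parent u ∨ ∃ c, b = kids u c)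
  adj_of_mem : ∀ u ∈ Z, ∀ b, E.Adj u b → b ∈ Z ∨ (b ∈ hid ∧ parent b = u)
  hid_cases : ∀ u ∈ hid, (parent u ∈ Z ∧ lay u = 1) ∨
    ((parent u ∈ hid ∧ lay (parent u) < ρ) ∧ ∃ c, u = kids (parent u) c)

/-- The parent of a vertex outside `Z` is the only neighbor that is no further from `Z`, and all other
neighbors are its children. -/
theorem exists_ballForest {W : Type} [Finite W] {E : SimpleGraph W} {Z : Set W} {ρ q : ℕ}
    (hρ : 1 ≤ ρ) (hreg : ∀ w, (E.neighborSet w).ncard = q + 1)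
    (huniq : ∀ s < ρ, ∀ w a b, w ∉ within E Z s → E.Adj w a → a ∈ within E Z (s + 1) →
      E.Adj w b → b ∈ within E Z (s + 1) → a = b) :
    Nonempty (BallForest E Z ρ q) := by
  classical
  set lay : W → ℕ := fun w => sInf {s | w ∈ within E Z s} with hlay
  have lay_mem : ∀ {s w}, w ∈ within E Z s → w ∈ within E Z (lay w) := fun h =>
    Nat.sInf_mem (s := {s | _ ∈ within E Z s}) ⟨_, h⟩
  have lay_le : ∀ {s w}, w ∈ within E Z s → lay w ≤ s := fun {s w} h => Nat.sInf_le h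
  have lt_lay : ∀ {s t w}, w ∉ within E Z s → w ∈ within E Z t → s < lay w := by
    intro s t w h h'
    by_contra! hle
    exact h (within_mono hle (lay_mem h'))
  have notMem : ∀ {s w}, s < lay w → w ∉ within E Z s := fun h h' =>
    absurd (lay_le h') (by omega)
  set hid : Set W := {w | w ∈ within E Z ρ ∧ w ∉ Z} with hhid
  have hid_lay : ∀ {u}, u ∈ hid → 1 ≤ lay u ∧ lay u ≤ ρ ∧ u ∈ within E Z (lay u) := fun {u} h =>
    ⟨lt_lay (mt mem_within_zero.1 h.2) h.1, lay_le h.1, lay_mem h.1⟩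
  have hpar : ∀ u, ∃ a, u ∈ hid → E.Adj u a ∧ a ∈ within E Z (lay u - 1) := by
    intro u
    by_cases hu : u ∈ hid
    · obtain ⟨h1, h2, h3⟩ := hid_lay hu
      obtain ⟨l, hl⟩ : ∃ l, lay u = l + 1 := ⟨lay u - 1, by omega⟩
      rw [hl] at h3 ⊢
      rcases exists_adj_of_mem_within_succ h3 with h | ⟨a, h⟩
      · exact absurd h hu.2
      · exact ⟨a, fun _ => h⟩
    · exact ⟨u, fun h => absurd h hu⟩
  choose parent hparent using hpar
  have eq_parent : ∀ {u a}, u ∈ hid → E.Adj u a → a ∈ within E Z (lay u) → a = parent u := by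
    intro u a hu hua ha
    obtain ⟨h1, h2, h3⟩ := hid_lay hu
    obtain ⟨h4, h5⟩ := hparent u hu
    refine huniq (lay u - 1) (by omega) u a (parent u) (notMem (by omega)) hua ?_ h4
      (within_mono (Nat.le_succ _) h5)
    rwa [Nat.sub_add_cancel h1]
  have other : ∀ {u b}, u ∈ hid → lay u < ρ → E.Adj u b → b ≠ parent u →
      b ∈ hid ∧ lay b = lay u + 1 ∧ parent b = u := by
    intro u b hu hlt hub hb
    obtain ⟨h1, h2, h3⟩ := hid_lay hu
    have h4 : b ∉ within E Z (lay u) := fun h => hb (eq_parent hu hub h)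
    have h5 : b ∈ within E Z (lay u + 1) := mem_within_succ_of_adj hub.symm h3
    have h6 : lay b = lay u + 1 := le_antisymm (lay_le h5) (lt_lay h4 h5)
    have h7 : b ∈ hid := ⟨within_mono (by omega) h5, fun h =>
      h4 (within_mono (Nat.zero_le _) (mem_within_zero.2 h))⟩
    refine ⟨h7, h6, (eq_parent h7 hub.symm ?_).symm⟩
    rw [h6]
    exact within_mono (Nat.le_succ _) h3
  have hkids : ∀ u, ∃ f : Fin q → W, u ∈ hid → Function.Injective f ∧
      ∀ b, (∃ c, f c = b) ↔ E.Adj u b ∧ b ≠ parent u := by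
    intro u
    by_cases hu : u ∈ hid
    · have hcard : (E.neighborSet u \ {parent u}).ncard = q := by
        have := Set.ncard_sdiff_singleton_add_one (s := E.neighborSet u) (a := parent u)
          (hparent u hu).1 (Set.toFinite _)
        rw [hreg] at this
        omega
      have e : Fin q ≃ ↥(E.neighborSet u \ {parent u}) :=
        (Finite.equivFinOfCardEq (by rw [← hcard]; rfl)).symm
      refine ⟨fun c => e c, fun _ => ⟨Subtype.val_injective.comp e.injective, fun b => ?_⟩⟩
      constructor
      · rintro ⟨c, rfl⟩
        exact (e c).2
      · intro h
        exact ⟨e.symm ⟨b, h⟩, by simp⟩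
    · exact ⟨fun _ => u, fun h => absurd h hu⟩
  choose kids hkids using hkids
  have kid : ∀ {u}, u ∈ hid → ∀ c, E.Adj u (kids u c) ∧ kids u c ≠ parent u := fun {u} hu c =>
    ((hkids u hu).2 _).1 ⟨c, rfl⟩
  exact ⟨{
    hid := hid
    lay := lay
    parent := parent
    kids := kids
    hid_subset := fun u hu => hu.1
    disjoint := fun u hu h => h.2 hu
    lay_le := fun u hu => (hid_lay hu).2.1
    kids_hid := fun u hu hlt c => (other hu hlt (kid hu c).1 (kid hu c).2).1
    kids_inj := fun u hu _ => (hkids u hu).1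
    parent_kids := fun u hu hlt c => (other hu hlt (kid hu c).1 (kid hu c).2).2.2
    lay_kids := fun u hu hlt c => (other hu hlt (kid hu c).1 (kid hu c).2).2.1
    adj_iff := by
      intro u hu _ b
      constructor
      · intro hub
        by_cases hb : b = parent u
        · exact Or.inl hb
        · obtain ⟨c, hc⟩ := ((hkids u hu).2 b).2 ⟨hub, hb⟩
          exact Or.inr ⟨c, hc.symm⟩
      · rintro (rfl | ⟨c, rfl⟩)
        · exact (hparent u hu).1
        · exact (kid hu c).1
    adj_of_mem := by
      intro u hu b hub
      by_cases hb : b ∈ Z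
      · exact Or.inl hb
      have hu0 : u ∈ within E Z 0 := mem_within_zero.2 hu
      have hb1 : b ∈ within E Z 1 := mem_within_succ_of_adj hub.symm hu0
      have hbh : b ∈ hid := ⟨within_mono hρ hb1, hb⟩
      exact Or.inr ⟨hbh, (eq_parent hbh hub.symm (within_mono (Nat.zero_le _) hu0)).symm⟩
    hid_cases := by
      intro u hu
      obtain ⟨h1, h2, h3⟩ := hid_lay hu
      obtain ⟨h4, h5⟩ := hparent u hu
      rcases Nat.eq_or_lt_of_le h1 with h6 | h6
      · rw [← h6] at h5
        exact Or.inl ⟨mem_within_zero.1 h5, h6.symm⟩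
      · right
        have h7 : parent u ∉ within E Z (lay u - 2) := by
          intro h
          have := mem_within_succ_of_adj h4 h
          exact notMem (by omega) this
        have h8 : lay (parent u) = lay u - 1 := le_antisymm (lay_le h5)
          (by have := lt_lay h7 h5; omega)
        have h9 : parent u ∈ hid := ⟨within_mono (by omega) h5, fun h =>
          h7 (within_mono (Nat.zero_le _) (mem_within_zero.2 h))⟩
        refine ⟨⟨h9, by omega⟩, ?_⟩
        obtain ⟨c, hc⟩ := ((hkids (parent u) h9).2 u).2 ⟨h4.symm, by
          intro h
          have h10 := (hparent (parent u) h9).2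
          rw [← h, h8] at h10
          exact notMem (by omega) h10⟩
        exact ⟨c, hc.symm⟩ }⟩

/-! ### The decorated expander as a self-similar forest -/

namespace CoreVertex

variable {n K : ℕ} {W : Type} {E : SimpleGraph W}

/-- The expander vertex to which a vertex of the decorated expander is attached. -/
def anchor : CoreVertex n W → W
  | .expander u => u
  | .tree u _ _ _ _ => u

/-- The number of steps from a vertex to the expander. -/
def toExpander : CoreVertex n W → ℕ
  | .expander _ => 0
  | .tree _ _ _ _ w => w.len + 1

/-- The next vertex on the way from a tree vertex to the expander. -/
def treePar (u : W) (k : ℕ) (hk : 1 ≤ k ∧ k < n.sqrt)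
    (i : Fin (degSeq n k - degSeq n (k + 1))) (w : TreeVertex n k 0) : CoreVertex n W :=
  match w.par with
  | none => .expander u
  | some w' => .tree u k hk i w'

theorem adj_expander {u : W} {y : CoreVertex n W} :
    (coreGraph n E).Adj (.expander u) y ↔
      (∃ v, y = .expander v ∧ E.Adj u v) ∨ ∃ k hk i, y = .tree u k hk i .here := by
  rw [coreGraph, SimpleGraph.fromRel_adj]
  constructor
  · rintro ⟨-, h | h⟩
    · cases h with
      | edge h => exact Or.inl ⟨_, rfl, h⟩
      | root _ k hk i => exact Or.inr ⟨k, hk, i, rfl⟩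
    · cases h with
      | edge h => exact Or.inl ⟨_, rfl, h.symm⟩
  · rintro (⟨v, rfl, h⟩ | ⟨k, hk, i, rfl⟩)
    · exact ⟨by simpa using h.ne, Or.inl (.edge h)⟩
    · exact ⟨by simp, Or.inl (.root _ k hk i)⟩

theorem adj_tree {u : W} {k : ℕ} {hk : 1 ≤ k ∧ k < n.sqrt}
    {i : Fin (degSeq n k - degSeq n (k + 1))} {w : TreeVertex n k 0} {y : CoreVertex n W} :
    (coreGraph n E).Adj (.tree u k hk i w) y ↔
      y = treePar u k hk i w ∨ ∃ w', w'.par = some w ∧ y = .tree u k hk i w' := by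
  have hpar : ∀ w', (selfSimilarTree n k).Adj w w' → CoreVertex.tree u k hk i w' = treePar u k hk i w ∨
      ∃ w'', w''.par = some w ∧ CoreVertex.tree u k hk i w' = .tree u k hk i w'' := by
    intro w' h
    rcases TreeVertex.selfSimilarTree_adj.1 h with h | h
    · exact Or.inr ⟨w', h, rfl⟩
    · exact Or.inl (by rw [treePar, h])
  rw [coreGraph, SimpleGraph.fromRel_adj]
  constructor
  · rintro ⟨-, h | h⟩
    · cases h with
      | inner _ _ _ _ h => exact hpar _ h
    · cases h with
      | root => exact Or.inl rfl
      | inner _ _ _ _ h => exact hpar _ h.symm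
  · rintro (rfl | ⟨w', h, rfl⟩)
    · rcases hw : w.par with _ | w'
      · obtain rfl := TreeVertex.par_eq_none.1 hw
        rw [treePar, hw]
        exact ⟨by simp, Or.inr (.root _ _ _ _)⟩
      · have h : (selfSimilarTree n k).Adj w w' := TreeVertex.selfSimilarTree_adj.2 (Or.inr hw)
        rw [treePar, hw]
        exact ⟨by simpa using h.ne, Or.inl (.inner _ _ _ _ h)⟩
    · have h : (selfSimilarTree n k).Adj w w' := TreeVertex.selfSimilarTree_adj.2 (Or.inl h)
      exact ⟨by simpa using h.ne, Or.inl (.inner _ _ _ _ h)⟩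

theorem anchor_treePar {u : W} {k : ℕ} {hk : 1 ≤ k ∧ k < n.sqrt}
    {i : Fin (degSeq n k - degSeq n (k + 1))} {w : TreeVertex n k 0} :
    (treePar u k hk i w).anchor = u := by
  rw [treePar]
  cases w.par <;> rfl

variable {Z : Set W} {ρ : ℕ} (B : BallForest E Z ρ (n - 1))

/-- The level of a vertex, the expander having level `√n`. -/
def level : CoreVertex n W → ℕ
  | .expander _ => n.sqrt
  | .tree _ _ _ _ w => w.lev

/-- The depth of a vertex within its level. -/
def depth : CoreVertex n W → ℕ
  | .expander u => B.lay u
  | .tree _ _ _ _ w => w.dep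

/-- The depth of a vertex in the forest. -/
def height : CoreVertex n W → ℕ
  | .expander u => B.lay u
  | .tree u _ _ _ w => B.lay u + 1 + w.len

/-- The parent of a vertex in the forest. -/
def parent : CoreVertex n W → CoreVertex n W
  | .expander u => .expander (B.parent u)
  | .tree u k hk i w => treePar u k hk i w

/-- The child of a vertex in the slot `c`, or the vertex itself where there is no such child. -/
def child : CoreVertex n W → ℕ → CoreVertex n W
  | .expander u, c =>
    if h : c < n - 1 then .expander (B.kids u ⟨c, h⟩)
    else if h : (1 ≤ slotLevel n c ∧ slotLevel n c < n.sqrt) ∧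
        slotIndex n c < degSeq n (slotLevel n c) - degSeq n (slotLevel n c + 1) then
      .tree u (slotLevel n c) h.1 ⟨slotIndex n c, h.2⟩ .here
    else .expander u
  | .tree u k hk i w, c => .tree u k hk i (w.child c)

/-- The slot of a tree whose root is attached to the expander. -/
def rootSlot : CoreVertex n W → ℕ
  | .expander _ => 0
  | .tree _ k _ i _ => i + degSeq n (k + 1) - 1

/-- The vertices of the forest: those attached to the forest around `Z`, except that the trees
attached to its last layer are left out. -/
def Covered (x : CoreVertex n W) : Prop :=
  x.anchor ∈ B.hid ∧ ∀ u, x.anchor = u → x ≠ .expander u → B.lay u < ρ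

variable {B}

theorem child_expander (hn : n = K ^ 2) (hK : 2 ≤ K) (u : W) (c : Fin (numSlots n)) :
    (∃ h : (c : ℕ) < n - 1, n.sqrt ≤ slotLevel n c ∧
        child B (.expander u) c = .expander (B.kids u ⟨c, h⟩)) ∨
      (slotLevel n c < n.sqrt ∧ ∃ h hi,
        child B (.expander u) c = .tree u (slotLevel n c) h ⟨slotIndex n c, hi⟩ .here) := by
  have h1 := le_slotLevel_iff hn hK le_rfl (c := c)
  rw [degSeq_self hn] at h1
  by_cases hc : (c : ℕ) < n - 1
  · exact Or.inl ⟨hc, by rw [sqrt_eq hn]; exact h1.2 (Or.inr hc), by simp [child, hc]⟩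
  · have h2 : slotLevel n c < K := by
      by_contra! h
      have := h1.1 h
      omega
    have h3 : 1 ≤ slotLevel n c ∧ slotLevel n c < n.sqrt :=
      ⟨one_le_slotLevel hn hK c, by rwa [sqrt_eq hn]⟩
    have h4 := slotIndex_lt hn hK c h2
    exact Or.inr ⟨h3.2, h3, h4, by simp [child, hc, h3, h4]⟩

theorem numSlots_ge (hn : n = K ^ 2) (hK : 2 ≤ K) : n - 1 ≤ numSlots n := by
  have h := degSeq_eq hn 1
  have : 2 * K ≤ K ^ 2 := by nlinarith
  rw [numSlots, h, hn]
  omega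

/-- All facts about a child of an inner vertex. -/
theorem child_spec (hn : n = K ^ 2) (hK : 2 ≤ K) {x : CoreVertex n W} (hc : Covered B x)
    (hd : x.depth B < if x.level < K then depthSeq n x.level else ρ) (c : Fin (numSlots n)) :
    Covered B (child B x c) ∧ parent B (child B x c) = x ∧
      (child B x c).level = min x.level (slotLevel n c) ∧
      (child B x c).depth B = (if x.level ≤ slotLevel n c then x.depth B + 1 else 0) ∧
      (child B x c).height B = x.height B + 1 := by
  obtain ⟨hx, hcut⟩ := hc
  cases x with
  | expander u =>
    have hlt : B.lay u < ρ := by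
      rw [if_neg (by rw [level, sqrt_eq hn]; omega)] at hd
      exact hd
    rcases child_expander (B := B) hn hK u c with ⟨h1, h2, h3⟩ | ⟨h1, h2, h3, h4⟩
    · rw [h3]
      refine ⟨⟨B.kids_hid u hx hlt _, by rintro _ rfl h; exact (h rfl).elim⟩, ?_, (min_eq_left h2).symm, ?_, B.lay_kids u hx hlt _⟩
      · rw [parent, B.parent_kids u hx hlt]
      · exact (B.lay_kids u hx hlt _).trans (if_pos h2).symm
    · rw [h4]
      exact ⟨⟨hx, by rintro _ rfl -; exact hlt⟩, rfl, (min_eq_right h1.le).symm, (if_neg (not_le.2 h1)).symm, rfl⟩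
  | tree u k hk i w =>
    have hkK : k < K := by rw [← sqrt_eq hn]; exact hk.2
    have hwK : w.lev < K := (w.lev_le).trans_lt hkK
    have hd' : w.dep < depthSeq n w.lev := by
      rw [if_pos (show level (tree u k hk i w) < K from hwK)] at hd
      exact hd
    obtain ⟨h1, h2, h3, h4, -⟩ := TreeVertex.child_spec hn hK hkK.le w hd' c
    refine ⟨⟨hx, by rintro _ rfl -; exact hcut _ rfl (by simp)⟩, ?_, h2, h3, ?_⟩
    · simp only [child, parent, treePar, h1]
    · simp only [child, height, h4]
      omega

theorem child_injective (hn : n = K ^ 2) (hK : 2 ≤ K) {x : CoreVertex n W}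
    (hx : x.anchor ∈ B.hid)
    (hd : x.depth B < if x.level < K then depthSeq n x.level else ρ) :
    Function.Injective fun c : Fin (numSlots n) => child B x c := by
  intro c c' h
  simp only at h
  cases x with
  | expander u =>
    have hlt : B.lay u < ρ := by
      rw [if_neg (by rw [level, sqrt_eq hn]; omega)] at hd
      exact hd
    rcases child_expander (B := B) hn hK u c with ⟨h1, h2, h3⟩ | ⟨h1, h2, h3, h4⟩ <;>
      rcases child_expander (B := B) hn hK u c' with ⟨h1', h2', h3'⟩ | ⟨h1', h2', h3', h4'⟩
    · rw [h3, h3', expander.injEq] at h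
      have := B.kids_inj u hx hlt h
      simp only [Fin.mk.injEq] at this
      exact Fin.ext this
    · rw [h3, h4'] at h
      cases h
    · rw [h4, h3'] at h
      cases h
    · rw [h4, h4'] at h
      have := congrArg rootSlot h
      simp only [rootSlot] at this
      rw [sqrt_eq hn] at h1 h1'
      rw [slotIndex_add hn hK h1, slotIndex_add hn hK h1'] at this
      exact Fin.ext (by omega)
  | tree u k hk i w =>
    have hkK : k < K := by rw [← sqrt_eq hn]; exact hk.2
    have hwK : w.lev < K := (w.lev_le).trans_lt hkK
    have hd' : w.dep < depthSeq n w.lev := by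
      rw [if_pos (show level (tree u k hk i w) < K from hwK)] at hd
      exact hd
    simp only [child, tree.injEq, heq_eq_eq, true_and] at h
    have h1 := (TreeVertex.child_spec hn hK hkK.le w hd' c).2.2.2.2
    have h2 := (TreeVertex.child_spec hn hK hkK.le w hd' c').2.2.2.2
    rw [h] at h1
    exact Fin.ext (h1.symm.trans h2)

theorem adj_iff_of_inner (hn : n = K ^ 2) (hK : 2 ≤ K) {x : CoreVertex n W}
    (hx : x.anchor ∈ B.hid)
    (hd : x.depth B < if x.level < K then depthSeq n x.level else ρ) (y : CoreVertex n W) :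
    (coreGraph n E).Adj x y ↔
      y = parent B x ∨ ∃ c : Fin (numSlots n), y = child B x c := by
  cases x with
  | expander u =>
    have hlt : B.lay u < ρ := by
      rw [if_neg (by rw [level, sqrt_eq hn]; omega)] at hd
      exact hd
    rw [adj_expander]
    constructor
    · rintro (⟨v, rfl, h⟩ | ⟨k, hk, i, rfl⟩)
      · rcases (B.adj_iff u hx hlt v).1 h with rfl | ⟨c, rfl⟩
        · exact Or.inl rfl
        · refine Or.inr ⟨⟨c, c.2.trans_le (numSlots_ge hn hK)⟩, ?_⟩
          simp [child]
      · right
        have hkK : k < K := by rw [← sqrt_eq hn]; exact hk.2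
        obtain ⟨c, h1, h2⟩ := exists_slot hn hK hk.1 hkK i.2
        refine ⟨c, ?_⟩
        rcases child_expander (B := B) hn hK u c with ⟨-, h3, -⟩ | ⟨-, h3, h4, h5⟩
        · rw [sqrt_eq hn] at h3
          omega
        · rw [h5]
          obtain ⟨i, hi⟩ := i
          simp only at h2
          subst h2
          subst h1
          rfl
    · rintro (rfl | ⟨c, rfl⟩)
      · exact Or.inl ⟨_, rfl, (B.adj_iff u hx hlt _).2 (Or.inl rfl)⟩
      · rcases child_expander (B := B) hn hK u c with ⟨h1, h2, h3⟩ | ⟨h1, h2, h3, h4⟩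
        · rw [h3]
          exact Or.inl ⟨_, rfl, (B.adj_iff u hx hlt _).2 (Or.inr ⟨_, rfl⟩)⟩
        · rw [h4]
          exact Or.inr ⟨_, _, _, rfl⟩
  | tree u k hk i w =>
    have hkK : k < K := by rw [← sqrt_eq hn]; exact hk.2
    have hwK : w.lev < K := (w.lev_le).trans_lt hkK
    have hd' : w.dep < depthSeq n w.lev := by
      rw [if_pos (show level (tree u k hk i w) < K from hwK)] at hd
      exact hd
    rw [adj_tree]
    refine or_congr Iff.rfl ⟨?_, ?_⟩
    · rintro ⟨w', h, rfl⟩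
      obtain ⟨-, c, rfl⟩ := TreeVertex.exists_child_eq hn hK hkK.le h
      exact ⟨c, rfl⟩
    · rintro ⟨c, rfl⟩
      exact ⟨_, (TreeVertex.child_spec hn hK hkK.le w hd' c).1, rfl⟩

theorem adj_iff_of_leaf (hn : n = K ^ 2) (hK : 2 ≤ K) {x : CoreVertex n W}
    (hd : x.depth B = if x.level < K then depthSeq n x.level else ρ) (hl : x.level < K)
    (y : CoreVertex n W) : (coreGraph n E).Adj x y ↔ y = parent B x := by
  cases x with
  | expander u =>
    rw [level, sqrt_eq hn] at hl
    omega
  | tree u k hk i w =>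
    have hkK : k < K := by rw [← sqrt_eq hn]; exact hk.2
    rw [if_pos hl] at hd
    rw [adj_tree]
    refine ⟨fun h => h.resolve_right ?_, Or.inl⟩
    rintro ⟨w', hw', -⟩
    have h1 := (TreeVertex.exists_child_eq hn hK hkK.le hw').1
    have h2 : w.dep = depthSeq n w.lev := hd
    omega

theorem parent_cases (hn : n = K ^ 2) (hK : 2 ≤ K) {x : CoreVertex n W}
    (hc : Covered B x) :
    ((parent B x).anchor ∈ Z ∧ x.level = K ∧ x.depth B = 1) ∨
      ((Covered B (parent B x) ∧ (parent B x).depth B <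
        if (parent B x).level < K then depthSeq n (parent B x).level else ρ) ∧
        ∃ c : Fin (numSlots n), x = child B (parent B x) c) := by
  have key : ∀ y : CoreVertex n W, parent B x = y → Covered B y →
      (y.depth B < if y.level < K then depthSeq n y.level else ρ) →
      (∃ c : Fin (numSlots n), x = child B y c) →
      ((parent B x).anchor ∈ Z ∧ x.level = K ∧ x.depth B = 1) ∨
      ((Covered B (parent B x) ∧ (parent B x).depth B <
        if (parent B x).level < K then depthSeq n (parent B x).level else ρ) ∧
        ∃ c : Fin (numSlots n), x = child B (parent B x) c) := fun y hy h1 h2 h3 => by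
    rw [← hy] at h1 h2 h3
    exact Or.inr ⟨⟨h1, h2⟩, h3⟩
  obtain ⟨hx, hcut⟩ := hc
  cases x with
  | expander u =>
    rcases B.hid_cases u hx with ⟨h1, h2⟩ | ⟨⟨h1, h2⟩, c, h3⟩
    · exact Or.inl ⟨h1, sqrt_eq hn, h2⟩
    · refine key (.expander (B.parent u)) rfl ⟨h1, by rintro _ rfl h; exact (h rfl).elim⟩ ?_ ⟨⟨c, c.2.trans_le (numSlots_ge hn hK)⟩, ?_⟩
      · rw [if_neg (by rw [level, sqrt_eq hn]; omega)]
        exact h2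
      · rw [child, dif_pos c.2]
        exact congrArg _ h3
  | tree u k hk i w =>
    have hkK : k < K := by rw [← sqrt_eq hn]; exact hk.2
    have hlay : B.lay u < ρ := hcut u rfl (by simp)
    rcases hw : w.par with _ | w'
    · obtain rfl := TreeVertex.par_eq_none.1 hw
      have hd : depth B (expander u : CoreVertex n W) <
          if (expander u : CoreVertex n W).level < K then
            depthSeq n (expander u : CoreVertex n W).level else ρ := by
        rw [if_neg (by rw [level, sqrt_eq hn]; omega)]
        exact hlay
      refine key (.expander u) rfl ⟨hx, by rintro _ rfl h; exact (h rfl).elim⟩ hd ?_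
      have := (adj_iff_of_inner (B := B) hn hK (x := .expander u) hx hd
        (.tree u k hk i .here)).1 (adj_expander.2 (Or.inr ⟨k, hk, i, rfl⟩))
      exact this.resolve_left (by simp [parent])
    · obtain ⟨h1, c, rfl⟩ := TreeVertex.exists_child_eq hn hK hkK.le hw
      refine key (.tree u k hk i w') (by simp [parent, treePar, hw])
        ⟨hx, by rintro _ rfl -; exact hlay⟩ ?_ ⟨c, rfl⟩
      rw [if_pos (show level (tree u k hk i w') < K from (w'.lev_le).trans_lt hkK)]
      exact h1

/-- The forest of the decorated expander around the expander vertices within distance `ρ` of `Z`.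
What is attached to a vertex of `Z` is revealed. -/
def forest (hn : n = K ^ 2) (hK : 2 ≤ K) (B : BallForest E Z ρ (n - 1)) :
    Forest (mainGraph n E) (numSlots n) K (fun c => slotLevel n c)
      (fun k => if k < K then depthSeq n k else ρ) where
  revealed := Sum.inl '' {x | x.anchor ∈ Z}
  hidden := Sum.inl '' {x | Covered B x}
  level := Sum.elim level fun _ => 0
  dep := Sum.elim (depth B) fun _ => 0
  ht := Sum.elim (height B) fun _ => 0
  par := Sum.elim (fun x => .inl (parent B x)) .inr
  child := Sum.elim (fun x c => .inl (child B x c)) fun i _ => .inr i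
  disjoint := by
    rintro _ ⟨x, hx, rfl⟩ ⟨y, hy, h⟩
    obtain rfl := Sum.inl_injective h
    exact B.disjoint _ hx hy.1
  level_pos := by
    rintro _ ⟨x, hx, rfl⟩
    cases x with
    | expander u => simp only [Sum.elim_inl, level, sqrt_eq hn]; omega
    | tree u k hk i w => exact w.one_le_lev hk.1
  level_le := by
    rintro _ ⟨x, hx, rfl⟩
    cases x with
    | expander u => exact (sqrt_eq hn).le
    | tree u k hk i w => exact w.lev_le.trans (hk.2.le.trans (sqrt_eq hn).le)
  dep_le := by
    rintro _ ⟨x, hx, rfl⟩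
    cases x with
    | expander u =>
      simp only [Sum.elim_inl, level, sqrt_eq hn, lt_irrefl, if_false]
      exact B.lay_le u hx.1
    | tree u k hk i w =>
      have : w.lev < K := w.lev_le.trans_lt (hk.2.trans_eq (sqrt_eq hn))
      simp only [Sum.elim_inl, level, this, if_true]
      exact w.dep_le (Nat.zero_le _)
  child_hidden := by
    rintro _ ⟨x, hx, rfl⟩ hd c
    exact ⟨_, (child_spec hn hK hx hd c).1, rfl⟩
  child_inj := by
    rintro _ ⟨x, hx, rfl⟩ hd c c' h
    exact child_injective hn hK hx.1 hd (Sum.inl_injective h)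
  par_child := by
    rintro _ ⟨x, hx, rfl⟩ hd c
    exact congrArg Sum.inl (child_spec hn hK hx hd c).2.1
  level_child := by
    rintro _ ⟨x, hx, rfl⟩ hd c
    exact (child_spec hn hK hx hd c).2.2.1
  dep_child := by
    rintro _ ⟨x, hx, rfl⟩ hd c
    exact (child_spec hn hK hx hd c).2.2.2.1
  ht_child := by
    rintro _ ⟨x, hx, rfl⟩ hd c
    exact (child_spec hn hK hx hd c).2.2.2.2
  adj_inner := by
    rintro _ ⟨x, hx, rfl⟩ hd (y | i)
    · simpa [mainGraph] using adj_iff_of_inner hn hK hx.1 hd y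
    · simp [mainGraph]
  adj_leaf := by
    rintro _ ⟨x, hx, rfl⟩ hd hl (y | i)
    · simpa [mainGraph] using adj_iff_of_leaf hn hK hd hl y
    · simp [mainGraph]
  adj_revealed := by
    rintro _ ⟨x, hx, rfl⟩ (y | i) h
    · replace h : (coreGraph n E).Adj x y := by simpa [mainGraph] using h
      cases x with
      | expander u =>
        rcases adj_expander.1 h with ⟨v, rfl, h'⟩ | ⟨k, hk, i, rfl⟩
        · rcases B.adj_of_mem u hx v h' with h' | ⟨hv, rfl⟩
          · exact Or.inl ⟨_, h', rfl⟩
          · exact Or.inr ⟨⟨.expander v, ⟨hv, by rintro _ rfl h; exact (h rfl).elim⟩, rfl⟩, rfl⟩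
        · exact Or.inl ⟨.tree u k hk i .here, hx, rfl⟩
      | tree u k hk i w =>
        rcases adj_tree.1 h with rfl | ⟨w', -, rfl⟩
        · refine Or.inl ⟨_, ?_, rfl⟩
          change (treePar u k hk i w).anchor ∈ Z
          rw [anchor_treePar]
          exact hx
        · exact Or.inl ⟨.tree u k hk i w', hx, rfl⟩
    · simp [mainGraph] at h
  hidden_cases := by
    rintro _ ⟨x, hx, rfl⟩
    rcases parent_cases hn hK hx with ⟨h1, h2⟩ | ⟨⟨h1, h2⟩, c, h3⟩
    · exact Or.inl ⟨⟨_, h1, rfl⟩, h2⟩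
    · exact Or.inr ⟨⟨⟨_, h1, rfl⟩, h2⟩, c, congrArg Sum.inl h3⟩

end CoreVertex

/-! ### Distances measured on the expander -/

namespace CoreVertex

variable {n : ℕ} {W : Type} {E : SimpleGraph W}

theorem toExpander_le_of_adj {x y : CoreVertex n W} (h : (coreGraph n E).Adj x y) :
    x.toExpander ≤ y.toExpander + 1 := by
  cases x with
  | expander u => simp [toExpander]
  | tree u k hk i w =>
    rcases adj_tree.1 h with rfl | ⟨w', hw', rfl⟩
    · rw [treePar]
      rcases hw : w.par with _ | w'
      · obtain rfl := TreeVertex.par_eq_none.1 hw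
        exact le_rfl
      · exact Nat.succ_le_succ (TreeVertex.len_of_par hw).le
    · simp only [toExpander, TreeVertex.len_of_par hw']
      omega

theorem exists_walk_anchor (x : CoreVertex n W) :
    ∃ p : (coreGraph n E).Walk x (.expander x.anchor), p.length = x.toExpander := by
  induction hs : x.toExpander generalizing x with
  | zero =>
    cases x with
    | expander u => exact ⟨.nil, rfl⟩
    | tree u k hk i w => simp [toExpander] at hs
  | succ s ih =>
    cases x with
    | expander u => simp [toExpander] at hs
    | tree u k hk i w =>
      have hadj : (coreGraph n E).Adj (.tree u k hk i w) (treePar u k hk i w) :=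
        adj_tree.2 (Or.inl rfl)
      have hlen : (treePar u k hk i w).toExpander = s := by
        simp only [toExpander] at hs
        rw [treePar]
        rcases hw : w.par with _ | w'
        · obtain rfl := TreeVertex.par_eq_none.1 hw
          simp only [TreeVertex.len] at hs
          simp only [toExpander]
          omega
        · have := TreeVertex.len_of_par hw
          simp only [toExpander]
          omega
      have hex := ih _ hlen
      rw [anchor_treePar] at hex
      obtain ⟨p, hp⟩ := hex
      exact ⟨.cons hadj p, congrArg Nat.succ hp⟩

end CoreVertex

open Classical in
/-- In a walk that meets the expander, the steps inside the trees at its two ends come on top of the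
steps between its expander vertices. -/
theorem countP_expander_le {n : ℕ} {W : Type} {E : SimpleGraph W} {u v : Vertex n W}
    (p : (mainGraph n E).Walk u v)
    (hp : 1 ≤ p.support.countP fun w => decide (w ∈ expanderVertices n W)) :
    Sum.elim CoreVertex.toExpander (fun _ => 0) u + Sum.elim CoreVertex.toExpander (fun _ => 0) v +
      p.support.countP (fun w => decide (w ∈ expanderVertices n W)) ≤ p.length + 1 := by
  set f : Vertex n W → ℕ := Sum.elim CoreVertex.toExpander fun _ => 0 with hf
  have f_adj : ∀ {a b}, (mainGraph n E).Adj a b → f a ≤ f b + 1 := by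
    rintro (a | a) (b | b) h
    · exact CoreVertex.toExpander_le_of_adj (E := E) (by simpa [mainGraph] using h)
    all_goals simp [mainGraph] at h
  have f_exp : ∀ {a}, a ∈ expanderVertices n W → f a = 0 := by
    rintro _ ⟨u, rfl⟩
    rfl
  have f_walk : ∀ {a b} (p : (mainGraph n E).Walk a b), f b ≤ f a + p.length := by
    intro a b p
    induction p with
    | nil => simp
    | cons h p ih =>
      have := f_adj h.symm
      simp only [SimpleGraph.Walk.length_cons]
      omega
  induction p with
  | nil =>
    rename_i u
    have hu : u ∈ expanderVertices n W := by
      by_contra h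
      simp [h] at hp
    simp [hu, f_exp hu]
  | cons h p ih =>
    rename_i u w v
    simp only [SimpleGraph.Walk.support_cons, List.countP_cons,
      SimpleGraph.Walk.length_cons] at hp ⊢
    have h1 := f_adj h
    have h2 := f_adj h.symm
    have h3 := f_walk p
    by_cases hu : u ∈ expanderVertices n W
    · have h4 := f_exp hu
      simp only [hu, decide_true, if_true] at hp ⊢
      rcases Nat.eq_zero_or_pos (p.support.countP fun w => decide (w ∈ expanderVertices n W))
        with h0 | h0
      · omega
      · have := ih h0
        omega
    · simp only [hu, decide_false, Bool.false_eq_true, if_false, add_zero] at hp ⊢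
      have := ih hp
      omega

/-- The distance `dist_E` exceeds the distance of the anchors in `E` by at most one. -/
theorem distE_le {n : ℕ} {W : Type} {E : SimpleGraph W} (x y : CoreVertex n W)
    (q : E.Walk x.anchor y.anchor) :
    distE n E (.inl x : Vertex n W) (.inl y) ≤ (q.length + 1 : ℕ) := by
  classical
  obtain ⟨p₁, h₁⟩ := x.exists_walk_anchor (E := E)
  obtain ⟨p₂, h₂⟩ := y.exists_walk_anchor (E := E)
  let φ : E →g coreGraph n E :=
    ⟨CoreVertex.expander, fun h => CoreVertex.adj_expander.2 (Or.inl ⟨_, rfl, h⟩)⟩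
  let ι : coreGraph n E →g mainGraph n E := ⟨Sum.inl, fun h => by simpa [mainGraph] using h⟩
  let w : (mainGraph n E).Walk (.inl x) (.inl y) := ((p₁.append (q.map φ)).append p₂.reverse).map ι
  have hw : w.length = x.toExpander + q.length + y.toExpander := by
    rw [SimpleGraph.Walk.length_map, SimpleGraph.Walk.length_append,
      SimpleGraph.Walk.length_append, SimpleGraph.Walk.length_map, SimpleGraph.Walk.length_reverse,
      h₁, h₂]
  obtain ⟨p, hp⟩ := SimpleGraph.Reachable.exists_walk_length_eq_dist ⟨w⟩
  refine (iInf₂_le p hp).trans (Nat.cast_le.2 ?_)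
  have hdist : p.length ≤ w.length := hp.trans_le (SimpleGraph.dist_le w)
  rcases Nat.eq_zero_or_pos (p.support.countP fun w => decide (w ∈ expanderVertices n W))
    with h0 | h0
  · omega
  · have := countP_expander_le p h0
    simp only [Sum.elim_inl] at this
    omega

/-! ### Cyclic shifts of the slots -/

/-- The cyclic shift by `γ` of the first `M` of `D` slots. -/
def slotShift {D M : ℕ} [NeZero M] (h : M ≤ D) (γ : Fin M) : Equiv.Perm (Fin D) :=
  (Equiv.addLeft γ).extendDomain (Fin.castLEOrderIso h).toEquiv

section SlotShift

variable {D M : ℕ} [NeZero M] (h : M ≤ D) (γ : Fin M) (i : Fin D)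

theorem slotShift_of_lt (hi : (i : ℕ) < M) :
    ((slotShift h γ i : Fin D) : ℕ) = ((γ + ⟨i, hi⟩ : Fin M) : ℕ) := by
  have := Equiv.Perm.extendDomain_apply_image (Equiv.addLeft γ) (Fin.castLEOrderIso h).toEquiv
    ⟨i, hi⟩
  exact congrArg Fin.val this

theorem slotShift_of_le (hi : M ≤ (i : ℕ)) : slotShift h γ i = i :=
  Equiv.Perm.extendDomain_apply_not_subtype _ _ (by omega)

theorem slotShift_lt_iff : ((slotShift h γ i : Fin D) : ℕ) < M ↔ (i : ℕ) < M := by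
  by_cases hi : (i : ℕ) < M
  · simp only [slotShift_of_lt h γ i hi, hi, iff_true]
    exact Fin.is_lt _
  · rw [slotShift_of_le h γ i (by omega)]

theorem card_slotShift_lt_le {κ : ℕ} (hκ : κ ≤ M) :
    (Finset.univ.filter fun γ : Fin M => ((slotShift h γ i : Fin D) : ℕ) < κ).card ≤ κ := by
  by_cases hi : (i : ℕ) < M
  · refine (Finset.card_le_card_of_injOn (t := Finset.range κ)
      (fun γ => ((γ + ⟨i, hi⟩ : Fin M) : ℕ)) ?_ ?_).trans (Finset.card_range κ).le
    · intro γ hγ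
      simp only [Finset.coe_filter, Finset.mem_univ, true_and, Set.mem_ofPred_eq] at hγ
      rw [slotShift_of_lt h γ i hi] at hγ
      simpa using hγ
    · intro γ _ γ' _ hγ
      exact add_right_cancel (Fin.ext hγ)
  · rw [Finset.filter_false_of_mem]
    · exact Nat.zero_le _
    · intro γ _
      rw [slotShift_of_le h γ i (by omega)]
      omega

end SlotShift

/-! ### Counting the labelings on which a fixed algorithm succeeds -/

theorem oracle_eq {n : ℕ} {W : Type} (E : SimpleGraph W) (π : Labeling n W) :
    oracle E π = labelOracle (mainGraph n E) π := by
  funext x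
  ext x'
  simp [oracle, labelOracle]

section Count

variable {n K t N : ℕ}

/-- The expander vertices to which the non-isolated ones among the vertices `vs i` are attached. -/
def anchors {W : Type} (vs : Fin t → Vertex n W) : Set W :=
  {u | ∃ i x, vs i = .inl x ∧ x.anchor = u}

theorem ncard_anchors_le {W : Type} [Finite W] (vs : Fin t → Vertex n W) :
    (anchors vs).ncard ≤ t := by
  classical
  have : anchors vs ⊆ ⋃ i, Sum.elim (fun x : CoreVertex n W => {x.anchor}) (fun _ => ∅) (vs i) := by
    rintro _ ⟨i, x, h, rfl⟩
    refine Set.mem_iUnion.2 ⟨i, ?_⟩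
    rw [h]
    rfl
  refine (Set.ncard_le_ncard this).trans ((Set.ncard_iUnion_le_of_fintype _).trans ?_)
  refine (Finset.sum_le_card_nsmul _ _ 1 fun i _ => ?_).trans (by simp)
  rcases vs i with x | j <;> simp

/-- The labelings that give the label `xs i` to the vertex `vs i`. -/
def labelingsThrough {W : Type} [Finite W] (vs : Fin t → Vertex n W) (xs : Fin t → Label n) :
    Finset (Labeling n W) :=
  open Classical in Finset.univ.filter fun π => ∀ i, π (vs i) = xs i

theorem mem_labelingsThrough {W : Type} [Finite W] {vs : Fin t → Vertex n W}
    {xs : Fin t → Label n} {π : Labeling n W} :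
    π ∈ labelingsThrough vs xs ↔ ∀ i, π (vs i) = xs i := by
  simp [labelingsThrough]

/-- The core of the argument, with the numerical requirements as hypotheses: for at most a `1 / P`
fraction of the labelings compatible with given samples, a given algorithm with fewer than `2 ^ K`
queries outputs a non-isolated vertex far from the samples. Here `x` is the length of blind runs,
the forest around the hull consists of the expander vertices at distance up to `2 * x + 1`, and
`2 ^ h` exceeds the number of samples. The failure probability is a sum of `K` terms, one for
guesses and one for blind runs of each level `1 ≤ r < K`, each at most `1 / (K * P)`. -/
theorem card_far_mul_le (hn : n = K ^ 2) (hK : 2 ≤ K) (E : SimpleGraph (Fin N))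
    (hreg : ∀ w, (E.neighborSet w).ncard = n) {x h P : ℕ} (hx : 0 < x) (hh : 1 ≤ h)
    (hth : t < 2 ^ h) (hdepth : ∀ k, 1 ≤ k → (k + 2) * x ≤ depthSeq n k)
    (hgirth : ((2 * ((2 * h + 1) * (2 * (2 * x + 2))) + 3 : ℕ) : ℕ∞) ≤ E.egirth)
    (hfar : (h + 1) * (2 * (2 * x + 2)) + (2 * x + 1) + 1 < girthParam n / 2)
    (hblind : ∀ r, 1 ≤ r → r < K → (2 ^ K) ^ 2 * (degSeq n (r + 1) - 1) ^ x * (K * P) ≤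
      (degSeq n r - 1) ^ x)
    (hguess : 2 ^ K * Nat.card (CoreVertex n (Fin N)) * (K * P) + t < numIsolated n (Fin N))
    (hroom : numSlots n ^ x * Nat.card (CoreVertex n (Fin N)) + t ≤ numIsolated n (Fin N))
    (vs : Fin t → Vertex n (Fin N)) (xs : Fin t → Label n)
    (T : QueryTree (Label n) (Finset (Label n)))
    (hT : ∀ π ∈ labelingsThrough vs xs, T.numQueries (oracle E π) < 2 ^ K)
    {Bad : Finset (Labeling n (Fin N))} (hsub : Bad ⊆ labelingsThrough vs xs)
    (hBad : ∀ π ∈ Bad, (π, (xs, T.run (oracle E π))) ∈ farEvent n t E) :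
    Bad.card * P ≤ (labelingsThrough vs xs).card := by
  classical
  set L := labelingsThrough vs xs with hL
  set U : Finset (Fin N) := (anchors vs).toFinset with hU
  have hUcard : U.card < 2 ^ h := by
    have := ncard_anchors_le vs
    rw [Set.ncard_eq_toFinset_card'] at this
    exact this.trans_lt hth
  set m := 2 * (2 * x + 2) with hm
  set Z := hull E U m with hZ
  have hUZ : (U : Set (Fin N)) ⊆ Z := fun w hw => Or.inl hw
  have hn1 : n - 1 + 1 = n := by
    have : 0 < n := by rw [hn]; positivity
    omega
  obtain ⟨B⟩ : Nonempty (BallForest E Z (2 * x + 1) (n - 1)) :=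
    exists_ballForest (by omega) (fun w => by rw [hn1, hreg])
      fun s hs w a b hw hwa ha hwb hb => eq_of_mem_within (by omega) hw hwa ha hwb hb
  set F := CoreVertex.forest hn hK B with hF
  -- The isolated vertices that are not samples serve as hiding places.
  set I : Set (Vertex n (Fin N)) := Set.range Sum.inr \ Set.range vs with hI
  have hIso : ∀ u ∈ isolatedVertices n (Fin N),
      (u ∉ F.revealed ∧ u ∉ F.hidden) ∧ ∀ w, ¬ (mainGraph n E).Adj w u := by
    rintro _ ⟨j, rfl⟩
    refine ⟨⟨?_, ?_⟩, ?_⟩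
    · rintro ⟨y, -, h⟩; cases h
    · rintro ⟨y, -, h⟩; cases h
    · rintro (w | w) <;> simp [mainGraph]
  have hIcard : numIsolated n (Fin N) ≤ I.ncard + t := by
    have h1 : (Set.range (Sum.inr : Fin (numIsolated n (Fin N)) → Vertex n (Fin N))).ncard =
        numIsolated n (Fin N) := by
      rw [← Set.image_univ, Set.ncard_image_of_injective _ Sum.inr_injective, Set.ncard_univ,
        Nat.card_eq_fintype_card, Fintype.card_fin]
    have h2 : (Set.range vs).ncard ≤ t := by
      rw [← Set.image_univ]
      refine (Set.ncard_image_le).trans ?_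
      rw [Set.ncard_univ, Nat.card_eq_fintype_card, Fintype.card_fin]
    have := Set.ncard_le_ncard_sdiff_add_ncard (Set.range Sum.inr) (Set.range vs)
    rw [← hI] at this
    omega
  have hcore : ∀ S : Set (CoreVertex n (Fin N)),
      (Sum.inl '' S : Set (Vertex n (Fin N))).ncard ≤ Nat.card (CoreVertex n (Fin N)) := by
    intro S
    rw [Set.ncard_image_of_injective _ Sum.inl_injective, ← Set.ncard_univ]
    exact Set.ncard_le_ncard (Set.subset_univ _)
  have hvs : ∀ i, vs i ∉ I ∧ vs i ∉ F.hidden ∧ (vs i ∈ F.revealed ∨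
      vs i ∈ isolatedVertices n (Fin N)) := by
    intro i
    refine ⟨fun h => h.2 ⟨i, rfl⟩, ?_⟩
    rcases hv : vs i with y | j
    · have hy : (Sum.inl y : Vertex n (Fin N)) ∈ F.revealed :=
        ⟨y, hUZ (by rw [hU, Set.coe_toFinset]; exact ⟨i, y, hv, rfl⟩), rfl⟩
      exact ⟨F.disjoint _ hy, Or.inl hy⟩
    · exact ⟨(hIso _ ⟨j, rfl⟩).1.2, Or.inr ⟨j, rfl⟩⟩
  set Q := 2 ^ K with hQ
  -- Guesses of the labels of vertices that the algorithm cannot know.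
  set guess : Finset (Labeling n (Fin N)) := L.filter fun π => ∃ j < Q,
    ∃ w ∉ isolatedVertices n (Fin N), Guesses (mainGraph n E) F.revealed T π j w with hguessdef
  have hguess_le : guess.card * (K * P) ≤ L.card := by
    have h1 := card_exists_guesses_le (G := mainGraph n E) (R := F.revealed) (T := T)
      (Iso := isolatedVertices n (Fin N)) (I := I)
      (fun u hu => ⟨(hIso u hu).1.1, (hIso u hu).2⟩) Set.sdiff_subset (L := L) (by
        intro π hπ w hw hw' i hi
        rw [hL, mem_labelingsThrough] at hπ ⊢
        intro k
        have hwk : vs k ≠ w := by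
          rintro rfl
          exact (hvs k).2.2.elim hw hw'
        have hik : vs k ≠ i := by
          rintro rfl
          exact (hvs k).1 hi
        exact (congrArg π (@Equiv.swap_apply_of_ne_of_ne _ (fun _ _ => Classical.propDecidable _)
          _ _ _ hwk hik)).trans (hπ k)) Q
    have h2 : (isolatedVertices n (Fin N))ᶜ.ncard ≤ Nat.card (CoreVertex n (Fin N)) := by
      refine (Set.ncard_le_ncard (t := Sum.inl '' Set.univ) ?_).trans (hcore _)
      rintro (y | j) h
      · exact ⟨y, trivial, rfl⟩
      · exact absurd ⟨j, rfl⟩ h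
    have h3 : Q * Nat.card (CoreVertex n (Fin N)) * (K * P) ≤ I.ncard := by omega
    have h0 : 0 < I.ncard := by omega
    refine Nat.le_of_mul_le_mul_right (c := I.ncard) ?_ h0
    calc guess.card * (K * P) * I.ncard = guess.card * I.ncard * (K * P) := by ring
      _ ≤ Q * (isolatedVertices n (Fin N))ᶜ.ncard * L.card * (K * P) := Nat.mul_le_mul_right _ h1
      _ ≤ Q * Nat.card (CoreVertex n (Fin N)) * L.card * (K * P) := by gcongr
      _ = Q * Nat.card (CoreVertex n (Fin N)) * (K * P) * L.card := by ring
      _ ≤ I.ncard * L.card := Nat.mul_le_mul_right _ h3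
      _ = L.card * I.ncard := mul_comm _ _
  -- Blind runs: the slots of level at least `r` are the first `M` ones, and are shifted cyclically.
  set blind : ℕ → Finset (Labeling n (Fin N)) := fun r => L.filter fun π =>
    ∃ v, ∃ a < Q, ∃ b < Q, F.Blind T x r v a b π with hblinddef
  have hblind_le : ∀ r, 1 ≤ r → r < K → (blind r).card * (K * P) ≤ L.card := by
    intro r hr hrK
    have hpos : ∀ k, k ≤ K → 2 ≤ degSeq n k := by
      intro k hk
      rw [degSeq_eq hn]
      have h1 : k * K ≤ K * K := Nat.mul_le_mul_right _ hk
      have h2 : 2 * K ≤ K * K := Nat.mul_le_mul_right _ hK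
      rw [sq]
      omega
    have hanti : ∀ {k k'}, k ≤ k' → degSeq n k' ≤ degSeq n k := fun h =>
      Nat.sub_le_sub_left (Nat.mul_le_mul_right _ h) _
    set M := degSeq n r - 1 with hM
    have hM0 : 0 < M := by
      have := hpos r hrK.le
      omega
    have : NeZero M := ⟨hM0.ne'⟩
    have hMD : M ≤ numSlots n := Nat.sub_le_sub_right (hanti hr) _
    have hle : ∀ k, 1 ≤ k → k ≤ K → ∀ i : Fin (numSlots n),
        k ≤ slotLevel n i ↔ (i : ℕ) < degSeq n k - 1 := by
      intro k hk hkK i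
      rw [le_slotLevel_iff hn hK hkK]
      exact ⟨fun h => h.resolve_left (by omega), Or.inr⟩
    have h1 := Forest.card_exists_blind_le (F := F) (T := T) (x := x) (I := I) (r := r)
      (κ := degSeq n (r + 1) - 1) (sh := slotShift hMD) hx (by
        intro γ i
        by_cases hi : (i : ℕ) < M
        · rw [min_eq_right ((hle r hr hrK.le _).2 hi),
            min_eq_right ((hle r hr hrK.le _).2 ((slotShift_lt_iff hMD γ i).2 hi))]
        · rw [slotShift_of_le hMD γ i (by omega)]) (by
        intro i
        refine (Finset.card_le_card ?_).trans (card_slotShift_lt_le hMD i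
          (Nat.sub_le_sub_right (hanti (Nat.le_succ r)) 1))
        intro γ hγ
        simp only [Finset.mem_filter, Finset.mem_univ, true_and] at hγ ⊢
        exact (hle (r + 1) (by omega) hrK _).1 hγ) (fun u hu => (hIso u hu.1).1) (by
        rw [Fintype.card_fin]
        have h2 : F.hidden.ncard ≤ Nat.card (CoreVertex n (Fin N)) := hcore _
        have h3 : M ^ x ≤ numSlots n ^ x := Nat.pow_le_pow_left hMD x
        have h4 := Nat.mul_le_mul h3 h2
        omega) (L := L) (by
        intro π hπ σ hσ
        rw [hL, mem_labelingsThrough] at hπ ⊢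
        intro k
        rw [Equiv.trans_apply, hσ _ (hvs k).1 (hvs k).2.1, hπ]) Q
    rw [Fintype.card_fin] at h1
    refine Nat.le_of_mul_le_mul_right (c := M ^ x) ?_ (by positivity)
    calc (blind r).card * (K * P) * M ^ x = (blind r).card * M ^ x * (K * P) := by ring
      _ ≤ Q ^ 2 * (degSeq n (r + 1) - 1) ^ x * L.card * (K * P) := Nat.mul_le_mul_right _ h1
      _ = Q ^ 2 * (degSeq n (r + 1) - 1) ^ x * (K * P) * L.card := by ring
      _ ≤ M ^ x * L.card := Nat.mul_le_mul_right _ (hblind r hr hrK)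
      _ = L.card * M ^ x := mul_comm _ _
  -- Without guesses and blind runs, the output is known to the cautious run, which stays in the
  -- forest around the hull.
  have hcover : Bad ⊆ guess ∪ (Finset.Ico 1 K).biUnion blind := by
    intro π hπ
    by_contra hnot
    simp only [Finset.mem_union, Finset.mem_biUnion, Finset.mem_Ico, not_or, not_exists,
      not_and] at hnot
    obtain ⟨hng, hnb⟩ := hnot
    have hπL := hsub hπ
    have hfarπ := hBad π hπ
    have hng' : ∀ j < Q, ∀ w, Guesses (mainGraph n E) F.revealed T π j w →
        w ∈ isolatedVertices n (Fin N) := by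
      intro j hj w hw
      by_contra hw'
      exact hng (Finset.mem_filter.2 ⟨hπL, j, hj, w, hw', hw⟩)
    obtain ⟨j, hj, hcur⟩ := exists_cautiousRun_current_eq_run (S := π '' F.revealed)
      (hT π hπL) (by
        intro j hj hcur
        have hw := hng' j hj (π.symm (explore (mainGraph n E) F.revealed T π j).2.current)
          ⟨by simp, by
            rw [mem_known, π.apply_symm_apply, explore, ← oracle_eq]
            exact hcur⟩
        rw [explore, ← oracle_eq] at hw
        rw [oracle_eq] at hw ⊢
        refine Finset.eq_empty_of_forall_notMem fun z hz => ?_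
        exact (hIso _ hw).2 _ (mem_labelOracle.1 hz).symm)
    set y := T.run (oracle E π) with hy
    have hcut : F.CutFree T π (2 ^ K) := Forest.not_cut_of_not_blind hx (by omega)
      (fun k hk hkK => by simpa [hkK] using hdepth k hk) (by simp)
      fun r v a b hr hrK hab hb hbl => hnb r ⟨hr, hrK⟩
        (Finset.mem_filter.2 ⟨hπL, v, a, hab.trans hb, b, hb, hbl⟩)
    have hknown : π.symm y ∈ Known (mainGraph n E) F.revealed T π j := by
      by_contra hk
      refine hfarπ.1 (hng' j hj _ ⟨?_, hk⟩)
      rw [π.apply_symm_apply, explore, ← oracle_eq]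
      exact hcur
    have hmem := Forest.known_mem (fun i hi u hu => hcut i (hi.trans hj) u hu) hknown
    obtain ⟨z, hz, hzy⟩ : ∃ z : CoreVertex n (Fin N), z.anchor ∈ within E Z (2 * x + 1) ∧
        Sum.inl z = π.symm y := by
      rcases hmem with ⟨z, hz, h⟩ | ⟨z, hz, h⟩
      · exact ⟨z, within_mono (Nat.zero_le _) (mem_within_zero.2 hz), h⟩
      · exact ⟨z, B.hid_subset hz.1, h⟩
    obtain ⟨z', hz', p, hp⟩ := hz
    obtain ⟨u, hu, p', hp'⟩ := hull_subset_within hh hUcard hgirth hz'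
    rw [hU, Set.coe_toFinset] at hu
    obtain ⟨i, s, hs, rfl⟩ := hu
    have hd := distE_le (n := n) s z (p.append p').reverse
    rw [← hs, hzy] at hd
    have hfar' := hfarπ.2
    have hle : distESet n E (π.symm '' Set.range xs) (π.symm y) ≤ distE n E (vs i) (π.symm y) :=
      iInf₂_le _ ⟨xs i, ⟨i, rfl⟩, by
        rw [← mem_labelingsThrough.1 hπL i, π.symm_apply_apply]⟩
    have := Nat.cast_le.1 (hfar'.trans (hle.trans hd))
    rw [SimpleGraph.Walk.length_reverse, SimpleGraph.Walk.length_append] at this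
    omega
  have hK0 : 0 < K := by omega
  refine Nat.le_of_mul_le_mul_left (c := K) ?_ hK0
  calc K * (Bad.card * P) = Bad.card * (K * P) := by ring
    _ ≤ (guess.card + ∑ r ∈ Finset.Ico 1 K, (blind r).card) * (K * P) :=
        Nat.mul_le_mul_right _ ((Finset.card_le_card hcover).trans
          ((Finset.card_union_le _ _).trans (Nat.add_le_add_left Finset.card_biUnion_le _)))
    _ = guess.card * (K * P) + ∑ r ∈ Finset.Ico 1 K, (blind r).card * (K * P) := by
        rw [add_mul, Finset.sum_mul]
    _ ≤ L.card + ∑ r ∈ Finset.Ico 1 K, L.card := by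
        refine Nat.add_le_add hguess_le (Finset.sum_le_sum fun r hr => ?_)
        rw [Finset.mem_Ico] at hr
        exact hblind_le r hr.1 hr.2
    _ = K * L.card := by
        rw [Finset.sum_const, Nat.card_Ico, smul_eq_mul]
        obtain ⟨k, rfl⟩ : ∃ k, K = k + 1 := ⟨K - 1, by omega⟩
        rw [Nat.add_sub_cancel]
        ring

end Count

/-! ### Reduction to the count of labelings -/

theorem iidSamples_map {X Y : Type} (f : X → Y) (p : PMF X) (t : ℕ) :
    iidSamples (p.map f) t = (iidSamples p t).map fun x => f ∘ x := by
  induction t with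
  | zero =>
    rw [iidSamples, iidSamples, PMF.pure_map]
    congr 1
    exact Subsingleton.elim _ _
  | succ t ih =>
    rw [iidSamples, iidSamples, PMF.bind_map, PMF.map_bind]
    congr 1
    funext a
    rw [Function.comp_apply, ih, PMF.map_comp, PMF.map_comp]
    congr 1
    funext x
    funext i
    refine Fin.cases ?_ (fun i => ?_) i <;> simp

theorem measureState_relabelState {n : ℕ} {W : Type} [Finite W] (π : Labeling n W)
    (ψ : EuclideanSpace ℂ (Vertex n W)) (hψ : ‖ψ‖ = 1) :
    measureState (relabelState π ψ) ((relabelState_norm π ψ).trans hψ) =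
      (measureState ψ hψ).map π := by
  classical
  ext x
  rw [PMF.map_apply, tsum_eq_single (π.symm x)]
  · simp [measureState, relabelState]
  · intro v hv
    rw [if_neg]
    rintro rfl
    simp at hv

/-- For the guarantee in expectation over the samples, the random labeling and the coins of the
algorithm, it suffices to count labelings for fixed samples and fixed coins. Here the samples are
drawn as vertices, before the labeling, which is possible because the distribution of the sampled
vertices does not depend on the labeling. -/
theorem experiment_toOuterMeasure_le {n t : ℕ} (alg : ClassicalAlgorithm n t) {W : Type} [Finite W]
    (E : SimpleGraph W) [Nonempty (Labeling n W)] (ψ : EuclideanSpace ℂ (Vertex n W)) (hψ : ‖ψ‖ = 1)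
    (A : Set (Labeling n W × ((Fin t → Label n) × Label n))) {P : ℕ} (hP : P ≠ 0)
    (hA : ∀ vs xs, ∀ T ∈ (alg xs).support, ∀ Bad ⊆ labelingsThrough vs xs,
      (∀ π ∈ Bad, (π, (xs, T.run (oracle E π))) ∈ A) →
        Bad.card * P ≤ (labelingsThrough vs xs).card) :
    (experiment alg E ψ hψ).toOuterMeasure A ≤ (P : ℝ≥0∞)⁻¹ := by
  classical
  set p := iidSamples (measureState ψ hψ) t with hp
  set ind : Labeling n W → (Fin t → Label n) → QueryTree (Label n) (Finset (Label n)) → ℝ≥0∞ :=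
    fun π xs T => if (π, (xs, T.run (oracle E π))) ∈ A then 1 else 0 with hind
  have hexp : (experiment alg E ψ hψ).toOuterMeasure A =
      ∑' π, PMF.uniformOfFintype (Labeling n W) π *
        ∑' vs, p vs * ∑' T, alg (π ∘ vs) T * ind π (π ∘ vs) T := by
    rw [experiment, PMF.toOuterMeasure_bind_apply]
    refine tsum_congr fun π => congrArg _ ?_
    rw [measureState_relabelState π ψ hψ, inputOutput, iidSamples_map, PMF.bind_map, PMF.map_bind,
      PMF.toOuterMeasure_bind_apply]
    refine tsum_congr fun vs => congrArg _ ?_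
    rw [Function.comp_apply, PMF.map_comp, PMF.toOuterMeasure_map_apply,
      PMF.toOuterMeasure_apply]
    refine tsum_congr fun T => ?_
    simp only [Set.indicator_apply, hind, mul_ite, mul_one, mul_zero]
    rfl
  have hfiber : ∀ (vs : Fin t → Vertex n W) (xs : Fin t → Label n), ∑ π ∈ labelingsThrough vs xs, ∑' T, alg (π ∘ vs) T * ind π (π ∘ vs) T ≤
      (P : ℝ≥0∞)⁻¹ * (labelingsThrough vs xs).card := by
    intro vs xs
    set L := labelingsThrough vs xs with hL
    have hT : ∀ T ∈ (alg xs).support, ∑ π ∈ L, ind π xs T ≤ (P : ℝ≥0∞)⁻¹ * L.card := by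
      intro T hT
      have h1 := hA vs xs T hT (L.filter fun π => (π, (xs, T.run (oracle E π))) ∈ A)
        (Finset.filter_subset _ _) fun π hπ => (Finset.mem_filter.1 hπ).2
      rw [hind, Finset.sum_boole, ← ENNReal.div_eq_inv_mul]
      rw [ENNReal.le_div_iff_mul_le (Or.inl (Nat.cast_ne_zero.2 hP))
        (Or.inl (ENNReal.natCast_ne_top _))]
      exact_mod_cast h1
    calc ∑ π ∈ L, ∑' T, alg (π ∘ vs) T * ind π (π ∘ vs) T
        = ∑ π ∈ L, ∑' T, alg xs T * ind π xs T := by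
          refine Finset.sum_congr rfl fun π hπ => ?_
          rw [show π ∘ vs = xs from funext (mem_labelingsThrough.1 hπ)]
      _ = ∑' T, alg xs T * ∑ π ∈ L, ind π xs T := by
          rw [← Summable.tsum_finsetSum fun _ _ => ENNReal.summable]
          simp only [Finset.mul_sum]
      _ ≤ ∑' T, alg xs T * ((P : ℝ≥0∞)⁻¹ * L.card) := by
          refine ENNReal.tsum_le_tsum fun T => ?_
          by_cases hT' : T ∈ (alg xs).support
          · exact mul_le_mul_right (hT T hT') _
          · rw [(PMF.apply_eq_zero_iff _ _).2 hT', zero_mul]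
            exact zero_le
      _ = (P : ℝ≥0∞)⁻¹ * L.card := by rw [ENNReal.tsum_mul_right, PMF.tsum_coe, one_mul]
  have hsum : ∀ vs : Fin t → Vertex n W, ∑ π : Labeling n W, ∑' T, alg (π ∘ vs) T * ind π (π ∘ vs) T ≤
      (P : ℝ≥0∞)⁻¹ * Fintype.card (Labeling n W) := by
    intro vs
    have hL : ∀ xs, labelingsThrough vs xs =
        Finset.univ.filter fun π : Labeling n W => π ∘ vs = xs := by
      intro xs
      ext π
      simp [mem_labelingsThrough, funext_iff]
    calc _ = ∑ xs, ∑ π ∈ labelingsThrough vs xs,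
          ∑' T, alg (π ∘ vs) T * ind π (π ∘ vs) T := by
          simp only [hL]
          exact (Finset.sum_fiberwise _ _ _).symm
      _ ≤ ∑ xs, (P : ℝ≥0∞)⁻¹ * (labelingsThrough vs xs).card :=
          Finset.sum_le_sum fun xs _ => hfiber vs xs
      _ = (P : ℝ≥0∞)⁻¹ * Fintype.card (Labeling n W) := by
          rw [← Finset.mul_sum, ← Nat.cast_sum]
          simp only [hL]
          rw [← Finset.card_eq_sum_card_fiberwise fun π _ => Finset.mem_coe.2 (Finset.mem_univ _)]
          rfl
  have hcard0 : (Fintype.card (Labeling n W) : ℝ≥0∞) ≠ 0 := by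
    exact_mod_cast Fintype.card_ne_zero
  rw [hexp]
  calc _ = ∑' vs, p vs * ((Fintype.card (Labeling n W) : ℝ≥0∞)⁻¹ *
        ∑ π : Labeling n W, ∑' T, alg (π ∘ vs) T * ind π (π ∘ vs) T) := by
        simp only [PMF.uniformOfFintype_apply, ← ENNReal.tsum_mul_left]
        rw [ENNReal.tsum_comm]
        refine tsum_congr fun vs => ?_
        rw [← tsum_fintype (L := .unconditional _), ← ENNReal.tsum_mul_left,
          ← ENNReal.tsum_mul_left]
        refine tsum_congr fun π => ?_
        simp only [ENNReal.tsum_mul_left]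
        ring
    _ ≤ ∑' vs, p vs * ((Fintype.card (Labeling n W) : ℝ≥0∞)⁻¹ *
        ((P : ℝ≥0∞)⁻¹ * Fintype.card (Labeling n W))) := by
        refine ENNReal.tsum_le_tsum fun vs => ?_
        gcongr
        exact hsum vs
    _ = (P : ℝ≥0∞)⁻¹ := by
        rw [ENNReal.tsum_mul_right, PMF.tsum_coe, one_mul, mul_comm, mul_assoc,
          ENNReal.mul_inv_cancel hcard0 (ENNReal.natCast_ne_top _), mul_one]

/-! ### The size of the decorated expander -/

section Size

variable {n K : ℕ}

/-- A path down the tree stays in each level `r` for at most `depthSeq n r` steps. -/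
theorem TreeVertex.len_add_le {k j : ℕ} (hj : j ≤ depthSeq n k) (w : TreeVertex n k j) :
    w.len + j ≤ ∑ r ∈ Finset.range (k + 1), (depthSeq n r + 1) := by
  induction w with
  | here =>
    rw [len, Finset.sum_range_succ]
    omega
  | base h c w ih =>
    have := ih h
    rw [len]
    omega
  | @deco k j h r hr i w ih =>
    have h1 := ih (Nat.zero_le _)
    have h2 : ∑ r ∈ Finset.range (r + 1), (depthSeq n r + 1) ≤
        ∑ r ∈ Finset.range k, (depthSeq n r + 1) :=
      Finset.sum_le_sum_of_subset (Finset.range_mono hr.2)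
    rw [len, Finset.sum_range_succ]
    omega

theorem TreeVertex.ncard_len_le (hn : n = K ^ 2) (hK : 2 ≤ K) {k : ℕ} (hk : k ≤ K) (s : ℕ) :
    {w : TreeVertex n k 0 | w.len ≤ s}.ncard ≤ (numSlots n + 1) ^ s := by
  induction s with
  | zero =>
    have : {w : TreeVertex n k 0 | w.len ≤ 0} ⊆ {.here} := by
      intro w hw
      cases w with
      | here => rfl
      | base => exact absurd hw (Nat.not_succ_le_zero _)
      | deco => exact absurd hw (Nat.not_succ_le_zero _)
    simpa using Set.ncard_le_ncard this
  | succ s ih =>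
    have hsub : {w : TreeVertex n k 0 | w.len ≤ s + 1} ⊆ insert .here
        ((fun p : TreeVertex n k 0 × Fin (numSlots n) => p.1.child p.2) ''
          ({w | w.len ≤ s} ×ˢ Set.univ)) := by
      intro w hw
      rcases hp : w.par with _ | v
      · exact Or.inl (TreeVertex.par_eq_none.1 hp)
      · obtain ⟨-, c, rfl⟩ := TreeVertex.exists_child_eq hn hK hk hp
        have h1 := TreeVertex.len_of_par hp
        have h2 : (v.child c).len ≤ s + 1 := hw
        exact Or.inr ⟨(v, c), ⟨show v.len ≤ s by omega, trivial⟩, rfl⟩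
    have h1 := (Set.ncard_le_ncard hsub).trans ((Set.ncard_insert_le _ _).trans
      (Nat.add_le_add_right Set.ncard_image_le 1))
    rw [Set.ncard_prod, Set.ncard_univ, Nat.card_eq_fintype_card, Fintype.card_fin] at h1
    have h2 := Nat.mul_le_mul_right (numSlots n) ih
    have h3 : 1 ≤ (numSlots n + 1) ^ s := Nat.one_le_pow _ _ (Nat.succ_pos _)
    rw [pow_succ, mul_add, mul_one]
    omega

theorem TreeVertex.card_le (hn : n = K ^ 2) (hK : 2 ≤ K) {k : ℕ} (hk : k < K) :
    Nat.card (TreeVertex n k 0) ≤ (2 * n) ^ (K * (K * (10 * (n * K) * lg n) + 1)) := by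
  set s := K * (K * (10 * (n * K) * lg n) + 1) with hs
  have h1 : {w : TreeVertex n k 0 | w.len ≤ s} = Set.univ := by
    refine Set.eq_univ_of_forall fun w => ?_
    have h2 := w.len_add_le (Nat.zero_le _)
    have h3 : ∑ r ∈ Finset.range (k + 1), (depthSeq n r + 1) ≤ s := by
      refine (Finset.sum_le_card_nsmul _ _ (K * (10 * (n * K) * lg n) + 1) ?_).trans ?_
      · intro r hr
        rw [Finset.mem_range] at hr
        rw [depthSeq, sqrt_eq hn]
        gcongr
        omega
      · rw [Finset.card_range, smul_eq_mul]
        exact Nat.mul_le_mul_right _ hk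
    change w.len ≤ s
    omega
  have h2 := TreeVertex.ncard_len_le hn hK hk.le s
  rw [h1, Set.ncard_univ] at h2
  refine h2.trans (Nat.pow_le_pow_left ?_ s)
  have : 0 < n := by rw [hn]; positivity
  have h3 : degSeq n 1 ≤ 2 * n := Nat.sub_le _ _
  rw [numSlots]
  omega

theorem CoreVertex.card_le (hn : n = K ^ 2) {N T : ℕ}
    (hT : ∀ k < K, Nat.card (TreeVertex n k 0) ≤ T) :
    Nat.card (CoreVertex n (Fin N)) ≤ N * (1 + K * (2 * n * T)) := by
  let f : CoreVertex n (Fin N) →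
      Fin N × Option (Σ k : Fin K, Fin (2 * n) × TreeVertex n k 0) := fun x => match x with
    | .expander u => (u, none)
    | .tree u k hk i w => (u, some ⟨⟨k, hk.2.trans_eq (sqrt_eq hn)⟩,
        ⟨i, i.2.trans_le ((Nat.sub_le _ _).trans (Nat.sub_le _ _))⟩, w⟩)
  have hf : Function.Injective f := by
    intro x y h
    cases x with
    | expander u =>
      cases y with
      | expander u' =>
        simp only [f, Prod.mk.injEq, and_true] at h
        rw [h]
      | tree => simp [f] at h
    | tree u k hk i w =>
      cases y with
      | expander => simp [f] at h
      | tree u' k' hk' i' w' =>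
        simp only [f, Prod.mk.injEq, Option.some.injEq, Sigma.mk.injEq, Fin.mk.injEq] at h
        obtain ⟨rfl, rfl, h⟩ := h
        simp only [heq_eq_eq, Prod.mk.injEq, Fin.mk.injEq] at h
        obtain ⟨h, rfl⟩ := h
        obtain rfl := Fin.ext h
        rfl
  refine (Nat.card_le_card_of_injective f hf).trans ?_
  have : Fintype (TreeVertex n 0 0) := Fintype.ofFinite _
  rw [Nat.card_prod, Finite.card_option, Nat.card_sigma, Nat.card_eq_fintype_card,
    Fintype.card_fin, add_comm]
  refine Nat.mul_le_mul_left _ (Nat.add_le_add_left ?_ _)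
  refine (Finset.sum_le_card_nsmul _ _ (2 * n * T) fun k _ => ?_).trans (by simp)
  rw [Nat.card_prod, Nat.card_eq_fintype_card, Fintype.card_fin]
  exact Nat.mul_le_mul_left _ (hT k k.2)

end Size

/-! ### Large parameters -/

theorem eventually_mul_lg_le (C : ℕ) (hC : 1 ≤ C) : ∃ K₀, ∀ K ≥ K₀, C * lg (K ^ 2) ≤ K := by
  have h := tendsto_pow_const_div_const_pow_of_one_lt 2 (r := (2 : ℝ)) one_lt_two
  have h' := (h.eventually (ge_mem_nhds (show (0 : ℝ) < 1 / (4 * C ^ 2) by positivity)))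
  obtain ⟨q₀, hq₀⟩ := Filter.eventually_atTop.1 h'
  refine ⟨C * (q₀ + 1), fun K hK => ?_⟩
  set q := K / C with hq
  have hq1 : q₀ + 1 ≤ q := by
    rw [hq, Nat.le_div_iff_mul_le (by omega), mul_comm]
    exact hK
  have hKq : K < C * (q + 1) := Nat.lt_mul_div_succ K (by omega)
  have h2 : 4 * C ^ 2 * q ^ 2 ≤ 2 ^ q := by
    have h3 := hq₀ q (by omega)
    rw [div_le_div_iff₀ (by positivity) (by positivity)] at h3
    have h4 : (4 * C ^ 2 * q ^ 2 : ℝ) ≤ 2 ^ q := by linarith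
    exact_mod_cast h4
  have h3 : lg (K ^ 2) ≤ q := by
    refine Nat.clog_le_of_le_pow (le_trans ?_ h2)
    calc K ^ 2 ≤ (C * (q + 1)) ^ 2 := Nat.pow_le_pow_left hKq.le 2
      _ ≤ (C * (2 * q)) ^ 2 := by gcongr; omega
      _ = 4 * C ^ 2 * q ^ 2 := by ring
  calc C * lg (K ^ 2) ≤ C * q := Nat.mul_le_mul_left _ h3
    _ ≤ K := Nat.mul_div_le _ _

/-- The probability `(κ / M) ^ x` of a blind run is small enough for `x = 3K³ l`. Here `M` slots have
level at least `r`, and all but `K` of them have a level above `r`. The run length gives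
`(κ / M) ^ x ≤ (8 / 27) ^ (K² l)`, and `8 ^ K` makes up for the union bound over pairs of steps and
over levels. -/
theorem pow_mul_pow_le {K l κ M : ℕ} (hK : 4 ≤ K) (hl : 1 ≤ l) (hM : κ + K = M)
    (hκ : κ ≤ 2 * K ^ 2) :
    (2 ^ K) ^ 2 * κ ^ (3 * K ^ 3 * l) * (K * 2 ^ (K ^ 2 * l)) ≤ M ^ (3 * K ^ 3 * l) := by
  -- Bernoulli's inequality: `(1 + K / κ) ^ K ≥ 1 + K² / κ ≥ 3 / 2`.
  have h1 : 3 * κ ^ K ≤ 2 * M ^ K := by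
    have h2 := one_add_mul_le_pow (a := (K / κ : ℝ)) (by
      have : (0 : ℝ) ≤ K / κ := by positivity
      linarith) K
    rcases Nat.eq_zero_or_pos κ with rfl | hκ0
    · rw [zero_pow (by omega)]
      omega
    have hκ' : (0 : ℝ) < κ := by exact_mod_cast hκ0
    have h3 : (1 / 2 : ℝ) ≤ K * (K / κ) := by
      rw [← mul_div_assoc, le_div_iff₀ hκ']
      have : (κ : ℝ) ≤ 2 * K ^ 2 := by exact_mod_cast hκ
      nlinarith
    have h4 : (M : ℝ) = (1 + K / κ) * κ := by
      rw [← hM]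
      push_cast
      field_simp
    have h5 : (3 * κ ^ K : ℝ) ≤ 2 * M ^ K := by
      rw [h4, mul_pow]
      have : (0 : ℝ) < κ ^ K := by positivity
      nlinarith
    exact_mod_cast h5
  set s := K ^ 2 * l with hs
  have hx : 3 * K ^ 3 * l = K * (3 * s) := by rw [hs]; ring
  have h2 : 27 ^ s * κ ^ (K * (3 * s)) ≤ 8 ^ s * M ^ (K * (3 * s)) := by
    have := Nat.pow_le_pow_left h1 (3 * s)
    rw [mul_pow, mul_pow, ← pow_mul, ← pow_mul, pow_mul 3, pow_mul 2] at this
    exact this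
  have h3 : 8 ^ K * 16 ^ s ≤ 27 ^ s := by
    obtain ⟨d, hd⟩ : ∃ d, s = 4 * K + d := Nat.exists_eq_add_of_le (by
      rw [hs]
      nlinarith)
    -- `8 * 16 ^ 4 ≤ 27 ^ 4`
    rw [hd, pow_add, pow_add, pow_mul, pow_mul, ← mul_assoc, ← mul_pow]
    exact Nat.mul_le_mul (Nat.pow_le_pow_left (by norm_num) K) (Nat.pow_le_pow_left (by norm_num) d)
  have hKK : K ≤ 2 ^ K := Nat.lt_two_pow_self.le
  rw [hx]
  refine Nat.le_of_mul_le_mul_left (c := 8 ^ s) ?_ (by positivity)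
  calc 8 ^ s * ((2 ^ K) ^ 2 * κ ^ (K * (3 * s)) * (K * 2 ^ s))
      ≤ 8 ^ s * ((2 ^ K) ^ 2 * κ ^ (K * (3 * s)) * (2 ^ K * 2 ^ s)) := by gcongr
    _ = 8 ^ K * 16 ^ s * κ ^ (K * (3 * s)) := by
        rw [show (8 : ℕ) ^ K = (2 ^ K) ^ 3 by rw [← pow_mul, mul_comm, pow_mul]; norm_num,
          show (16 : ℕ) ^ s = 8 ^ s * 2 ^ s by rw [← mul_pow]; norm_num]
        ring
    _ ≤ 27 ^ s * κ ^ (K * (3 * s)) := Nat.mul_le_mul_right _ h3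
    _ ≤ 8 ^ s * M ^ (K * (3 * s)) := h2

theorem two_pow_add_lt {x y z e m : ℕ} (hx : x ≤ 2 ^ e) (hy : y ≤ 2 ^ e) (hz : z ≤ 2 ^ e)
    (he : e + 2 ≤ m) : x + y + z < 2 ^ m := by
  have h1 : 2 ^ (e + 2) ≤ 2 ^ m := Nat.pow_le_pow_right two_pos he
  have h2 : 0 < 2 ^ e := by positivity
  rw [pow_add] at h1
  omega

section Large

variable {n K l c N : ℕ}

/-- The number of vertices of the core has order `n^{5/2} log² n` in the exponent, less than the `n³`
in the exponent of the number of labels. -/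
theorem card_core_le (hn : n = K ^ 2) (hl : lg n = l) (hK : 4 ≤ K) (hl1 : 1 ≤ l)
    (hN : N ≤ 2 ^ (c * n ^ 2 * l ^ 2)) :
    Nat.card (CoreVertex n (Fin N)) ≤ 2 ^ ((c + 26) * (K ^ 5 * l ^ 2)) := by
  have hnl : 2 * n ≤ 2 ^ (2 * l) := by
    have h1 : n ≤ 2 ^ l := hl ▸ Nat.le_pow_clog one_lt_two n
    calc 2 * n ≤ 2 * 2 ^ l := by omega
      _ = 2 ^ (l + 1) := by ring
      _ ≤ 2 ^ (2 * l) := Nat.pow_le_pow_right two_pos (by omega)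
  set y := K ^ 5 * l ^ 2 with hy
  have hK5 : K ^ 5 * l ≤ y := by rw [hy]; exact Nat.mul_le_mul_left _ (by nlinarith)
  have hK1 : K * l ≤ K ^ 5 * l := Nat.mul_le_mul_right _ (Nat.le_self_pow (by norm_num) K)
  have hKl : K ≤ K * l ∧ l ≤ K * l ∧ 1 ≤ l := ⟨by nlinarith, by nlinarith, hl1⟩
  have hT : ∀ k < K, Nat.card (TreeVertex n k 0) ≤ 2 ^ (22 * y) := by
    intro k hk
    refine (TreeVertex.card_le hn (by omega) hk).trans ?_
    refine (Nat.pow_le_pow_left hnl _).trans ?_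
    rw [← pow_mul, hl]
    refine Nat.pow_le_pow_right two_pos ?_
    have h1 : K ≤ K ^ 5 * l := hKl.1.trans hK1
    calc 2 * l * (K * (K * (10 * (n * K) * l) + 1)) = 2 * l * (10 * (K ^ 5 * l) + K) := by
          rw [hn]; ring
      _ ≤ 2 * l * (11 * (K ^ 5 * l)) := Nat.mul_le_mul_left _ (by omega)
      _ = 22 * y := by rw [hy]; ring
  have hKK : K ≤ 2 ^ K := Nat.lt_two_pow_self.le
  have h3 : 1 + K * (2 * n * 2 ^ (22 * y)) ≤ 2 ^ (26 * y) := by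
    have h4 : K * (2 * n * 2 ^ (22 * y)) ≤ 2 ^ (K + (2 * l + 22 * y)) := by
      rw [pow_add, pow_add]
      gcongr
    have h5 : 2 ^ (K + (2 * l + 22 * y)) ≤ 2 ^ (25 * y) :=
      Nat.pow_le_pow_right two_pos (by omega)
    have h6 : 2 * 2 ^ (25 * y) ≤ 2 ^ (26 * y) := by
      rw [← pow_succ']
      exact Nat.pow_le_pow_right two_pos (by omega)
    have h7 : 1 ≤ 2 ^ (25 * y) := Nat.one_le_two_pow
    omega
  have h8 : c * n ^ 2 * l ^ 2 ≤ c * y := by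
    rw [hy, hn, mul_assoc]
    refine Nat.mul_le_mul_left _ (Nat.mul_le_mul_right _ ?_)
    rw [← pow_mul]
    exact Nat.pow_le_pow_right (by omega) (by norm_num)
  calc _ ≤ N * (1 + K * (2 * n * 2 ^ (22 * y))) := CoreVertex.card_le hn hT
    _ ≤ 2 ^ (c * y) * 2 ^ (26 * y) :=
        Nat.mul_le_mul (hN.trans (Nat.pow_le_pow_right two_pos h8)) h3
    _ = 2 ^ ((c + 26) * y) := by rw [← pow_add, add_mul]

/-- The guessing probability is negligible, and the padding offers enough hiding places. -/
theorem room_of_large (hn : n = K ^ 2) (hl : lg n = l) (hK : c + 40 ≤ K) (hl1 : 1 ≤ l)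
    (hN : N ≤ 2 ^ (c * n ^ 2 * l ^ 2)) {t h : ℕ} (ht : t < 2 ^ h) (hh : h ≤ K) :
    2 ^ K * Nat.card (CoreVertex n (Fin N)) * (K * 2 ^ (n * l)) + t < numIsolated n (Fin N) ∧
      numSlots n ^ (3 * K ^ 3 * l) * Nat.card (CoreVertex n (Fin N)) + t ≤
        numIsolated n (Fin N) := by
  set y := K ^ 5 * l ^ 2 with hy
  have hC := card_core_le hn hl (by omega) hl1 hN
  rw [← hy] at hC
  set C := Nat.card (CoreVertex n (Fin N)) with hCdef
  have hK2 : K ^ 2 * l ≤ y := Nat.mul_le_mul (Nat.pow_le_pow_right (by omega) (by norm_num))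
    (Nat.le_self_pow two_ne_zero l)
  have hK3 : K ^ 3 * l ^ 2 ≤ y :=
    Nat.mul_le_mul_right _ (Nat.pow_le_pow_right (by omega) (by norm_num))
  have hK1 : K ≤ K ^ 2 * l := by nlinarith [Nat.le_self_pow two_ne_zero K]
  have hy1 : 1 ≤ y := by omega
  have hCe : C ≤ 2 ^ ((c + 36) * y) :=
    hC.trans (Nat.pow_le_pow_right two_pos (Nat.mul_le_mul_right _ (by omega)))
  have hte : t ≤ 2 ^ ((c + 36) * y) :=
    ht.le.trans (Nat.pow_le_pow_right two_pos (by nlinarith))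
  have hm : (c + 36) * y + 2 ≤ numQubits n := by
    have : numQubits n = 15 * (K * y) := by
      rw [numQubits, hl, hn, hy]
      ring
    rw [this]
    have h1 : (c + 40) * y ≤ K * y := Nat.mul_le_mul_right _ hK
    nlinarith
  have hKK : K ≤ 2 ^ K := Nat.lt_two_pow_self.le
  have h1 : 2 ^ K * C * (K * 2 ^ (n * l)) ≤ 2 ^ ((c + 36) * y) := by
    calc 2 ^ K * C * (K * 2 ^ (n * l))
        ≤ 2 ^ K * 2 ^ ((c + 26) * y) * (2 ^ K * 2 ^ (n * l)) := by gcongr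
      _ = 2 ^ (K + (c + 26) * y + (K + n * l)) := by rw [← pow_add, ← pow_add, ← pow_add]
      _ ≤ 2 ^ ((c + 36) * y) := by
          refine Nat.pow_le_pow_right two_pos ?_
          rw [hn]
          nlinarith
  have h2 : numSlots n ^ (3 * K ^ 3 * l) * C ≤ 2 ^ ((c + 36) * y) := by
    have hD : numSlots n ≤ 2 ^ (2 * l) := by
      have h1 : n ≤ 2 ^ l := hl ▸ Nat.le_pow_clog one_lt_two n
      have h3 : numSlots n ≤ 2 * n := (Nat.sub_le _ _).trans (Nat.sub_le _ _)
      calc numSlots n ≤ 2 * 2 ^ l := by omega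
        _ = 2 ^ (l + 1) := by ring
        _ ≤ 2 ^ (2 * l) := Nat.pow_le_pow_right two_pos (by omega)
    calc numSlots n ^ (3 * K ^ 3 * l) * C
        ≤ (2 ^ (2 * l)) ^ (3 * K ^ 3 * l) * 2 ^ ((c + 26) * y) := by gcongr
      _ = 2 ^ (6 * (K ^ 3 * l ^ 2) + (c + 26) * y) := by
          rw [← pow_mul, ← pow_add]
          congr 1
          ring
      _ ≤ 2 ^ ((c + 36) * y) := Nat.pow_le_pow_right two_pos (by nlinarith)
  have h3 := two_pow_add_lt h1 hte hCe hm
  have h4 := two_pow_add_lt h2 hte hCe hm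
  have h5 : numIsolated n (Fin N) = 2 ^ numQubits n - C := rfl
  omega

theorem labeling_nonempty (h : 0 < numIsolated n (Fin N)) : Nonempty (Labeling n (Fin N)) := by
  have h1 : numIsolated n (Fin N) = 2 ^ numQubits n - Nat.card (CoreVertex n (Fin N)) := rfl
  refine Finite.card_eq.1 ?_
  rw [Nat.card_sum, Nat.card_eq_fintype_card (α := Fin _), Nat.card_eq_fintype_card (α := Fin _),
    Fintype.card_fin, Fintype.card_fin]
  omega

/-- The hull of the samples and the forest around it stay well within the girth. -/
theorem girth_of_large (hn : n = K ^ 2) (hl : lg n = l) (hK : 2 ≤ K) (hl1 : 1 ≤ l) {β : ℕ}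
    (hβ : (2 * β + 3) * l ≤ K) :
    2 * ((2 * (β * l + 1) + 1) * (2 * (2 * (3 * K ^ 3 * l) + 2))) + 3 ≤ girthParam n ∧
      (β * l + 1 + 1) * (2 * (2 * (3 * K ^ 3 * l) + 2)) + (2 * (3 * K ^ 3 * l) + 1) + 1 <
        girthParam n / 2 := by
  set z := K ^ 3 * l with hz
  have hz1 : 1 ≤ z := Nat.mul_pos (by positivity) hl1
  have hKz : 2 * z ≤ K * z := Nat.mul_le_mul_right _ hK
  have hg : girthParam n = 40 * (K * z) + 8 := by
    rw [girthParam, hl, hn, hz]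
    ring
  have h1 : 2 * (β * l + 1) + 1 ≤ K := by nlinarith
  have h2 : 2 * (2 * (3 * K ^ 3 * l) + 2) ≤ 16 * z := by
    have : 3 * K ^ 3 * l = 3 * z := by rw [hz]; ring
    omega
  have h3 : (2 * (β * l + 1) + 1) * (2 * (2 * (3 * K ^ 3 * l) + 2)) ≤ K * (16 * z) :=
    Nat.mul_le_mul h1 h2
  have h4 : (β * l + 1 + 1) * (2 * (2 * (3 * K ^ 3 * l) + 2)) ≤ K * (16 * z) :=
    Nat.mul_le_mul (by omega) h2
  have h5 : K * (16 * z) = 16 * (K * z) := by ring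
  have h6 : 3 * K ^ 3 * l = 3 * z := by rw [hz]; ring
  omega

end Large
end GuidedSampling

end

theorem mainTheorem3 (a b : ℝ) (ha : 1 ≤ a) (hb : 1 ≤ b) (c : ℕ) :
    ∃ n₀ : ℕ, ∀ n : ℕ, n₀ ≤ n → IsSquare n →
      ∀ (N : ℕ) (E : SimpleGraph (Fin N)), GuidedSampling.IsHighGirthExpander c n E →
        ∃ _ : Nonempty (GuidedSampling.Labeling n (Fin N)),
          ∀ (ψ : EuclideanSpace ℂ (GuidedSampling.Vertex n (Fin N))) (hψ : ‖ψ‖ = 1),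
            (∀ π : GuidedSampling.Labeling n (Fin N),
              ∃ φ : EuclideanSpace ℂ (GuidedSampling.Label n),
                GuidedSampling.IsGroundState (GuidedSampling.hamiltonian E π) φ ∧
                  1 / (n : ℝ) ^ a ≤ ‖inner ℂ (GuidedSampling.relabelState π ψ) φ‖) →
            ∀ (t : ℕ), (t : ℝ) ≤ (n : ℝ) ^ b →
              ∀ alg : GuidedSampling.ClassicalAlgorithm n t,
                alg.MakesFewerThan E (2 ^ n.sqrt) →
                (GuidedSampling.experiment alg E ψ hψ).toOuterMeasure
                    (GuidedSampling.farEvent n t E) ≤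
                  ENNReal.ofReal ((2 : ℝ) ^ (-((n : ℝ) * Real.logb 2 n))) := by
  -- The number of samples is at most `n ^ β < 2 ^ (β * l + 1)` with `l = ⌈log₂ n⌉`; the hull takes
  -- `K ≥ (2 * β + 3) * l` to fit into the girth, and the padding dwarfs the core for `K ≥ c + 40`.
  have hβ0 : b ≤ (⌈b⌉₊ : ℝ) := Nat.le_ceil b
  set β := ⌈b⌉₊ with hβ
  obtain ⟨K₀, hK₀⟩ := GuidedSampling.eventually_mul_lg_le (2 * β + 3) (by omega)
  refine ⟨(max K₀ (c + 40)) ^ 2, ?_⟩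
  rintro n hn ⟨K, hnK⟩ N E hE
  replace hnK : n = K ^ 2 := by rw [hnK, sq]
  have hKmax : max K₀ (c + 40) ≤ K := by
    rw [hnK] at hn
    exact (Nat.pow_le_pow_iff_left two_ne_zero).1 hn
  have hKK₀ : K₀ ≤ K := (le_max_left _ _).trans hKmax
  have hKc : c + 40 ≤ K := (le_max_right _ _).trans hKmax
  have hK0 : 0 < K := by omega
  have hn2 : 2 ≤ n := by
    rw [hnK]
    nlinarith
  obtain ⟨l, hl⟩ : ∃ l, GuidedSampling.lg n = l := ⟨_, rfl⟩
  have hl1 : 1 ≤ l := hl ▸ Nat.clog_pos one_lt_two hn2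
  have hnl : n ≤ 2 ^ l := hl ▸ Nat.le_pow_clog one_lt_two n
  have hβK : (2 * β + 3) * l ≤ K := by
    have := hK₀ K hKK₀
    rwa [← hnK, hl] at this
  have hcard : N ≤ 2 ^ (c * n ^ 2 * l ^ 2) := hl ▸ hE.card_le
  have hreg : ∀ w, (E.neighborSet w).ncard = n := by
    intro w
    classical
    rw [Set.ncard_eq_toFinset_card', Set.toFinset_card, SimpleGraph.card_neighborSet_eq_degree]
    convert hE.regular w
  have hhK : β * l + 1 ≤ K := by nlinarith
  obtain ⟨hg₁, hg₂⟩ := GuidedSampling.girth_of_large hnK hl (by omega) hl1 hβK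
  have hne : Nonempty (GuidedSampling.Labeling n (Fin N)) :=
    GuidedSampling.labeling_nonempty (Nat.zero_le _ |>.trans_lt
      (GuidedSampling.room_of_large hnK hl hKc hl1 hcard (t := 0) (h := 1)
        (by norm_num) (by omega)).1)
  refine ⟨hne, fun ψ hψ _ t ht alg halg => ?_⟩
  have hth : t < 2 ^ (β * l + 1) := by
    have h1 : (t : ℝ) ≤ (n : ℝ) ^ β := by
      refine ht.trans ?_
      rw [← Real.rpow_natCast]
      exact Real.rpow_le_rpow_of_exponent_le (by exact_mod_cast (by omega : 1 ≤ n)) hβ0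
    have h2 : t ≤ n ^ β := by exact_mod_cast h1
    calc t ≤ (2 ^ l) ^ β := h2.trans (Nat.pow_le_pow_left hnl β)
      _ = 2 ^ (β * l) := by rw [← pow_mul, mul_comm]
      _ < 2 ^ (β * l + 1) := Nat.pow_lt_pow_right one_lt_two (Nat.lt_succ_self _)
  obtain ⟨hguess, hroom⟩ := GuidedSampling.room_of_large hnK hl hKc hl1 hcard hth hhK
  have hsqrt := GuidedSampling.sqrt_eq hnK
  have hmain := GuidedSampling.experiment_toOuterMeasure_le alg E ψ hψ
    (GuidedSampling.farEvent n t E) (P := 2 ^ (n * l)) (by positivity) (by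
      intro vs xs T hT Bad hsub hBad
      refine GuidedSampling.card_far_mul_le hnK (by omega) E hreg (x := 3 * K ^ 3 * l)
        (by positivity) (Nat.succ_pos _) hth ?_ ((Nat.cast_le.2 hg₁).trans hE.girth) hg₂ ?_
        hguess hroom vs xs T (fun π _ => hsqrt ▸ halg π xs T hT) hsub hBad
      · intro k hk
        rw [GuidedSampling.depthSeq, hsqrt, hl, hnK]
        calc (k + 2) * (3 * K ^ 3 * l) ≤ (3 * k) * (3 * K ^ 3 * l) :=
              Nat.mul_le_mul_right _ (by omega)
          _ = 9 * (k * K ^ 3 * l) := by ring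
          _ ≤ 10 * (k * K ^ 3 * l) := Nat.mul_le_mul_right _ (by norm_num)
          _ = k * (10 * (K ^ 2 * K) * l) := by ring
      · intro r hr hrK
        have h1 : (r + 1) * K ≤ K * K := Nat.mul_le_mul_right _ hrK
        have h2 : 1 ≤ K * K := Nat.mul_pos (by omega) (by omega)
        rw [hnK]
        refine GuidedSampling.pow_mul_pow_le (by omega) hl1 ?_ ?_ <;>
          rw [GuidedSampling.degSeq_eq rfl]
        · rw [GuidedSampling.degSeq_eq rfl]
          rw [add_mul, one_mul] at h1 ⊢
          rw [sq]
          omega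
        · omega)
  -- `l = ⌈log₂ n⌉` may exceed `log₂ n`, in the favorable direction.
  refine hmain.trans ?_
  have hlog : (n : ℝ) * Real.logb 2 n ≤ ((n * l : ℕ) : ℝ) := by
    rw [Nat.cast_mul]
    refine mul_le_mul_of_nonneg_left ?_ (Nat.cast_nonneg n)
    rw [Real.logb_le_iff_le_rpow one_lt_two (by exact_mod_cast (by omega : 0 < n)),
      Real.rpow_natCast]
    exact_mod_cast hnl
  calc (((2 ^ (n * l) : ℕ) : ENNReal))⁻¹ = ENNReal.ofReal ((2 : ℝ) ^ (-((n * l : ℕ) : ℝ))) := by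
        rw [Real.rpow_neg zero_le_two, Real.rpow_natCast, ENNReal.ofReal_inv_of_pos (by positivity),
          ENNReal.ofReal_pow zero_le_two]
        simp
    _ ≤ ENNReal.ofReal ((2 : ℝ) ^ (-((n : ℝ) * Real.logb 2 n))) :=
        ENNReal.ofReal_le_ofReal
          (Real.rpow_le_rpow_of_exponent_le one_le_two (neg_le_neg hlog))
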